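/- Let $k$ be an algebraically closed field, of arbitrary characteristic; a variety over $k$ is an integral separated scheme of finite type over $k$. Toric varieties. Let $N=\mathbb Z^d$, $N_{\mathbb R}=\mathbb R^d$, and let $M$ be the lattice dual to $N$. A fan $\Sigma$ is a finite nonempty collection of strongly convex rational polyhedral cones in $N_{\mathbb R}$ that contains all faces of its members and in which the intersection of any two members is a face of both. For a cone $\sigma$ let $S_\sigma=\{m\in M : m\ge 0 \text{ on } \sigma\}$ and $U_\sigma=\operatorname{Spec} k[S_\sigma]$. The (normal) toric variety $X_\Sigma$ is obtained by gluing the $U_\sigma$, $\sigma\in\Sigma$, along the open subschemes $U_\tau\subseteq U_\sigma$ for the faces $\tau$ of $\sigma$. A toric variety over $k$ is a variety isomorphic over $k$ to some $X_\Sigma$; it is automatically normal. Higher Nash modifications. Let $X$ be a variety over $k$ of dimension $d$, let $n\ge 1$, and let $\mathcal P^n_X=\mathcal O_{X\times X}/\mathcal I^{n+1}$, where $\mathcal I$ is the ideal of the diagonal. It is a coherent $\mathcal O_X$-module (through the first projection), locally free of rank $r=\binom{n+d}{d}$ on the regular locus $X_{reg}$. Let $G\to X$ be the Grassmannian of locally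 free quotients of rank $r$ of $\mathcal P^n_X$. The identity of $\mathcal P^n_X|_{X_{reg}}$ defines a section of $G$ over $X_{reg}$. The $n$-th Nash modification $\mathcal N_n(X)$ is the closure of the image of this section in $G$, with its reduced structure, and $\pi_n:\mathcal N_n(X)\to X$ is the projection. Theorem. Let $X$ be a (normal) toric variety over the algebraically closed field $k$, of any characteristic, and let $n\ge 1$ be an integer. Then $\pi_n:\mathcal N_n(X)\to X$ is an isomorphism if and only if $X$ is nonsingular, that is, all local rings of $X$ are regular. -/

import Mathlib

open CategoryTheory AlgebraicGeometry

universe u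

noncomputable section

namespace HigherNash

section Cones
variable {d : ℕ}

/-- The inclusion of the lattice `N = ℤᵈ` into `N_ℝ = ℝᵈ`. -/
def latticeVec (v : Fin d → ℤ) : Fin d → ℝ := fun i => (v i : ℝ)

/-- Strongly convex rational polyhedral cones in `ℝᵈ`: the cones generated by finitely many
elements of the lattice `ℤᵈ` that contain no line. -/
def IsSCRPC (σ : PointedCone ℝ (Fin d → ℝ)) : Prop :=
  (∃ S : Finset (Fin d → ℤ), σ = PointedCone.hull ℝ (latticeVec '' (S : Set (Fin d → ℤ)))) ∧
    ∀ x ∈ σ, -x ∈ σ → x = 0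

/-- The faces of a cone `σ`: the sets `{x ∈ σ | u(x) = 0}`, where `u` is a linear form on `ℝᵈ` with
nonnegative values on `σ`. -/
def IsFace (τ σ : PointedCone ℝ (Fin d → ℝ)) : Prop :=
  ∃ u : Fin d → ℝ, (∀ x ∈ σ, 0 ≤ u ⬝ᵥ x) ∧ ∀ x, x ∈ τ ↔ x ∈ σ ∧ u ⬝ᵥ x = 0

/-- Fans in `ℝᵈ` (with respect to the lattice `ℤᵈ`): finite nonempty collections of strongly convex
rational polyhedral cones that contain the faces of their members and such that the intersection of two
members is a face of each. -/
structure Fan (d : ℕ) where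
  cones : Set (PointedCone ℝ (Fin d → ℝ))
  finite : cones.Finite
  nonempty : cones.Nonempty
  isSCRPC : ∀ σ ∈ cones, IsSCRPC σ
  face_mem : ∀ σ ∈ cones, ∀ τ, IsFace τ σ → τ ∈ cones
  inter_isFace : ∀ σ ∈ cones, ∀ τ ∈ cones, IsFace (σ ⊓ τ) σ ∧ IsFace (σ ⊓ τ) τ

/-- The monoid `S_σ = σ^∨ ∩ M` of the elements of the dual lattice `M = ℤᵈ` that are nonnegative on `σ`;
the pairing of `M_ℝ` and `N_ℝ` is the standard scalar product of `ℝᵈ`. -/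
def dualMonoid (σ : PointedCone ℝ (Fin d → ℝ)) : AddSubmonoid (Fin d → ℤ) where
  carrier := {m | ∀ x ∈ σ, 0 ≤ latticeVec m ⬝ᵥ x}
  zero_mem' x _ := by simp [latticeVec, dotProduct]
  add_mem' {a b} ha hb x hx := by
    have : latticeVec (a + b) = latticeVec a + latticeVec b := by
      ext i
      simp [latticeVec]
    rw [this, add_dotProduct]
    exact add_nonneg (ha x hx) (hb x hx)

lemma dualMonoid_le {σ τ : PointedCone ℝ (Fin d → ℝ)} (h : τ ≤ σ) :
    dualMonoid σ ≤ dualMonoid τ := fun _ hm x hx => hm x (h hx)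

lemma dotProduct_nonneg_hull (S : Set (Fin d → ℝ)) (u : Fin d → ℝ) (h : ∀ v ∈ S, 0 ≤ u ⬝ᵥ v)
    (x : Fin d → ℝ) (hx : x ∈ PointedCone.hull ℝ S) : 0 ≤ u ⬝ᵥ x := by
  induction hx using Submodule.span_induction with
  | mem x hx => exact h x hx
  | zero => simp
  | add x y _ _ hx hy =>
    rw [dotProduct_add]
    exact add_nonneg hx hy
  | smul a x _ hx =>
    change 0 ≤ u ⬝ᵥ ((a : ℝ) • x)
    rw [dotProduct_smul]
    exact mul_nonneg a.2 hx

/-- a point of the hull where `u` vanishes is in the hull of the generators where it vanishes -/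
lemma mem_hull_of_dotProduct_eq_zero (S : Set (Fin d → ℝ)) (u : Fin d → ℝ)
    (h : ∀ v ∈ S, 0 ≤ u ⬝ᵥ v) (x : Fin d → ℝ) (hx : x ∈ PointedCone.hull ℝ S)
    (hux : u ⬝ᵥ x = 0) : x ∈ PointedCone.hull ℝ {v ∈ S | u ⬝ᵥ v = 0} := by
  induction hx using Submodule.span_induction with
  | mem x hx => exact Submodule.subset_span ⟨hx, hux⟩
  | zero => exact Submodule.zero_mem _
  | add x y hx' hy' hx hy =>
    rw [dotProduct_add] at hux
    have h1 := dotProduct_nonneg_hull S u h x hx'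
    have h2 := dotProduct_nonneg_hull S u h y hy'
    exact Submodule.add_mem _ (hx (by linarith)) (hy (by linarith))
  | smul a x hx' hx =>
    change u ⬝ᵥ ((a : ℝ) • x) = 0 at hux
    rw [dotProduct_smul, smul_eq_mul, mul_eq_zero] at hux
    rcases hux with ha | hux
    · have : a = 0 := Subtype.ext ha
      rw [this, zero_smul]
      exact Submodule.zero_mem _
    · exact Submodule.smul_mem _ _ (hx hux)

/-- A real linear form can be replaced by an integral one with the same signs. -/
lemma exists_integral_form (S : Finset (Fin d → ℤ)) (u : Fin d → ℝ)
    (h : ∀ v ∈ S, 0 ≤ u ⬝ᵥ latticeVec v) :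
    ∃ m : Fin d → ℤ, ∀ v ∈ S, 0 ≤ latticeVec m ⬝ᵥ latticeVec v ∧
      (latticeVec m ⬝ᵥ latticeVec v = 0 ↔ u ⬝ᵥ latticeVec v = 0) := by
  -- coordinates of `u` in a rational basis of their span
  let W : Submodule ℚ ℝ := Submodule.span ℚ (Set.range u)
  have : Module.Finite ℚ W := Module.Finite.span_of_finite ℚ (Set.finite_range u)
  let b := Module.finBasis ℚ W
  let c : Fin d → Fin (Module.finrank ℚ W) → ℚ := fun i j =>
    b.repr ⟨u i, Submodule.subset_span ⟨i, rfl⟩⟩ j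
  have hu : ∀ i, u i = ∑ j, (c i j : ℝ) * (b j : ℝ) := by
    intro i
    have := b.sum_repr ⟨u i, Submodule.subset_span ⟨i, rfl⟩⟩
    have h2 := congrArg (fun w : W => (w : ℝ)) this
    simp only [Submodule.coe_sum, Submodule.coe_smul] at h2
    rw [← h2]
    exact Finset.sum_congr rfl fun j _ => by rw [Rat.smul_def]
  -- the rational form attached to a point near `b`
  let p : (Fin d → ℤ) → Fin (Module.finrank ℚ W) → ℚ := fun v j => ∑ i, c i j * v i
  have hpair : ∀ v, u ⬝ᵥ latticeVec v = ∑ j, (p v j : ℝ) * (b j : ℝ) := by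
    intro v
    simp only [dotProduct, latticeVec, hu, p, Rat.cast_sum, Rat.cast_mul, Rat.cast_intCast,
      Finset.sum_mul]
    rw [Finset.sum_comm]
    exact Finset.sum_congr rfl fun j _ => Finset.sum_congr rfl fun i _ => by ring
  have hzero : ∀ v, u ⬝ᵥ latticeVec v = 0 → ∀ j, p v j = 0 := by
    intro v hv
    have hli := Fintype.linearIndependent_iff.mp b.linearIndependent (p v) (by
      apply Subtype.ext
      simp only [Submodule.coe_sum, Submodule.coe_smul, ZeroMemClass.coe_zero]
      rw [← hv, hpair]
      exact Finset.sum_congr rfl fun j _ => by rw [Rat.smul_def])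
    exact hli
  -- choose a rational point near `b`
  obtain ⟨q, hq⟩ : ∃ q : Fin (Module.finrank ℚ W) → ℚ, ∀ v ∈ S, 0 < u ⬝ᵥ latticeVec v →
      0 < ∑ j, (p v j : ℝ) * (q j : ℝ) := by
    let O : Set (Fin (Module.finrank ℚ W) → ℝ) :=
      ⋂ v ∈ S.filter (fun v => 0 < u ⬝ᵥ latticeVec v), {y | 0 < ∑ j, (p v j : ℝ) * y j}
    have hO : IsOpen O := by
      refine isOpen_biInter_finset fun v _ => isOpen_lt continuous_const ?_
      fun_prop
    have hne : O.Nonempty := by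
      refine ⟨fun j => (b j : ℝ), ?_⟩
      simp only [O, Set.mem_iInter, Set.mem_ofPred_eq, Finset.mem_filter]
      rintro v ⟨-, hv⟩
      rwa [← hpair]
    have hd : DenseRange (fun (q : Fin (Module.finrank ℚ W) → ℚ) j => (q j : ℝ)) :=
      DenseRange.piMap fun _ => Rat.denseRange_cast
    obtain ⟨q, hq⟩ := hd.exists_mem_open hO hne
    refine ⟨q, fun v hv hv' => ?_⟩
    simp only [O, Set.mem_iInter, Set.mem_ofPred_eq, Finset.mem_filter] at hq
    exact hq v ⟨hv, hv'⟩
  -- clear denominators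
  let w : Fin d → ℚ := fun i => ∑ j, c i j * q j
  let D : ℕ := ∏ i, (w i).den
  have hD : 0 < D := Finset.prod_pos fun i _ => (w i).den_pos
  have hint : ∀ i, ∃ z : ℤ, (z : ℚ) = D * w i := by
    intro i
    obtain ⟨e, he⟩ : (w i).den ∣ D := Finset.dvd_prod_of_mem _ (Finset.mem_univ i)
    refine ⟨e * (w i).num, ?_⟩
    rw [he]
    push_cast
    rw [mul_comm ((w i).den : ℚ), mul_assoc, Rat.den_mul_eq_num]
  choose m hm using hint
  have hm' : ∀ v, latticeVec m ⬝ᵥ latticeVec v = D * ∑ j, (p v j : ℝ) * (q j : ℝ) := by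
    intro v
    have : ∀ i, (m i : ℝ) = D * ∑ j, (c i j : ℝ) * (q j : ℝ) := by
      intro i
      have := congrArg (fun z : ℚ => (z : ℝ)) (hm i)
      simpa [w] using this
    simp only [dotProduct, latticeVec, this, p, Rat.cast_sum, Rat.cast_mul, Rat.cast_intCast,
      Finset.sum_mul, Finset.mul_sum]
    rw [Finset.sum_comm]
    exact Finset.sum_congr rfl fun j _ => Finset.sum_congr rfl fun i _ => by ring
  refine ⟨m, fun v hv => ?_⟩
  have hDr : (0 : ℝ) < D := by exact_mod_cast hD
  rcases (h v hv).eq_or_lt with h0 | h0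
  · have : latticeVec m ⬝ᵥ latticeVec v = 0 := by
      rw [hm', Finset.sum_eq_zero, mul_zero]
      intro j _
      rw [hzero v h0.symm j, Rat.cast_zero, zero_mul]
    exact ⟨this.ge, fun _ => h0.symm, fun _ => this⟩
  · have : 0 < latticeVec m ⬝ᵥ latticeVec v := by
      rw [hm']
      exact mul_pos hDr (hq v hv h0)
    exact ⟨this.le, fun h => absurd h this.ne', fun h => absurd h h0.ne'⟩

lemma dotProduct_eq_zero_hull (S : Set (Fin d → ℝ)) (u : Fin d → ℝ) (h : ∀ v ∈ S, u ⬝ᵥ v = 0)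
    (x : Fin d → ℝ) (hx : x ∈ PointedCone.hull ℝ S) : u ⬝ᵥ x = 0 := by
  have h1 := dotProduct_nonneg_hull S u (fun v hv => (h v hv).ge) x hx
  have h2 := dotProduct_nonneg_hull S (-u) (fun v hv => by rw [neg_dotProduct, h v hv, neg_zero])
    x hx
  rw [neg_dotProduct] at h2
  linarith

/-- Every face of a rational polyhedral cone is cut out by an integral linear form. -/
lemma IsFace.exists_integral {σ τ : PointedCone ℝ (Fin d → ℝ)} (hσ : IsSCRPC σ)
    (h : IsFace τ σ) :
    ∃ m ∈ dualMonoid σ, ∀ x, x ∈ τ ↔ x ∈ σ ∧ latticeVec m ⬝ᵥ x = 0 := by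
  obtain ⟨⟨S, rfl⟩, -⟩ := hσ
  obtain ⟨u, hu, hτ⟩ := h
  have hS : ∀ v ∈ S, latticeVec v ∈
      PointedCone.hull ℝ (latticeVec '' (S : Set (Fin d → ℤ))) :=
    fun v hv => Submodule.subset_span ⟨v, hv, rfl⟩
  obtain ⟨m, hm⟩ := exists_integral_form S u fun v hv => hu _ (hS v hv)
  refine ⟨m, ?_, fun x => ?_⟩
  · refine dotProduct_nonneg_hull _ _ ?_
    rintro _ ⟨v, hv, rfl⟩
    exact (hm v hv).1
  · rw [hτ]
    refine and_congr_right fun hx => ⟨fun h0 => ?_, fun h0 => ?_⟩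
    · refine dotProduct_eq_zero_hull _ _ ?_ x (mem_hull_of_dotProduct_eq_zero _ u (by
        rintro _ ⟨v, hv, rfl⟩
        exact hu _ (hS v hv)) x hx h0)
      rintro _ ⟨⟨v, hv, rfl⟩, hv0⟩
      exact (hm v hv).2.mpr hv0
    · refine dotProduct_eq_zero_hull _ _ ?_ x (mem_hull_of_dotProduct_eq_zero _ (latticeVec m) (by
        rintro _ ⟨v, hv, rfl⟩
        exact (hm v hv).1) x hx h0)
      rintro _ ⟨⟨v, hv, rfl⟩, hv0⟩
      exact (hm v hv).2.mp hv0

/-- If `m ∈ S_σ` cuts out the face `τ` then `S_τ = S_σ + ℕ(-m)`. -/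
lemma exists_add_nsmul_mem {σ τ : PointedCone ℝ (Fin d → ℝ)} (hσ : IsSCRPC σ) {m : Fin d → ℤ}
    (hm : m ∈ dualMonoid σ) (hτ : ∀ x, x ∈ τ ↔ x ∈ σ ∧ latticeVec m ⬝ᵥ x = 0) :
    -m ∈ dualMonoid τ ∧ ∀ a ∈ dualMonoid τ, ∃ N : ℕ, a + N • m ∈ dualMonoid σ := by
  obtain ⟨⟨S, rfl⟩, -⟩ := hσ
  have hS : ∀ v ∈ S, latticeVec v ∈
      PointedCone.hull ℝ (latticeVec '' (S : Set (Fin d → ℤ))) :=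
    fun v hv => Submodule.subset_span ⟨v, hv, rfl⟩
  have hcast : ∀ a b : Fin d → ℤ, latticeVec a ⬝ᵥ latticeVec b = ((a ⬝ᵥ b : ℤ) : ℝ) := by
    intro a b
    simp [dotProduct, latticeVec]
  refine ⟨fun x hx => ?_, fun a ha => ?_⟩
  · have : latticeVec (-m) = -latticeVec m := by
      ext i
      simp [latticeVec]
    rw [this, neg_dotProduct, ((hτ x).mp hx).2, neg_zero]
  · have key : ∀ v ∈ S, ∃ N : ℕ, ∀ M : ℕ, N ≤ M → 0 ≤ (a + M • m) ⬝ᵥ v := by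
      intro v hv
      have h1 := hm _ (hS v hv)
      rw [hcast] at h1
      rcases (show (0 : ℤ) ≤ m ⬝ᵥ v by exact_mod_cast h1).eq_or_lt with h0 | h0
      · refine ⟨0, fun M _ => ?_⟩
        have h2 : latticeVec v ∈ τ := (hτ _).mpr ⟨hS v hv, by rw [hcast, ← h0, Int.cast_zero]⟩
        have h3 := ha _ h2
        rw [hcast] at h3
        rw [add_dotProduct, smul_dotProduct, ← h0, smul_zero, add_zero]
        exact_mod_cast h3
      · refine ⟨(a ⬝ᵥ v).natAbs, fun M hM => ?_⟩
        rw [add_dotProduct, smul_dotProduct, nsmul_eq_mul]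
        have : (M : ℤ) ≤ M * (m ⬝ᵥ v) := le_mul_of_one_le_right (by positivity) h0
        omega
    choose! N hN using key
    refine ⟨S.sup N, ?_⟩
    refine dotProduct_nonneg_hull _ _ ?_
    rintro _ ⟨v, hv, rfl⟩
    rw [hcast]
    exact_mod_cast hN v hv _ (Finset.le_sup hv)

end Cones

section Toric
open Limits
variable {d : ℕ} (k : Type u) [Field k]

/-- The monoid algebra `k[S_σ]`. -/
abbrev ConeAlgebra (σ : PointedCone ℝ (Fin d → ℝ)) : Type u := AddMonoidAlgebra k (dualMonoid σ)

/-- The element `χ^m` of `k[S_σ]`, for `m ∈ S_σ`. -/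
def coneCharacter {k : Type u} [Field k] {σ : PointedCone ℝ (Fin d → ℝ)} {m : Fin d → ℤ} (hm : m ∈ dualMonoid σ) :
    ConeAlgebra k σ := AddMonoidAlgebra.single ⟨m, hm⟩ 1

/-- The inclusion `k[S_σ] → k[S_τ]` for `τ ⊆ σ`. -/
def coneAlgebraMap {σ τ : PointedCone ℝ (Fin d → ℝ)} (h : τ ≤ σ) :
    ConeAlgebra k σ →+* ConeAlgebra k τ :=
  AddMonoidAlgebra.mapDomainRingHom k (AddSubmonoid.inclusion (dualMonoid_le h))

lemma coneAlgebraMap_single {σ τ : PointedCone ℝ (Fin d → ℝ)} (h : τ ≤ σ) (m : dualMonoid σ)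
    (a : k) : coneAlgebraMap k h (AddMonoidAlgebra.single m a) =
      AddMonoidAlgebra.single ⟨m.1, dualMonoid_le h m.2⟩ a :=
  AddMonoidAlgebra.mapDomain_single ..

lemma coneAlgebraMap_injective {σ τ : PointedCone ℝ (Fin d → ℝ)} (h : τ ≤ σ) :
    Function.Injective (coneAlgebraMap k h) :=
  AddMonoidAlgebra.mapDomain_injective (AddSubmonoid.inclusion_injective _)

lemma coneAlgebraMap_id {σ : PointedCone ℝ (Fin d → ℝ)} (h : σ ≤ σ) :
    coneAlgebraMap k h = RingHom.id _ := by
  apply RingHom.ext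
  intro x
  induction x using AddMonoidAlgebra.induction_linear with
  | zero => simp
  | add x y hx hy => rw [map_add, hx, hy, map_add]
  | single m a => rw [coneAlgebraMap_single]; rfl

lemma coneAlgebraMap_comp {σ τ ρ : PointedCone ℝ (Fin d → ℝ)} (h : τ ≤ σ) (h' : ρ ≤ τ) :
    coneAlgebraMap k (h'.trans h) = (coneAlgebraMap k h').comp (coneAlgebraMap k h) := by
  apply RingHom.ext
  intro x
  induction x using AddMonoidAlgebra.induction_linear with
  | zero => simp only [map_zero]
  | add x y hx hy => rw [map_add, hx, hy, map_add]
  | single m a =>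
    rw [RingHom.comp_apply, coneAlgebraMap_single, coneAlgebraMap_single, coneAlgebraMap_single]

lemma isLocalization_coneAlgebra {σ τ : PointedCone ℝ (Fin d → ℝ)} (h : τ ≤ σ)
    {u : Fin d → ℤ} (hu : u ∈ dualMonoid σ) (hu' : -u ∈ dualMonoid τ)
    (H : ∀ m ∈ dualMonoid τ, ∃ N : ℕ, m + N • u ∈ dualMonoid σ) :
    letI := (coneAlgebraMap k h).toAlgebra
    IsLocalization.Away (coneCharacter (k := k) hu) (ConeAlgebra k τ) := by
  let _ := (coneAlgebraMap k h).toAlgebra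
  have hu1 : coneAlgebraMap k h (coneCharacter hu) = coneCharacter (dualMonoid_le h hu) :=
    coneAlgebraMap_single ..
  refine IsLocalization.Away.mk _ ?_ ?_ ?_
  · rw [RingHom.algebraMap_toAlgebra, hu1]
    refine IsUnit.of_mul_eq_one (coneCharacter hu') ?_
    rw [coneCharacter, coneCharacter, AddMonoidAlgebra.single_mul_single, AddMonoidAlgebra.one_def,
      one_mul]
    congr 1
    exact Subtype.ext (add_neg_cancel u)
  · intro x
    rw [RingHom.algebraMap_toAlgebra]
    induction x using AddMonoidAlgebra.induction_linear with
    | zero => exact ⟨0, 0, by simp⟩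
    | add x y hx hy =>
      obtain ⟨N, a, ha⟩ := hx
      obtain ⟨M, b, hb⟩ := hy
      refine ⟨N + M, a * coneCharacter hu ^ M + b * coneCharacter hu ^ N, ?_⟩
      rw [map_add, map_mul, map_mul, ← ha, ← hb, map_pow, map_pow]
      ring
    | single m a =>
      obtain ⟨N, hN⟩ := H m.1 m.2
      refine ⟨N, AddMonoidAlgebra.single ⟨_, hN⟩ a, ?_⟩
      rw [hu1, coneAlgebraMap_single, coneCharacter, AddMonoidAlgebra.single_pow,
        AddMonoidAlgebra.single_mul_single, one_pow, mul_one]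
      rfl
  · intro a b hab
    exact ⟨0, congrArg _ (coneAlgebraMap_injective k h hab)⟩

/-- The affine toric variety `U_σ = Spec k[S_σ]`. -/
def affineToric (σ : PointedCone ℝ (Fin d → ℝ)) : Scheme.{u} :=
  Spec (CommRingCat.of (ConeAlgebra k σ))

/-- The morphism `U_τ ⟶ U_σ` for `τ ⊆ σ`. It is an open immersion if `τ` is a face of `σ`. -/
def affineToricMap {σ τ : PointedCone ℝ (Fin d → ℝ)} (h : τ ≤ σ) :
    affineToric k τ ⟶ affineToric k σ :=
  Spec.map (CommRingCat.ofHom (coneAlgebraMap k h))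

lemma affineToricMap_comp {σ τ ρ : PointedCone ℝ (Fin d → ℝ)} (h : τ ≤ σ) (h' : ρ ≤ τ) :
    affineToricMap k (h'.trans h) = affineToricMap k h' ≫ affineToricMap k h := by
  refine (congrArg (fun q => Spec.map (CommRingCat.ofHom q)) (coneAlgebraMap_comp k h h')).trans ?_
  exact Spec.map_comp (CommRingCat.ofHom (coneAlgebraMap k h))
    (CommRingCat.ofHom (coneAlgebraMap k h'))

/-- The structure morphism `U_σ ⟶ Spec k`. -/
def affineToricStructure (σ : PointedCone ℝ (Fin d → ℝ)) :
    affineToric k σ ⟶ Spec (CommRingCat.of k) :=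
  Spec.map (CommRingCat.ofHom (algebraMap k (ConeAlgebra k σ)))

lemma affineToricMap_comp_structure {σ τ : PointedCone ℝ (Fin d → ℝ)} (h : τ ≤ σ) :
    affineToricMap k h ≫ affineToricStructure k σ = affineToricStructure k τ := by
  refine (Spec.map_comp (CommRingCat.ofHom (algebraMap k (ConeAlgebra k σ)))
    (CommRingCat.ofHom (coneAlgebraMap k h))).symm.trans ?_
  refine congrArg (fun q => Spec.map (CommRingCat.ofHom q)) (RingHom.ext fun a => ?_)
  exact coneAlgebraMap_single k h 0 a

lemma isOpenImmersion_affineToricMap {σ τ : PointedCone ℝ (Fin d → ℝ)} (h : τ ≤ σ)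
    {u : Fin d → ℤ} (hu : u ∈ dualMonoid σ) (hu' : -u ∈ dualMonoid τ)
    (H : ∀ m ∈ dualMonoid τ, ∃ N : ℕ, m + N • u ∈ dualMonoid σ) :
    IsOpenImmersion (affineToricMap k h) := by
  let _ := (coneAlgebraMap k h).toAlgebra
  have := isLocalization_coneAlgebra k h hu hu' H
  exact IsOpenImmersion.of_isLocalization (coneCharacter (k := k) hu)

lemma range_affineToricMap {σ τ : PointedCone ℝ (Fin d → ℝ)} (h : τ ≤ σ)
    {u : Fin d → ℤ} (hu : u ∈ dualMonoid σ) (hu' : -u ∈ dualMonoid τ)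
    (H : ∀ m ∈ dualMonoid τ, ∃ N : ℕ, m + N • u ∈ dualMonoid σ) :
    Set.range (affineToricMap k h) =
      (PrimeSpectrum.basicOpen (coneCharacter (k := k) hu) :
        Set (PrimeSpectrum (ConeAlgebra k σ))) := by
  let _ := (coneAlgebraMap k h).toAlgebra
  have := isLocalization_coneAlgebra k h hu hu' H
  exact PrimeSpectrum.localization_away_comap_range (ConeAlgebra k τ) (coneCharacter (k := k) hu)

namespace Fan
variable (F : Fan d)

/-- The cones of a fan, ordered by inclusion (that is, by the face relation). -/
abbrev Index : Type := {σ : PointedCone ℝ (Fin d → ℝ) // σ ∈ F.cones}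

lemma isFace_of_le {F : Fan d} {τ σ : F.Index} (h : τ ≤ σ) : IsFace τ.1 σ.1 := by
  have := (F.inter_isFace σ.1 σ.2 τ.1 τ.2).1
  rwa [inf_eq_right.mpr (show τ.1 ≤ σ.1 from h)] at this

/-- The affine toric varieties `U_σ`, for `σ` in the fan, and the open immersions `U_τ ⟶ U_σ` for the
faces `τ` of `σ`. -/
def diagram : F.Index ⥤ Scheme.{u} where
  obj σ := affineToric k σ.1
  map h := affineToricMap k (leOfHom h)
  map_id _ := by
    refine (congrArg (fun q => Spec.map (CommRingCat.ofHom q)) (coneAlgebraMap_id k le_rfl)).trans ?_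
    exact Spec.map_id _
  map_comp h h' := affineToricMap_comp k (leOfHom h') (leOfHom h)

instance {τ σ : F.Index} (h : τ ⟶ σ) : IsOpenImmersion ((F.diagram k).map h) := by
  obtain ⟨u, hu, hτ⟩ := (isFace_of_le (leOfHom h)).exists_integral (F.isSCRPC _ σ.2)
  obtain ⟨hu', H⟩ := exists_add_nsmul_mem (F.isSCRPC _ σ.2) hu hτ
  exact isOpenImmersion_affineToricMap k (leOfHom h) hu hu' H

lemma affineToricMap_directed {i j σ : F.Index} (hi : i ≤ σ) (hj : j ≤ σ) (x : affineToric k i.1)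
    (y : affineToric k j.1) (h : affineToricMap k hi x = affineToricMap k hj y) :
    ∃ (l : F.Index) (hli : l ≤ i) (hlj : l ≤ j) (z : affineToric k l.1),
      affineToricMap k hli z = x ∧ affineToricMap k hlj z = y := by
  obtain ⟨u, hu, hτu⟩ := (isFace_of_le hi).exists_integral (F.isSCRPC _ σ.2)
  obtain ⟨v, hv, hτv⟩ := (isFace_of_le hj).exists_integral (F.isSCRPC _ σ.2)
  obtain ⟨hu', Hu⟩ := exists_add_nsmul_mem (F.isSCRPC _ σ.2) hu hτu
  obtain ⟨hv', Hv⟩ := exists_add_nsmul_mem (F.isSCRPC _ σ.2) hv hτv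
  let l : F.Index := ⟨i.1 ⊓ j.1, F.face_mem _ i.2 _ (F.inter_isFace _ i.2 _ j.2).1⟩
  have hli : l ≤ i := show i.1 ⊓ j.1 ≤ i.1 from inf_le_left
  have hlj : l ≤ j := show i.1 ⊓ j.1 ≤ j.1 from inf_le_right
  have hl : l ≤ σ := hli.trans hi
  have huv := (dualMonoid σ.1).add_mem hu hv
  have hτl : ∀ x, x ∈ l.1 ↔ x ∈ σ.1 ∧ latticeVec (u + v) ⬝ᵥ x = 0 := by
    intro x
    have hadd : latticeVec (u + v) = latticeVec u + latticeVec v := by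
      ext i
      simp [latticeVec]
    change x ∈ i.1 ∧ x ∈ j.1 ↔ _
    rw [hτu, hτv, hadd, add_dotProduct]
    constructor
    · rintro ⟨⟨h1, h2⟩, -, h3⟩
      exact ⟨h1, by rw [h2, h3, add_zero]⟩
    · rintro ⟨h1, h2⟩
      have h3 := hu x h1
      have h4 := hv x h1
      exact ⟨⟨h1, by linarith⟩, h1, by linarith⟩
  obtain ⟨huv', Huv⟩ := exists_add_nsmul_mem (F.isSCRPC _ σ.2) huv hτl
  have hmul : coneCharacter (k := k) huv = coneCharacter hu * coneCharacter hv := by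
    rw [coneCharacter, coneCharacter, coneCharacter, AddMonoidAlgebra.single_mul_single, one_mul]
    rfl
  have hmem : affineToricMap k hi x ∈ Set.range (affineToricMap k hl) := by
    rw [range_affineToricMap k hl huv huv' Huv, hmul, PrimeSpectrum.basicOpen_mul]
    refine ⟨?_, ?_⟩
    · have h1 : affineToricMap k hi x ∈ Set.range (affineToricMap k hi) := ⟨x, rfl⟩
      rwa [range_affineToricMap k hi hu hu' Hu] at h1
    · have h1 : affineToricMap k hi x ∈ Set.range (affineToricMap k hj) := ⟨y, h.symm⟩
      rwa [range_affineToricMap k hj hv hv' Hv] at h1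
  obtain ⟨z, hz⟩ := hmem
  have := isOpenImmersion_affineToricMap k hi hu hu' Hu
  have := isOpenImmersion_affineToricMap k hj hv hv' Hv
  refine ⟨l, hli, hlj, z, ?_, ?_⟩
  · apply (affineToricMap k hi).isOpenEmbedding.injective
    rw [← hz, ← Scheme.Hom.comp_apply, ← affineToricMap_comp]
  · apply (affineToricMap k hj).isOpenEmbedding.injective
    rw [← h, ← hz, ← Scheme.Hom.comp_apply, ← affineToricMap_comp]

instance : (F.diagram k ⋙ Scheme.forget).IsLocallyDirected where
  cond {i j σ} fi fj x y h := by
    obtain ⟨l, hli, hlj, z, hx, hy⟩ :=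
      F.affineToricMap_directed k (leOfHom fi) (leOfHom fj) x y h
    exact ⟨l, homOfLE hli, homOfLE hlj, z, hx, hy⟩

/-- The toric variety of a fan: the affine toric varieties `U_σ` of its cones are glued along the open
subschemes `U_τ` for the common faces `τ`. -/
def toricScheme : Scheme.{u} := colimit (F.diagram k)

/-- The structure morphism `X_Σ ⟶ Spec k` of the toric variety of a fan. -/
def toricStructure : F.toricScheme k ⟶ Spec (CommRingCat.of k) :=
  colimit.desc (F.diagram k)
    { pt := Spec (CommRingCat.of k)
      ι :=
        { app := fun σ => affineToricStructure k σ.1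
          naturality := fun _ _ h =>
            (affineToricMap_comp_structure k (leOfHom h)).trans (Category.comp_id _).symm } }

end Fan
/-- A scheme `X` over `k` is a (normal) toric variety if it is isomorphic over `k` to the toric variety
of a fan in `ℝᵈ`, for some `d`. -/
def IsToricVariety {k : Type u} [Field k] {X : Scheme.{u}} (s : X ⟶ Spec (CommRingCat.of k)) : Prop :=
  ∃ (d : ℕ) (F : Fan d) (e : X ≅ F.toricScheme k), e.hom ≫ F.toricStructure k = s

/-- A scheme is nonsingular if all its local rings are regular. -/
def IsNonsingular (X : Scheme.{u}) : Prop := ∀ x : X, IsRegularLocalRing (X.presheaf.stalk x)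

end Toric

section Graded
variable {R S : Type u} [CommRing R] [CommRing S] {σ τ : Type u} [SetLike σ R]
  [AddSubgroupClass σ R] [SetLike τ S] [AddSubgroupClass τ S] {𝒜 : ℕ → σ} {ℬ : ℕ → τ}
  [GradedRing 𝒜] [GradedRing ℬ]

lemma awayMap_injective (g : GradedRingHom 𝒜 ℬ) (hg : Function.Injective g) (s : R) :
    Function.Injective (HomogeneousLocalization.Away.map g s) := by
  intro a b hab
  obtain ⟨x, rfl⟩ := HomogeneousLocalization.mk_surjective a
  obtain ⟨y, rfl⟩ := HomogeneousLocalization.mk_surjective b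
  replace hab := congrArg HomogeneousLocalization.val hab
  apply HomogeneousLocalization.val_injective
  rw [HomogeneousLocalization.Away.map, HomogeneousLocalization.map_mk,
    HomogeneousLocalization.map_mk] at hab
  rw [HomogeneousLocalization.val_mk, HomogeneousLocalization.val_mk, Localization.mk_eq_mk_iff,
    Localization.r_iff_exists] at hab ⊢
  obtain ⟨⟨_, l, rfl⟩, hc⟩ := hab
  refine ⟨⟨_, l, rfl⟩, hg ?_⟩
  simpa only [map_mul, map_pow] using hc

end Graded

section Closure
open Polynomial
variable {A K : Type u} [CommRing A] [CommRing K] [Algebra A K]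

/-- Let `E ⊆ K` be an `A`-submodule. This is the graded `A`-algebra `⨁ Eⁱ tⁱ ⊆ K[t]`, that is, the
`A`-subalgebra of `K[t]` generated by `E t`, see `closureRing_eq_adjoin`.

If `K` is the fraction field of `A` and `E` is the `A`-span of a family `(x_p)` of elements of `K`,
not all zero, then it is the image of `A[T_p] → K[t]`, `T_p ↦ x_p t`, hence the homogeneous coordinate
ring of the closure in the projective space over `Spec A` with coordinates `(T_p)` of the `K`-valued
point with homogeneous coordinates `(x_p)`. -/
def closureRing (E : Submodule A K) : Subalgebra A K[X] where
  carrier := {f | ∀ i, f.coeff i ∈ E ^ i}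
  mul_mem' hf hg i := by
    rw [coeff_mul]
    refine Submodule.sum_mem _ ?_
    rintro ⟨j, l⟩ e
    rw [← Finset.HasAntidiagonal.mem_antidiagonal.mp e, pow_add]
    exact Submodule.mul_mem_mul (hf j) (hg l)
  add_mem' hf hg i := by
    rw [coeff_add]
    exact Submodule.add_mem _ (hf i) (hg i)
  algebraMap_mem' a i := by
    rw [Polynomial.algebraMap_apply, coeff_C]
    split_ifs with h
    · subst h
      rw [pow_zero]
      exact Submodule.algebraMap_mem a
    · exact Submodule.zero_mem _

lemma mem_closureRing {E : Submodule A K} {f : K[X]} :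
    f ∈ closureRing E ↔ ∀ i, f.coeff i ∈ E ^ i := Iff.rfl

lemma monomial_mem_closureRing {E : Submodule A K} {i : ℕ} {x : K} (hx : x ∈ E ^ i) :
    monomial i x ∈ closureRing E := by
  intro j
  rw [coeff_monomial]
  split_ifs with h
  · exact h ▸ hx
  · exact Submodule.zero_mem _

lemma monomial_mem_adjoin {E : Submodule A K} {i : ℕ} {x : K} (hx : x ∈ E ^ i) :
    monomial i x ∈ Algebra.adjoin A (monomial 1 '' (E : Set K)) := by
  induction i generalizing x with
  | zero =>
    rw [pow_zero, Submodule.mem_one] at hx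
    obtain ⟨a, rfl⟩ := hx
    exact Subalgebra.algebraMap_mem _ a
  | succ i ih =>
    rw [pow_succ] at hx
    induction hx using Submodule.mul_induction_on' with
    | mem_mul_mem y hy z hz =>
      rw [← monomial_mul_monomial]
      exact Subalgebra.mul_mem _ (ih hy) (Algebra.subset_adjoin ⟨z, hz, rfl⟩)
    | add y _ z _ hy hz =>
      rw [map_add]
      exact Subalgebra.add_mem _ hy hz

lemma closureRing_eq_adjoin (E : Submodule A K) :
    closureRing E = Algebra.adjoin A (monomial 1 '' (E : Set K)) := by
  apply le_antisymm
  · intro f hf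
    rw [f.as_sum_support]
    exact Subalgebra.sum_mem _ fun i _ => monomial_mem_adjoin (hf i)
  · refine Algebra.adjoin_le ?_
    rintro _ ⟨x, hx, rfl⟩
    exact monomial_mem_closureRing (by rwa [pow_one])

/-- The grading of `⨁ Eⁱ tⁱ` by the degree in `t`. -/
def closureGrading (E : Submodule A K) (i : ℕ) : Submodule A (closureRing E) where
  carrier := {f | ∀ j, j ≠ i → (f : K[X]).coeff j = 0}
  add_mem' hf hg j hj := by
    change ((_ : K[X]) + _).coeff j = 0
    rw [coeff_add, hf j hj, hg j hj, add_zero]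
  zero_mem' j _ := by simp
  smul_mem' a f hf j hj := by
    change (a • (f : K[X])).coeff j = 0
    rw [coeff_smul, hf j hj, smul_zero]

lemma mem_closureGrading {E : Submodule A K} {i : ℕ} {f : closureRing E} :
    f ∈ closureGrading E i ↔ ∀ j, j ≠ i → (f : K[X]).coeff j = 0 := Iff.rfl

/-- The projection of `⨁ Eⁱ tⁱ` to its component of degree `i`. -/
def closureComponent (E : Submodule A K) (i : ℕ) : closureRing E →+ closureGrading E i where
  toFun f := ⟨⟨monomial i ((f : K[X]).coeff i), monomial_mem_closureRing (f.2 i)⟩,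
    fun j hj => by simp [coeff_monomial, hj.symm]⟩
  map_zero' := by ext; simp
  map_add' f g := by ext; simp

instance (E : Submodule A K) : SetLike.GradedMonoid (closureGrading E) where
  one_mem j hj := by
    change (1 : K[X]).coeff j = 0
    rw [coeff_one, if_neg hj]
  mul_mem i j f g hf hg l hl := by
    change ((f : K[X]) * (g : K[X])).coeff l = 0
    rw [coeff_mul]
    refine Finset.sum_eq_zero ?_
    rintro ⟨a, b⟩ hab
    rw [Finset.HasAntidiagonal.mem_antidiagonal] at hab
    dsimp only at hab ⊢
    by_cases ha : a = i
    · rw [hg b (by omega), mul_zero]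
    · rw [hf a ha, zero_mul]

lemma eq_monomial_of_mem {E : Submodule A K} {i : ℕ} {f : closureRing E}
    (hf : f ∈ closureGrading E i) : (f : K[X]) = monomial i ((f : K[X]).coeff i) := by
  ext j
  rw [coeff_monomial]
  split_ifs with h
  · rw [h]
  · exact hf j (Ne.symm h)

lemma coeff_coeAddMonoidHom {E : Submodule A K}
    (x : DirectSum ℕ fun i => closureGrading E i) (i : ℕ) :
    ((DirectSum.coeAddMonoidHom (closureGrading E) x : closureRing E) : K[X]).coeff i =
      ((x i : closureRing E) : K[X]).coeff i := by
  induction x using DirectSum.induction_on with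
  | zero => simp
  | of j y =>
    rw [DirectSum.coeAddMonoidHom_of]
    by_cases h : j = i
    · subst h
      rw [DirectSum.of_eq_same]
    · rw [DirectSum.of_eq_of_ne _ _ _ (Ne.symm h), y.2 i (Ne.symm h)]
      simp
  | add x y hx hy =>
    rw [map_add, DirectSum.add_apply]
    push_cast
    rw [coeff_add, coeff_add, hx, hy]

instance (E : Submodule A K) : GradedRing (closureGrading E) where
  decompose' f := ∑ i ∈ (f : K[X]).support, DirectSum.of (fun i => closureGrading E i) i
    (closureComponent E i f)
  left_inv f := by
    rw [map_sum]
    apply Subtype.ext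
    simp only [DirectSum.coeAddMonoidHom_of]
    rw [AddSubmonoidClass.coe_finsetSum]
    exact ((f : K[X]).as_sum_support).symm
  right_inv x := by
    have key : ∀ y z : DirectSum ℕ fun i => closureGrading E i,
        DirectSum.coeAddMonoidHom (closureGrading E) y =
          DirectSum.coeAddMonoidHom (closureGrading E) z → y = z := by
      intro y z h
      ext i j
      by_cases hj : j = i
      · subst hj
        rw [← coeff_coeAddMonoidHom, ← coeff_coeAddMonoidHom, h]
      · rw [(y i).2 j hj, (z i).2 j hj]
    apply key
    rw [map_sum]
    apply Subtype.ext
    simp only [DirectSum.coeAddMonoidHom_of]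
    rw [AddSubmonoidClass.coe_finsetSum]
    exact ((DirectSum.coeAddMonoidHom (closureGrading E) x : K[X]).as_sum_support).symm

/-- The structure morphism `Proj (⨁ Eⁱ tⁱ) ⟶ Spec A`. -/
def closureToBase (E : Submodule A K) :
    Proj (closureGrading E) ⟶ Spec (CommRingCat.of A) :=
  Proj.toSpecZero (closureGrading E) ≫ Spec.map (CommRingCat.ofHom
    (algebraMap A (closureGrading E 0)))
end Closure

section Functoriality
open Polynomial
variable {A A' K : Type u} [CommRing A] [CommRing A'] [CommRing K] [Algebra A K] [Algebra A' K]
  {E : Submodule A K} {E' : Submodule A' K}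

/-- The inclusion `⨁ Eⁱ tⁱ ⊆ ⨁ E'ⁱ tⁱ`, for an `A`-module `E ⊆ K` and an `A'`-module `E' ⊆ K`
whose powers contain those of `E`. -/
def closureInclusion (h : ∀ i, ∀ x ∈ E ^ i, x ∈ E' ^ i) :
    GradedRingHom (closureGrading E) (closureGrading E') where
  toFun f := ⟨f.1, fun i => h i _ (f.2 i)⟩
  map_one' := rfl
  map_mul' _ _ := rfl
  map_zero' := rfl
  map_add' _ _ := rfl
  map_mem hx := hx


lemma closureInclusion_injective (h : ∀ i, ∀ x ∈ E ^ i, x ∈ E' ^ i) :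
    Function.Injective (closureInclusion h) :=
  fun _ _ hxy => Subtype.ext (congrArg (fun z : closureRing E' => (z : K[X])) hxy)

section Localization
variable [Algebra A A'] [IsScalarTower A A' K]

lemma exists_pow_smul_mem (f : A) [IsLocalization.Away f A']
    (hE : E' = Submodule.span A' (E : Set K)) (i : ℕ) {x : K}
    (hx : x ∈ E' ^ i) : ∃ N : ℕ, f ^ N • x ∈ E ^ i := by
  have base : ∀ a : A', ∃ N : ℕ, ∃ b : A, algebraMap A A' f ^ N * a = algebraMap A A' b := by
    intro a
    obtain ⟨N, b, hb⟩ := IsLocalization.Away.surj f a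
    exact ⟨N, b, by rw [mul_comm, hb]⟩
  have mono : ∀ (i : ℕ) (y : K) (N N' : ℕ), N ≤ N' → f ^ N • y ∈ E ^ i → f ^ N' • y ∈ E ^ i := by
    intro i y N N' hN hy
    obtain ⟨c, rfl⟩ := Nat.exists_eq_add_of_le' hN
    rw [pow_add, mul_smul]
    exact Submodule.smul_mem _ _ hy
  have add : ∀ (i : ℕ) (y z : K), (∃ N : ℕ, f ^ N • y ∈ E ^ i) → (∃ N : ℕ, f ^ N • z ∈ E ^ i) →
      ∃ N : ℕ, f ^ N • (y + z) ∈ E ^ i := by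
    rintro i y z ⟨N, hN⟩ ⟨N', hN'⟩
    refine ⟨max N N', ?_⟩
    rw [smul_add]
    exact Submodule.add_mem _ (mono _ _ _ _ (le_max_left _ _) hN)
      (mono _ _ _ _ (le_max_right _ _) hN')
  have smul : ∀ (i : ℕ) (a : A') (y : K), (∃ N : ℕ, f ^ N • y ∈ E ^ i) →
      ∃ N : ℕ, f ^ N • (a • y) ∈ E ^ i := by
    rintro i a y ⟨N, hN⟩
    obtain ⟨N', b, hb⟩ := base a
    refine ⟨N' + N, ?_⟩
    have : f ^ (N' + N) • (a • y) = b • (f ^ N • y) := by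
      rw [← algebraMap_smul A' b, ← hb, ← map_pow, mul_smul, algebraMap_smul, pow_add, mul_smul,
        smul_comm (f ^ N) a y]
    rw [this]
    exact Submodule.smul_mem _ _ hN
  induction i generalizing x with
  | zero =>
    rw [pow_zero, Submodule.mem_one] at hx
    obtain ⟨a, rfl⟩ := hx
    have := smul 0 a 1 ⟨0, by simp [Submodule.one_le.mp le_rfl]⟩
    rwa [Algebra.smul_def, mul_one] at this
  | succ i ih =>
    rw [pow_succ] at hx
    induction hx using Submodule.mul_induction_on' with
    | mem_mul_mem y hy z hz =>
      obtain ⟨N, hN⟩ := ih hy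
      have hz' : ∃ N : ℕ, f ^ N • z ∈ E ^ 1 := by
        rw [hE] at hz
        induction hz using Submodule.span_induction with
        | mem x hx => exact ⟨0, by simpa using hx⟩
        | zero => exact ⟨0, by simp⟩
        | add x y _ _ hx hy => exact add _ _ _ hx hy
        | smul a x _ hx => exact smul _ _ _ hx
      obtain ⟨N', hN'⟩ := hz'
      refine ⟨N + N', ?_⟩
      rw [pow_one] at hN'
      rw [show f ^ (N + N') • (y * z) = (f ^ N • y) * (f ^ N' • z) by
        rw [smul_mul_smul_comm, pow_add], pow_succ]
      exact Submodule.mul_mem_mul hN hN'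
    | add y _ z _ hy hz => exact add _ _ _ hy hz

lemma pow_le_of_span (hE : E' = Submodule.span A' (E : Set K)) (i : ℕ) (x : K) (hx : x ∈ E ^ i) :
    x ∈ E' ^ i := by
  induction i generalizing x with
  | zero =>
    rw [pow_zero, Submodule.mem_one] at hx ⊢
    obtain ⟨a, rfl⟩ := hx
    exact ⟨algebraMap A A' a, (IsScalarTower.algebraMap_apply A A' K a).symm⟩
  | succ i ih =>
    rw [pow_succ] at hx ⊢
    induction hx using Submodule.mul_induction_on' with
    | mem_mul_mem y hy z hz =>
      refine Submodule.mul_mem_mul (ih y hy) ?_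
      rw [hE]
      exact Submodule.subset_span hz
    | add y _ z _ hy hz => exact Submodule.add_mem _ hy hz


lemma irrelevant_le_map (f : A) [IsLocalization.Away f A']
    (hE : E' = Submodule.span A' (E : Set K)) :
    HomogeneousIdeal.irrelevant (closureGrading E') ≤
      (HomogeneousIdeal.irrelevant (closureGrading E)).map
        (closureInclusion (pow_le_of_span hE)) := by
  refine toIdeal_le_toIdeal_iff.mp
    ((HomogeneousIdeal.toIdeal_irrelevant_le _).mpr ?_)
  rintro i hi g hg
  obtain ⟨N, hN⟩ := exists_pow_smul_mem f hE i (g.2 i)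
  obtain ⟨a, ha⟩ := (IsLocalization.Away.algebraMap_pow_isUnit (S := A') f N).exists_left_inv
  have hg' : g = algebraMap A' (closureRing E') a * closureInclusion (pow_le_of_span hE)
      ⟨monomial i (f ^ N • (g : K[X]).coeff i), monomial_mem_closureRing hN⟩ := by
    apply Subtype.ext
    change (g : K[X]) = algebraMap A' K[X] a * monomial i (f ^ N • (g : K[X]).coeff i)
    rw [← Algebra.smul_def, smul_monomial, ← algebraMap_smul A' (f ^ N), map_pow, smul_smul, ha,
      one_smul]
    exact eq_monomial_of_mem hg
  rw [hg']
  refine Ideal.mul_mem_left _ _ (Ideal.mem_map_of_mem _ ?_)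
  refine HomogeneousIdeal.mem_irrelevant_of_mem _ hi ?_
  intro j hj
  exact coeff_monomial_of_ne _ hj

/-- The morphism `Proj (⨁ E'ⁱ tⁱ) ⟶ Proj (⨁ Eⁱ tⁱ)` when `A' = A[1/f]` and `E' = A' E`. -/
def closureMap (f : A) [IsLocalization.Away f A'] (hE : E' = Submodule.span A' (E : Set K)) :
    Proj (closureGrading E') ⟶ Proj (closureGrading E) :=
  Proj.map (closureInclusion (pow_le_of_span hE)) (irrelevant_le_map f hE)


lemma isPullback_chart (f : A) [IsLocalization.Away f A']
    (hE : E' = Submodule.span A' (E : Set K)) {d : ℕ} (hd : 0 < d) (s : closureRing E)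
    (hs : s ∈ closureGrading E d) :
    IsPullback
      (Spec.map (CommRingCat.ofHom
        (HomogeneousLocalization.Away.map (closureInclusion (pow_le_of_span hE)) s)))
      (Proj.awayι (closureGrading E') (closureInclusion (pow_le_of_span hE) s)
        ((closureInclusion (pow_le_of_span hE)).map_mem hs) hd)
      (Proj.awayι (closureGrading E) s hs hd) (closureMap f hE) := by
  refine IsOpenImmersion.isPullback _ _ _ _ (Proj.awayι_comp_map _ _ hd s hs) ?_
  rw [Proj.opensRange_awayι, Proj.opensRange_awayι]
  rfl

lemma awayι_closureToBase {d : ℕ} (hd : 0 < d) (s : closureRing E) (hs : s ∈ closureGrading E d) :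
    Proj.awayι (closureGrading E) s hs hd ≫ closureToBase E =
      Spec.map (CommRingCat.ofHom ((HomogeneousLocalization.fromZeroRingHom (closureGrading E)
        (.powers s)).comp (algebraMap A (closureGrading E 0)))) := by
  rw [closureToBase, Proj.awayι_toSpecZero_assoc, ← Spec.map_comp]
  rfl

lemma awayMap_fromBase (h : ∀ i, ∀ x ∈ E ^ i, x ∈ E' ^ i) (s : closureRing E) (a : A) :
    HomogeneousLocalization.Away.map (closureInclusion h) s
        (HomogeneousLocalization.fromZeroRingHom (closureGrading E) (.powers s)
          (algebraMap A (closureGrading E 0) a)) =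
      HomogeneousLocalization.fromZeroRingHom (closureGrading E')
        (.powers (closureInclusion h s))
          (algebraMap A' (closureGrading E' 0) (algebraMap A A' a)) := by
  have h1 : closureInclusion h (algebraMap A (closureRing E) a) =
      algebraMap A' (closureRing E') (algebraMap A A' a) := by
    apply Subtype.ext
    change C (algebraMap A K a) = C (algebraMap A' K (algebraMap A A' a))
    rw [IsScalarTower.algebraMap_apply A A' K]
  refine congrArg HomogeneousLocalization.mk ?_
  refine HomogeneousLocalization.NumDenSameDeg.ext _ rfl h1 (map_one _)

lemma chart_comp_toBase (f : A) [IsLocalization.Away f A']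
    (hE : E' = Submodule.span A' (E : Set K)) {d : ℕ} (hd : 0 < d) (s : closureRing E)
    (hs : s ∈ closureGrading E d) :
    Proj.awayι (closureGrading E') (closureInclusion (pow_le_of_span hE) s)
        ((closureInclusion (pow_le_of_span hE)).map_mem hs) hd ≫
        closureMap f hE ≫ closureToBase E =
      Proj.awayι (closureGrading E') (closureInclusion (pow_le_of_span hE) s)
        ((closureInclusion (pow_le_of_span hE)).map_mem hs) hd ≫
        closureToBase E' ≫ Spec.map (CommRingCat.ofHom (algebraMap A A')) := by
  rw [← Category.assoc, ← Category.assoc, ← (isPullback_chart f hE hd s hs).w, Category.assoc,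
    awayι_closureToBase, awayι_closureToBase, ← Spec.map_comp, ← Spec.map_comp]
  congr 1
  apply CommRingCat.hom_ext
  apply RingHom.ext
  intro a
  exact awayMap_fromBase (pow_le_of_span hE) s a

lemma closureMap_comp_toBase (f : A) [IsLocalization.Away f A']
    (hE : E' = Submodule.span A' (E : Set K)) : closureMap f hE ≫ closureToBase E =
    closureToBase E' ≫ Spec.map (CommRingCat.ofHom (algebraMap A A')) :=
  (Proj.mapAffineOpenCover (closureInclusion (pow_le_of_span hE))
    (irrelevant_le_map f hE)).openCover.hom_ext _ _ fun s =>
      chart_comp_toBase f hE (d := s.1) s.1.2 s.2.1 s.2.2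

lemma chart_surj (f : A) [IsLocalization.Away f A']
    (hE : E' = Submodule.span A' (E : Set K)) {d : ℕ} (s : closureRing E)
    (hs : s ∈ closureGrading E d) (z : HomogeneousLocalization.Away (closureGrading E')
        (closureInclusion (pow_le_of_span hE) s)) :
    ∃ (N : ℕ) (y : HomogeneousLocalization.Away (closureGrading E) s),
      z * HomogeneousLocalization.Away.map (closureInclusion (pow_le_of_span hE)) s
        (HomogeneousLocalization.fromZeroRingHom (closureGrading E) (.powers s)
          (algebraMap A (closureGrading E 0) f)) ^ N =
      HomogeneousLocalization.Away.map (closureInclusion (pow_le_of_span hE)) s y := by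
  obtain ⟨m, x, hx, rfl⟩ := HomogeneousLocalization.Away.mk_surjective _
    ((closureInclusion (pow_le_of_span hE)).map_mem hs) z
  obtain ⟨N, hN⟩ := exists_pow_smul_mem f hE (m • d) (x.2 (m • d))
  have hy : (⟨monomial (m • d) (f ^ N • (x : K[X]).coeff (m • d)),
      monomial_mem_closureRing hN⟩ : closureRing E) ∈ closureGrading E (m • d) :=
    fun j hj => coeff_monomial_of_ne _ hj
  refine ⟨N, HomogeneousLocalization.Away.mk (closureGrading E) hs m _ hy, ?_⟩
  have hpow := (map_pow ((HomogeneousLocalization.Away.map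
    (closureInclusion (pow_le_of_span hE)) s).comp
      ((HomogeneousLocalization.fromZeroRingHom (closureGrading E) (.powers s)).comp
        (algebraMap A (closureGrading E 0)))) f N).symm
  refine (congrArg _ hpow).trans ?_
  change _ * HomogeneousLocalization.Away.map (closureInclusion (pow_le_of_span hE)) s
        (HomogeneousLocalization.fromZeroRingHom (closureGrading E) (.powers s)
          (algebraMap A (closureGrading E 0) (f ^ N))) = _
  rw [awayMap_fromBase (pow_le_of_span hE) s (f ^ N), HomogeneousLocalization.Away.map_mk]
  refine congrArg HomogeneousLocalization.mk
    (HomogeneousLocalization.NumDenSameDeg.ext _ rfl ?_ ?_)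
  · apply Subtype.ext
    change (x : K[X]) * C (algebraMap A' K (algebraMap A A' (f ^ N))) =
      monomial (m • d) (f ^ N • (x : K[X]).coeff (m • d))
    rw [← IsScalarTower.algebraMap_apply, Algebra.smul_def (f ^ N), mul_comm, ← C_mul_monomial]
    exact congrArg _ (eq_monomial_of_mem hx)
  · exact mul_one _

lemma isLocalization_chart (f : A) [IsLocalization.Away f A']
    (hE : E' = Submodule.span A' (E : Set K)) {d : ℕ} (s : closureRing E)
    (hs : s ∈ closureGrading E d) :
    letI := (HomogeneousLocalization.Away.map (closureInclusion (pow_le_of_span hE)) s).toAlgebra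
    IsLocalization.Away (HomogeneousLocalization.fromZeroRingHom (closureGrading E) (.powers s)
          (algebraMap A (closureGrading E 0) f))
      (HomogeneousLocalization.Away (closureGrading E')
        (closureInclusion (pow_le_of_span hE) s)) := by
  let _ := (HomogeneousLocalization.Away.map (closureInclusion (pow_le_of_span hE)) s).toAlgebra
  refine IsLocalization.Away.mk _ ?_ (chart_surj f hE s hs) ?_
  · rw [RingHom.algebraMap_toAlgebra, awayMap_fromBase (pow_le_of_span hE) s f]
    exact ((IsLocalization.Away.algebraMap_isUnit f).map _).map _
  · intro a b hab
    exact ⟨0, congrArg _ (awayMap_injective _ (closureInclusion_injective _) s hab)⟩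

end Localization
end Functoriality

section ClosureLocalization
variable {A A' K : Type u} [CommRing A] [CommRing A'] [CommRing K] [Algebra A K] [Algebra A' K]
  {E : Submodule A K} {E' : Submodule A' K} [Algebra A A'] [IsScalarTower A A' K]

lemma isOpenImmersion_chart (f : A) [IsLocalization.Away f A']
    (hE : E' = Submodule.span A' (E : Set K)) {d : ℕ} (s : closureRing E)
    (hs : s ∈ closureGrading E d) : IsOpenImmersion (Spec.map (CommRingCat.ofHom
        (HomogeneousLocalization.Away.map (closureInclusion (pow_le_of_span hE)) s))) := by
  let _ := (HomogeneousLocalization.Away.map (closureInclusion (pow_le_of_span hE)) s).toAlgebra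
  have := isLocalization_chart f hE s hs
  exact IsOpenImmersion.of_isLocalization
    (HomogeneousLocalization.fromZeroRingHom (closureGrading E) (.powers s)
      (algebraMap A (closureGrading E 0) f))

lemma isOpenImmersion_closureMap (f : A) [IsLocalization.Away f A']
    (hE : E' = Submodule.span A' (E : Set K)) : IsOpenImmersion (closureMap f hE) := by
  refine (IsZariskiLocalAtTarget.iff_of_openCover (P := @IsOpenImmersion)
    (Proj.affineOpenCover (closureGrading E)).openCover).mpr ?_
  rintro ⟨i, s, hs⟩
  have h2 := isOpenImmersion_chart f hE s hs
  have h3 := (isPullback_chart f hE i.2 s hs).flip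
  exact (MorphismProperty.cancel_left_of_respectsIso @IsOpenImmersion
    h3.isoPullback.hom _).mp (by
      refine (congrArg (fun g => IsOpenImmersion g) ?_).mpr h2
      exact h3.isoPullback_hom_snd)

lemma mem_range_chart (f : A) [IsLocalization.Away f A']
    (hE : E' = Submodule.span A' (E : Set K)) {d : ℕ} (s : closureRing E)
    (hs : s ∈ closureGrading E d) (y) :
    y ∈ Set.range (Spec.map (CommRingCat.ofHom
        (HomogeneousLocalization.Away.map (closureInclusion (pow_le_of_span hE)) s))) ↔
    Spec.map (CommRingCat.ofHom ((HomogeneousLocalization.fromZeroRingHom (closureGrading E)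
        (.powers s)).comp (algebraMap A (closureGrading E 0)))) y ∈
      Set.range (Spec.map (CommRingCat.ofHom (algebraMap A A'))) := by
  let _ := (HomogeneousLocalization.Away.map (closureInclusion (pow_le_of_span hE)) s).toAlgebra
  have := isLocalization_chart f hE s hs
  have h1 := PrimeSpectrum.localization_away_comap_range
    (HomogeneousLocalization.Away (closureGrading E') (closureInclusion (pow_le_of_span hE) s))
    (HomogeneousLocalization.fromZeroRingHom (closureGrading E) (.powers s)
      (algebraMap A (closureGrading E 0) f))
  have h2 := PrimeSpectrum.localization_away_comap_range A' f
  refine Iff.trans (Set.ext_iff.mp h1 y) (Iff.trans ?_ (Set.ext_iff.mp h2 _).symm)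
  rfl

lemma mem_range_closureMap (f : A) [IsLocalization.Away f A']
    (hE : E' = Submodule.span A' (E : Set K)) {d : ℕ} (hd : 0 < d) (s : closureRing E)
    (hs : s ∈ closureGrading E d)
    (y : Spec (CommRingCat.of (HomogeneousLocalization.Away (closureGrading E) s))) :
    closureToBase E (Proj.awayι (closureGrading E) s hs hd y) ∈
      Set.range (Spec.map (CommRingCat.ofHom (algebraMap A A'))) ↔
    Proj.awayι (closureGrading E) s hs hd y ∈ Set.range (closureMap f hE) := by
  rw [← Scheme.Hom.comp_apply, awayι_closureToBase, ← mem_range_chart f hE s hs y]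
  constructor
  · rintro ⟨z, rfl⟩
    rw [← Scheme.Hom.comp_apply, (isPullback_chart f hE hd s hs).w]
    exact ⟨_, rfl⟩
  · rintro ⟨z, hz⟩
    obtain ⟨o, -, ho⟩ := Scheme.exists_preimage_of_isPullback
      (isPullback_chart f hE hd s hs).flip z y hz
    exact ⟨o, ho⟩

/-- The formation of the closure commutes with localization of the base. -/
lemma isPullback_closureMap (f : A) [IsLocalization.Away f A']
    (hE : E' = Submodule.span A' (E : Set K)) :
    IsPullback (closureToBase E') (closureMap f hE)
      (Spec.map (CommRingCat.ofHom (algebraMap A A'))) (closureToBase E) := by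
  have := isOpenImmersion_closureMap f hE
  have : IsOpenImmersion (Spec.map (CommRingCat.ofHom (algebraMap A A'))) :=
    IsOpenImmersion.of_isLocalization f
  refine IsOpenImmersion.isPullback _ _ _ _ (closureMap_comp_toBase f hE) ?_
  ext x
  obtain ⟨i, y, rfl⟩ := (Proj.affineOpenCover (closureGrading E)).openCover.exists_eq x
  exact mem_range_closureMap f hE i.1.2 i.2.1 i.2.2 y

end ClosureLocalization

section PrincipalParts
open TensorProduct
variable (k A : Type u) [CommRing k] [CommRing A] [Algebra k A]

/-- The algebra of principal parts of order `n`, `Pⁿ_A = (A ⊗ A) / Iⁿ⁺¹`, where `I` is the kernel of the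
multiplication map `A ⊗ A → A` (tensor products over `k`). It is an `A`-algebra by the left factor. These
are the sections of `Pⁿ_X = 𝒪_{X × X} / ℐⁿ⁺¹`, with `ℐ` the ideal of the diagonal, on an affine open
set `Spec A` of `X`. -/
abbrev PrincipalParts (n : ℕ) : Type u :=
  (A ⊗[k] A) ⧸ (KaehlerDifferential.ideal k A) ^ (n + 1)


section
variable {k A} {B : Type u} [CommRing B] [Algebra k B]
lemma ideal_le_comap (φ : A →ₐ[k] B) (n : ℕ) :
    KaehlerDifferential.ideal k A ^ n ≤
      (KaehlerDifferential.ideal k B ^ n).comap (Algebra.TensorProduct.map φ φ) := by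
  refine le_trans (Ideal.pow_right_mono ?_ n) (Ideal.le_comap_pow _ n)
  intro x hx
  have h : (Algebra.TensorProduct.lmul' k (S := B)).comp (Algebra.TensorProduct.map φ φ) =
      φ.comp (Algebra.TensorProduct.lmul' k (S := A)) := by
    ext <;> simp
  have h2 := congrArg (fun g => g x) h
  change _ = φ (Algebra.TensorProduct.lmul' k (S := A) x) at h2
  change Algebra.TensorProduct.lmul' k (S := B) (Algebra.TensorProduct.map φ φ x) = 0
  change Algebra.TensorProduct.lmul' k (S := A) x = 0 at hx
  rw [hx, map_zero] at h2
  exact h2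

/-- The homomorphism `Pⁿ_A → Pⁿ_B` induced by a homomorphism `A → B` of `k`-algebras. -/
def principalPartsMap (φ : A →ₐ[k] B) (n : ℕ) :
    PrincipalParts k A n →+* PrincipalParts k B n :=
  Ideal.quotientMap _ (Algebra.TensorProduct.map φ φ : A ⊗[k] A →ₐ[k] B ⊗[k] B)
    (ideal_le_comap φ (n + 1))

end

end PrincipalParts

section Span
variable {R K V : Type u} [CommRing R] [CommRing K] [Algebra R K] [AddCommGroup V] [Module K V]
  [Module R V] [IsScalarTower R K V]

lemma multilinear_mem_span {r : ℕ} (ω : V [⋀^Fin r]→ₗ[K] K) (S : Set V) (v : Fin r → V)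
    (hv : ∀ i, v i ∈ Submodule.span R S) :
    ω v ∈ Submodule.span R {x : K | ∃ w : Fin r → V, (∀ i, w i ∈ S) ∧ ω w = x} := by
  suffices H : ∀ (T : Finset (Fin r)) (v : Fin r → V), (∀ i ∈ T, v i ∈ Submodule.span R S) →
      (∀ i, i ∉ T → v i ∈ S) →
      ω v ∈ Submodule.span R {x : K | ∃ w : Fin r → V, (∀ i, w i ∈ S) ∧ ω w = x} from
    H Finset.univ v (fun i _ => hv i) (fun i hi => absurd (Finset.mem_univ i) hi)
  intro T
  induction T using Finset.induction_on with
  | empty => exact fun v _ h => Submodule.subset_span ⟨v, fun i => h i (Finset.notMem_empty i), rfl⟩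
  | insert j T hj ih =>
    intro v h1 h2
    have key : ∀ x ∈ Submodule.span R S, ω (Function.update v j x) ∈
        Submodule.span R {x : K | ∃ w : Fin r → V, (∀ i, w i ∈ S) ∧ ω w = x} := by
      intro x hx
      induction hx using Submodule.span_induction with
      | mem x hx =>
        refine ih _ (fun i hi => ?_) (fun i hi => ?_)
        · have : i ≠ j := fun h => hj (h ▸ hi)
          rw [Function.update_of_ne this]
          exact h1 i (Finset.mem_insert_of_mem hi)
        · by_cases hij : i = j
          · subst hij
            rwa [Function.update_self]
          · rw [Function.update_of_ne hij]
            exact h2 i (by simp [hij, hi])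
      | zero =>
        rw [AlternatingMap.map_update_zero]
        exact Submodule.zero_mem _
      | add x y _ _ hx hy =>
        rw [AlternatingMap.map_update_add]
        exact Submodule.add_mem _ hx hy
      | smul a x _ hx =>
        rw [← algebraMap_smul K a x, AlternatingMap.map_update_smul, algebraMap_smul]
        exact Submodule.smul_mem _ _ hx
    have := key (v j) (h1 j (Finset.mem_insert_self j T))
    rwa [Function.update_eq_self] at this
end Span

section PrincipalPartsLocalization
open TensorProduct
variable {k A A' K : Type u} [CommRing k] [CommRing A] [Algebra k A] [CommRing A'] [Algebra k A']
  [CommRing K] [Algebra k K] [Algebra A K] [IsScalarTower k A K] [Algebra A' K]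
  [IsScalarTower k A' K] [Algebra A A'] [IsScalarTower A A' K]

lemma principalPartsMap_mk {B : Type u} [CommRing B] [Algebra k B] (φ : A →ₐ[k] B) (n : ℕ)
    (a b : A) : principalPartsMap φ n (Ideal.Quotient.mk _ (a ⊗ₜ b)) =
      Ideal.Quotient.mk _ (φ a ⊗ₜ φ b) := rfl

lemma principalPartsMap_comp {B C : Type u} [CommRing B] [Algebra k B] [CommRing C] [Algebra k C]
    (φ : A →ₐ[k] B) (ψ : B →ₐ[k] C) (n : ℕ) (p : PrincipalParts k A n) :
    principalPartsMap ψ n (principalPartsMap φ n p) = principalPartsMap (ψ.comp φ) n p := by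
  obtain ⟨y, rfl⟩ := Ideal.Quotient.mk_surjective p
  induction y using TensorProduct.induction_on with
  | zero => simp only [map_zero]
  | add y z hy hz => simp only [map_add, hy, hz]
  | tmul a b => rfl

lemma principalParts_mem_span (f : A) [IsLocalization.Away f A'] (n : ℕ)
    (p : PrincipalParts k A' n) :
    principalPartsMap (IsScalarTower.toAlgHom k A' K) n p ∈
      Submodule.span A' (Set.range (principalPartsMap (IsScalarTower.toAlgHom k A K) n)) := by
  -- notation
  let τ : K →ₐ[k] PrincipalParts k K n :=
    (Ideal.Quotient.mkₐ k _).comp Algebra.TensorProduct.includeRight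
  have hτ : ∀ x, τ x = Ideal.Quotient.mk _ ((1 : K) ⊗ₜ[k] x) := fun _ => rfl
  let B : Subalgebra A' (PrincipalParts k K n) :=
    Algebra.adjoin A' (Set.range fun a : A => τ (algebraMap A K a))
  have hBspan : ∀ x ∈ B, x ∈ Submodule.span A'
      (Set.range (principalPartsMap (IsScalarTower.toAlgHom k A K) n)) := by
    intro x hx
    have hx : x ∈ Subalgebra.toSubmodule B := hx
    rw [Algebra.adjoin_eq_span] at hx
    refine Submodule.span_mono ?_ hx
    refine (Submonoid.closure_le
      (S := (principalPartsMap (IsScalarTower.toAlgHom k A K) n).range.toSubmonoid)).mpr ?_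
    rintro _ ⟨a, rfl⟩
    exact ⟨Ideal.Quotient.mk _ (1 ⊗ₜ a), by
      rw [principalPartsMap_mk, map_one]
      rfl⟩
  have hA : ∀ a : A, τ (algebraMap A K a) ∈ B := fun a => Algebra.subset_adjoin ⟨a, rfl⟩
  have hleft : ∀ x : A', algebraMap A' (PrincipalParts k K n) x =
      Ideal.Quotient.mk _ (algebraMap A' K x ⊗ₜ[k] (1 : K)) := fun _ => rfl
  -- the image of `f` on the right is a unit of `B`
  have hunit : IsUnit (⟨τ (algebraMap A K f), hA f⟩ : B) := by
    have h1 : IsUnit (algebraMap A' B (algebraMap A A' f)) :=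
      (IsLocalization.Away.algebraMap_isUnit f).map _
    have h2 : IsNilpotent ((⟨τ (algebraMap A K f), hA f⟩ : B) -
        algebraMap A' B (algebraMap A A' f)) := by
      refine ⟨n + 1, Subtype.ext ?_⟩
      change (τ (algebraMap A K f) - algebraMap A' (PrincipalParts k K n) (algebraMap A A' f)) ^
        (n + 1) = 0
      rw [hleft, hτ, ← IsScalarTower.algebraMap_apply, ← map_sub, ← map_pow,
        Ideal.Quotient.eq_zero_iff_mem]
      refine Ideal.pow_mem_pow ?_ _
      exact KaehlerDifferential.one_smul_sub_smul_one_mem_ideal k _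
    have := IsNilpotent.isUnit_add_left_of_commute h2 h1 (Commute.all _ _)
    simpa using this
  have hA' : ∀ a : A', τ (algebraMap A' K a) ∈ B := by
    intro a
    obtain ⟨N, b, hb⟩ := IsLocalization.Away.surj f a
    obtain ⟨c, hc⟩ := (hunit.pow N).exists_right_inv
    have hc : τ (algebraMap A K f) ^ N * (c : PrincipalParts k K n) = 1 :=
      congrArg Subtype.val hc
    have hb' : τ (algebraMap A' K a) * τ (algebraMap A K f) ^ N = τ (algebraMap A K b) := by
      rw [← map_pow, ← map_mul, IsScalarTower.algebraMap_apply A A' K f, ← map_pow, ← map_mul,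
        hb, ← IsScalarTower.algebraMap_apply]
    have : τ (algebraMap A' K a) = τ (algebraMap A K b) * c := by
      rw [← hb', mul_assoc, hc, mul_one]
    rw [this]
    exact B.mul_mem (hA b) c.2
  apply hBspan
  obtain ⟨x, rfl⟩ := Ideal.Quotient.mk_surjective p
  induction x using TensorProduct.induction_on with
  | zero => simp
  | add x y hx hy =>
    rw [map_add, map_add]
    exact B.add_mem hx hy
  | tmul a b =>
    rw [principalPartsMap_mk]
    have : (Ideal.Quotient.mk (KaehlerDifferential.ideal k K ^ (n + 1)))
      ((algebraMap A' K a) ⊗ₜ[k] (algebraMap A' K b)) =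
        algebraMap A' _ a * τ (algebraMap A' K b) := by
      rw [hτ, hleft, ← map_mul, Algebra.TensorProduct.tmul_mul_tmul, one_mul, mul_one]
    refine Eq.mpr (congrArg (· ∈ B) this) ?_
    exact B.mul_mem (B.algebraMap_mem a) (hA' b)

end PrincipalPartsLocalization

section Plucker
open TensorProduct
variable (k A A' K : Type u) [CommRing k] [CommRing A] [Algebra k A] [CommRing A'] [Algebra k A']
  [CommRing K] [Algebra k K] [Algebra A K] [IsScalarTower k A K] [Algebra A' K]
  [IsScalarTower k A' K]

open Classical in
/-- For a field `K` such that `V = Pⁿ_K` has finite dimension `r` over `K`: a nonzero alternating `r`-form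
on `V`, that is, a generator of the dual of `Λʳ V`. It is unique up to a factor in `Kˣ`. (If `V` has
infinite dimension, which does not happen for the function field of a variety, it is set to be `0`.) -/
def pluckerForm (n : ℕ) :
    PrincipalParts k K n [⋀^Fin (Module.finrank K (PrincipalParts k K n))]→ₗ[K] K :=
  if h : Nonempty (Module.Basis (Fin (Module.finrank K (PrincipalParts k K n))) K
      (PrincipalParts k K n)) then h.some.det else 0

/-- The `A`-submodule of `K` spanned by the Plücker coordinates `ω(p₁, …, p_r)`, with `p₁, …, p_r` in
`Pⁿ_A`, of the `r`-dimensional quotient `K ⊗_A Pⁿ_A = Pⁿ_K` of the `A`-module `Pⁿ_A`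
(for `K` the fraction field of `A`), where `ω` is the form `pluckerForm`. -/
def pluckerModule (n : ℕ) : Submodule A K :=
  Submodule.span A {x : K | ∃ p : Fin (Module.finrank K (PrincipalParts k K n)) →
    PrincipalParts k A n,
    pluckerForm k K n (fun i => principalPartsMap (IsScalarTower.toAlgHom k A K) n (p i)) = x}

variable [Algebra A A'] [IsScalarTower k A A'] [IsScalarTower A A' K]

lemma pluckerModule_away (f : A) [IsLocalization.Away f A'] (n : ℕ) :
    pluckerModule k A' K n = Submodule.span A' (pluckerModule k A K n : Set K) := by
  apply le_antisymm
  · refine Submodule.span_le.mpr ?_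
    rintro _ ⟨p, rfl⟩
    have := multilinear_mem_span (R := A') (pluckerForm k K n)
      (Set.range (principalPartsMap (IsScalarTower.toAlgHom k A K) n)) _
      (fun i => principalParts_mem_span f n (p i))
    refine Submodule.span_mono ?_ this
    rintro _ ⟨w, hw, rfl⟩
    choose q hq using hw
    exact Submodule.subset_span ⟨q, congrArg _ (funext hq)⟩
  · refine Submodule.span_le.mpr ?_
    intro x hx
    induction hx using Submodule.span_induction with
    | zero => exact Submodule.zero_mem _
    | add x y _ _ hx hy => exact Submodule.add_mem _ hx hy
    | smul a x _ hx =>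
      rw [← algebraMap_smul A' a x]
      exact Submodule.smul_mem _ _ hx
    | mem x hx =>
      obtain ⟨p, rfl⟩ := hx
      refine Submodule.subset_span
        ⟨fun i => principalPartsMap (IsScalarTower.toAlgHom k A A') n (p i), ?_⟩
      refine congrArg _ (funext fun i => ?_)
      change principalPartsMap _ n (principalPartsMap _ n (p i)) = _
      rw [principalPartsMap_comp, show (IsScalarTower.toAlgHom k A' K).comp
        (IsScalarTower.toAlgHom k A A') = IsScalarTower.toAlgHom k A K from
          AlgHom.ext fun a => (IsScalarTower.algebraMap_apply A A' K a).symm]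
end Plucker

section GradedComp
variable {A B C σ τ ψ : Type u} [CommRing A] [SetLike σ A] [AddSubgroupClass σ A]
  [CommRing B] [SetLike τ B] [AddSubgroupClass τ B]
  [CommRing C] [SetLike ψ C] [AddSubgroupClass ψ C]
  {𝒜 : ℕ → σ} {ℬ : ℕ → τ} {𝒞 : ℕ → ψ} [GradedRing 𝒜] [GradedRing ℬ] [GradedRing 𝒞]

lemma projMap_comp (f : GradedRingHom 𝒜 ℬ) (g : GradedRingHom ℬ 𝒞)
    (hf : HomogeneousIdeal.irrelevant ℬ ≤ (HomogeneousIdeal.irrelevant 𝒜).map f)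
    (hg : HomogeneousIdeal.irrelevant 𝒞 ≤ (HomogeneousIdeal.irrelevant ℬ).map g)
    (hgf : HomogeneousIdeal.irrelevant 𝒞 ≤ (HomogeneousIdeal.irrelevant 𝒜).map (g.comp f)) :
    Proj.map (g.comp f) hgf = Proj.map g hg ≫ Proj.map f hf := by
  refine (Proj.mapAffineOpenCover (g.comp f) hgf).openCover.hom_ext _ _ fun s => ?_
  have h1 := Proj.awayι_comp_map (g.comp f) hgf s.1.2 s.2.1 s.2.2
  have h2 := Proj.awayι_comp_map f hf s.1.2 s.2.1 s.2.2
  have h3 := Proj.awayι_comp_map_assoc g hg s.1.2 (f s.2.1) (f.map_mem s.2.2) (Proj.map f hf)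
  refine h1.trans (Eq.trans ?_ h3.symm)
  rw [h2]
  refine Eq.trans ?_ (Category.assoc _ _ _)
  refine congrArg (· ≫ _) (Eq.trans ?_ (Spec.map_comp _ _))
  exact congrArg (fun q => Spec.map (CommRingCat.ofHom q))
    (HomogeneousLocalization.Away.map_comp f g _)
end GradedComp

section Transition
variable {A A' A'' K : Type u} [CommRing A] [CommRing A'] [CommRing A''] [CommRing K]
  [Algebra A K] [Algebra A' K] [Algebra A'' K]
  {E : Submodule A K} {E' : Submodule A' K} {E'' : Submodule A'' K}

/-- The morphism `Proj (⨁ E'ⁱ tⁱ) ⟶ Proj (⨁ Eⁱ tⁱ)` induced by the inclusion of graded rings. -/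
def closureTransition (h : ∀ i, ∀ x ∈ E ^ i, x ∈ E' ^ i)
    (hirr : HomogeneousIdeal.irrelevant (closureGrading E') ≤
      (HomogeneousIdeal.irrelevant (closureGrading E)).map (closureInclusion h)) :
    Proj (closureGrading E') ⟶ Proj (closureGrading E) :=
  Proj.map (closureInclusion h) hirr

lemma closureTransition_id (h : ∀ i, ∀ x ∈ E ^ i, x ∈ E ^ i)
    (hirr : HomogeneousIdeal.irrelevant (closureGrading E) ≤
      (HomogeneousIdeal.irrelevant (closureGrading E)).map (closureInclusion h)) :
    closureTransition h hirr = 𝟙 _ := by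
  refine (Proj.mapAffineOpenCover (closureInclusion h) hirr).openCover.hom_ext _ _ fun s => ?_
  rw [Category.comp_id]
  have h1 := Proj.awayι_comp_map (closureInclusion h) hirr s.1.2 s.2.1 s.2.2
  have h2 : HomogeneousLocalization.Away.map (closureInclusion h) s.2.1 =
      RingHom.id (HomogeneousLocalization.Away (closureGrading E) (s.2.1 : closureRing E)) := by
    ext x
    obtain ⟨n, x, hx, rfl⟩ := HomogeneousLocalization.Away.mk_surjective _ s.2.2 x
    rw [HomogeneousLocalization.Away.map_mk]
    rfl
  refine h1.trans ?_
  refine Eq.trans ?_ (Category.id_comp _)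
  refine congrArg (· ≫ _) ?_
  exact (congrArg (fun g => Spec.map (CommRingCat.ofHom g)) h2).trans (Spec.map_id _)

lemma closureTransition_comp (h : ∀ i, ∀ x ∈ E ^ i, x ∈ E' ^ i) (hirr)
    (h' : ∀ i, ∀ x ∈ E' ^ i, x ∈ E'' ^ i) (hirr') (h'' : ∀ i, ∀ x ∈ E ^ i, x ∈ E'' ^ i) (hirr'') :
    closureTransition h'' hirr'' = closureTransition h' hirr' ≫ closureTransition h hirr :=
  projMap_comp (closureInclusion h) (closureInclusion h') hirr hirr' hirr''
end Transition

section Scheme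
variable {k : Type u} [Field k] {X : Scheme.{u}} (s : X ⟶ Spec (CommRingCat.of k))

/-- The homomorphism `k → Γ(X, U)` given by the structure morphism. -/
def structureHom (U : X.Opens) : k →+* Γ(X, U) :=
  ((Scheme.ΓSpecIso (CommRingCat.of k)).inv ≫ s.appTop ≫
    X.presheaf.map (homOfLE (le_top : U ≤ ⊤)).op).hom

lemma map_structureHom {U V : X.Opens} (i : U ⟶ V) (a : k) :
    X.presheaf.map i.op (structureHom s V a) = structureHom s U a := by
  change ((Scheme.ΓSpecIso (CommRingCat.of k)).inv ≫ s.appTop ≫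
    X.presheaf.map (homOfLE (le_top : V ≤ ⊤)).op ≫ X.presheaf.map i.op) a = _
  rw [← Functor.map_comp]
  rfl

variable [IsIntegral X] (n : ℕ)

/-- The submodule `pluckerModule` of the function field of `X` attached to a nonempty (affine) open
set `U` of `X`. -/
def nashModule (U : X.Opens) [Nonempty U] : Submodule Γ(X, U) X.functionField :=
  letI := (structureHom s U).toAlgebra
  letI := ((X.germToFunctionField U).hom.comp (structureHom s U)).toAlgebra
  haveI : IsScalarTower k Γ(X, U) X.functionField := .of_algebraMap_eq' rfl
  pluckerModule k Γ(X, U) X.functionField n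

lemma germ_structureHom {U V : X.Opens} [Nonempty U] [Nonempty V] (i : U ⟶ V) :
    (X.germToFunctionField U).hom.comp (structureHom s U) =
      (X.germToFunctionField V).hom.comp (structureHom s V) := by
  ext a
  change X.germToFunctionField U (structureHom s U a) = X.germToFunctionField V (structureHom s V a)
  rw [← map_structureHom s i]
  exact X.presheaf.germ_res_apply i _ _ _

/-- The nonempty affine open sets of `X`, with `U ≤ V` if `U` is a basic open subset `D(f)` of `V`. -/
abbrev NashIndex (X : Scheme.{u}) : Type u :=
  {U : X.AffineZariskiSite // Nonempty U.toOpens}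

instance (U : NashIndex X) : Nonempty U.1.toOpens := U.2

lemma NashIndex.toOpens_le {X : Scheme.{u}} {U V : NashIndex X} (h : U ≤ V) : U.1.toOpens ≤ V.1.toOpens :=
  Scheme.AffineZariskiSite.toOpens_mono h

lemma nashModule_eq (U : X.Opens) [Nonempty U] (φ : k →+* X.functionField)
    (hφ : φ = (X.germToFunctionField U).hom.comp (structureHom s U)) :
    letI := (structureHom s U).toAlgebra
    letI := φ.toAlgebra
    letI : IsScalarTower k Γ(X, U) X.functionField := .of_algebraMap_eq' hφ
    nashModule s n U = pluckerModule k Γ(X, U) X.functionField n := by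
  subst hφ
  rfl

lemma nashModule_span {U V : NashIndex X} (h : U ≤ V) :
    letI := (X.presheaf.map (homOfLE (NashIndex.toOpens_le h)).op).hom.toAlgebra
    nashModule s n U.1.toOpens = Submodule.span Γ(X, U.1.toOpens)
      (nashModule s n V.1.toOpens : Set X.functionField) := by
  obtain ⟨f, hf⟩ := h
  have i : U.1.toOpens ⟶ V.1.toOpens := homOfLE (NashIndex.toOpens_le ⟨f, hf⟩)
  let := (X.presheaf.map i.op).hom.toAlgebra
  let := (structureHom s U.1.toOpens).toAlgebra
  let := (structureHom s V.1.toOpens).toAlgebra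
  let := ((X.germToFunctionField U.1.toOpens).hom.comp (structureHom s U.1.toOpens)).toAlgebra
  have : IsScalarTower k Γ(X, U.1.toOpens) X.functionField := .of_algebraMap_eq' rfl
  have : IsScalarTower k Γ(X, V.1.toOpens) X.functionField :=
    .of_algebraMap_eq' (germ_structureHom s i)
  have : IsScalarTower Γ(X, V.1.toOpens) Γ(X, U.1.toOpens) X.functionField :=
    .of_algebraMap_eq fun x => (X.presheaf.germ_res_apply i _ _ x).symm
  have : IsScalarTower k Γ(X, V.1.toOpens) Γ(X, U.1.toOpens) :=
    .of_algebraMap_eq fun a => (map_structureHom s i a).symm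
  have := V.1.2.isLocalization_of_eq_basicOpen f i hf.symm
  have key := pluckerModule_away k Γ(X, V.1.toOpens) Γ(X, U.1.toOpens) X.functionField f n
  have hV := nashModule_eq s n V.1.toOpens _ (germ_structureHom s i)
  rw [hV]
  exact key

end Scheme

section Modification
open Limits
variable (X : Scheme.{u}) [IsIntegral X]

/-- The cover of `X` by its nonempty affine open sets. -/
def nashCover : X.OpenCover where
  I₀ := NashIndex X
  X U := U.1.toOpens
  f U := U.1.toOpens.ι
  mem₀ := by
    rw [Scheme.presieve₀_mem_precoverage_iff]
    refine ⟨fun x => ?_, fun U => inferInstance⟩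
    obtain ⟨U, hxU⟩ := TopologicalSpace.Opens.mem_iSup.mp
      ((iSup_affineOpens_eq_top X).ge (Set.mem_univ x))
    exact ⟨⟨U, ⟨⟨x, hxU⟩⟩⟩, ⟨x, hxU⟩, rfl⟩

instance : Category (nashCover X).I₀ := inferInstanceAs (Category (NashIndex X))
instance : Quiver.IsThin (nashCover X).I₀ := inferInstanceAs (Quiver.IsThin (NashIndex X))
instance : Small.{u} (nashCover X).I₀ := inferInstanceAs (Small.{u} (NashIndex X))

lemma nashCover_directed (U V : NashIndex X)
    (x : (pullback U.1.toOpens.ι V.1.toOpens.ι : Scheme.{u})) :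
    ∃ (W : NashIndex X) (hU : W ≤ U) (hV : W ≤ V) (y : (W.1.toOpens : Scheme.{u})),
      pullback.lift (X.homOfLE (NashIndex.toOpens_le hU))
        (X.homOfLE (NashIndex.toOpens_le hV)) (by simp) y = x := by
  have ha : U.1.toOpens.ι (pullback.fst U.1.toOpens.ι V.1.toOpens.ι x) =
      V.1.toOpens.ι (pullback.snd U.1.toOpens.ι V.1.toOpens.ι x) := by
    rw [← Scheme.Hom.comp_apply, pullback.condition, Scheme.Hom.comp_apply]
  have haU : U.1.toOpens.ι (pullback.fst U.1.toOpens.ι V.1.toOpens.ι x) ∈ U.1.toOpens :=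
    (pullback.fst U.1.toOpens.ι V.1.toOpens.ι x).2
  have haV : V.1.toOpens.ι (pullback.snd U.1.toOpens.ι V.1.toOpens.ι x) ∈ V.1.toOpens :=
    (pullback.snd U.1.toOpens.ι V.1.toOpens.ι x).2
  rw [← ha] at haV
  obtain ⟨a, hx⟩ : ∃ a, a = U.1.toOpens.ι (pullback.fst U.1.toOpens.ι V.1.toOpens.ι x) := ⟨_, rfl⟩
  rw [← hx] at haU haV
  obtain ⟨W, hWU, hWV, haW⟩ : ∃ (W : NashIndex X), W ≤ U ∧ W ≤ V ∧ a ∈ W.1.toOpens := by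
    obtain ⟨f, g, e, hxf⟩ := exists_basicOpen_le_affine_inter U.1.2 V.1.2 _ ⟨haU, haV⟩
    exact ⟨⟨U.1.basicOpen f, ⟨⟨_, hxf⟩⟩⟩, U.1.basicOpen_le f, ⟨g, e.symm⟩, hxf⟩
  obtain ⟨y, hy⟩ : ∃ y : (W.1.toOpens : Scheme.{u}), W.1.toOpens.ι y = a := ⟨⟨a, haW⟩, rfl⟩
  refine ⟨W, hWU, hWV, y, ?_⟩
  apply (pullback.fst U.1.toOpens.ι V.1.toOpens.ι ≫ U.1.toOpens.ι).isOpenEmbedding.injective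
  rw [← Scheme.Hom.comp_apply, pullback.lift_fst_assoc, Scheme.homOfLE_ι, Scheme.Hom.comp_apply,
    ← hx, hy]

instance : (nashCover X).LocallyDirected where
  trans {U V} h := X.homOfLE (NashIndex.toOpens_le (leOfHom h))
  trans_id U := Scheme.homOfLE_rfl _ _
  trans_comp h h' := (Scheme.homOfLE_homOfLE _ _ _).symm
  w h := Scheme.homOfLE_ι _ _
  directed {U V} x := by
    obtain ⟨W, hU, hV, y, hy⟩ := nashCover_directed X U V x
    exact ⟨W, (homOfLE hU : W ⟶ (U : NashIndex X)),
      (homOfLE hV : W ⟶ (V : NashIndex X)), y, hy⟩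
  property_trans h := by
    change IsOpenImmersion (X.homOfLE _)
    infer_instance

variable {X} {k : Type u} [Field k] (s : X ⟶ Spec (CommRingCat.of k)) (n : ℕ)

lemma nashModule_pow_le {U V : NashIndex X} (h : U ≤ V) (i : ℕ) (x : X.functionField)
    (hx : x ∈ nashModule s n V.1.toOpens ^ i) : x ∈ nashModule s n U.1.toOpens ^ i := by
  let _ := (X.presheaf.map (homOfLE (NashIndex.toOpens_le h)).op).hom.toAlgebra
  have : IsScalarTower Γ(X, V.1.toOpens) Γ(X, U.1.toOpens) X.functionField :=
    .of_algebraMap_eq fun x => (X.presheaf.germ_res_apply _ _ _ x).symm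
  exact pow_le_of_span (nashModule_span s n h) i x hx

lemma nash_irrelevant_le {U V : NashIndex X} (h : U ≤ V) :
    HomogeneousIdeal.irrelevant (closureGrading (nashModule s n U.1.toOpens)) ≤
      (HomogeneousIdeal.irrelevant (closureGrading (nashModule s n V.1.toOpens))).map
        (closureInclusion (nashModule_pow_le s n h)) := by
  let _ := (X.presheaf.map (homOfLE (NashIndex.toOpens_le h)).op).hom.toAlgebra
  have : IsScalarTower Γ(X, V.1.toOpens) Γ(X, U.1.toOpens) X.functionField :=
    .of_algebraMap_eq fun x => (X.presheaf.germ_res_apply _ _ _ x).symm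
  have h' := h
  obtain ⟨f, hf⟩ := h'
  have := V.1.2.isLocalization_of_eq_basicOpen f
    (homOfLE (NashIndex.toOpens_le h)) hf.symm
  exact irrelevant_le_map f (nashModule_span s n h)

/-- The functor that maps a nonempty affine open set `U = Spec A` of `X` to the part over `U` of the
`n`-th Nash modification of `X`: the closure, in the projective space over `U` given by the Plücker
embedding of the Grassmannian of quotients of rank `r` of `Pⁿ_A`, of the point of the Grassmannian over
the generic point of `X` which is given by the identity of `Pⁿ_K`. Here `K` is the function field
of `X` and `r = dim_K Pⁿ_K`. -/
def nashFunctor : NashIndex X ⥤ Scheme.{u} where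
  obj U := Proj (closureGrading (nashModule s n U.1.toOpens))
  map h := closureTransition (nashModule_pow_le s n (leOfHom h)) (nash_irrelevant_le s n (leOfHom h))
  map_id _ := closureTransition_id _ _
  map_comp _ _ := closureTransition_comp _ _ _ _ _ _

/-- The projection to `U` of the part over `U` of the Nash modification. -/
def nashToOpen (U : NashIndex X) :
    Proj (closureGrading (nashModule s n U.1.toOpens)) ⟶ U.1.toOpens :=
  closureToBase _ ≫ U.1.2.isoSpec.inv

lemma isPullback_nash {U V : NashIndex X} (h : U ⟶ V) :
    IsPullback ((nashFunctor s n).map h) (nashToOpen s n U) (nashToOpen s n V)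
      (X.homOfLE (NashIndex.toOpens_le (leOfHom h))) := by
  have hle := leOfHom h
  let _ := (X.presheaf.map (homOfLE (NashIndex.toOpens_le hle)).op).hom.toAlgebra
  have : IsScalarTower Γ(X, V.1.toOpens) Γ(X, U.1.toOpens) X.functionField :=
    .of_algebraMap_eq fun x => (X.presheaf.germ_res_apply _ _ _ x).symm
  have h' := hle
  obtain ⟨f, hf⟩ := h'
  have := V.1.2.isLocalization_of_eq_basicOpen f
    (homOfLE (NashIndex.toOpens_le hle)) hf.symm
  have h1 := (isPullback_closureMap f (nashModule_span s n hle)).flip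
  have h2 : IsPullback (Spec.map (X.presheaf.map
      (homOfLE (NashIndex.toOpens_le hle)).op)) U.1.2.isoSpec.inv V.1.2.isoSpec.inv
      (X.homOfLE (NashIndex.toOpens_le hle)) := by
    refine IsPullback.of_vert_isIso ⟨?_⟩
    rw [Iso.eq_inv_comp, ← Category.assoc, Iso.comp_inv_eq]
    exact (Scheme.Opens.toSpecΓ_SpecMap_presheaf_map _ _ _)
  have h3 := IsPullback.paste_vert h1 h2
  exact h3

/-- The parts of the Nash modification over the affine open sets of `X` form a gluing datum. -/
def nashGluingData : (nashCover X).RelativeGluingData where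
  functor := nashFunctor s n
  natTrans :=
    { app := nashToOpen s n
      naturality := fun _ _ h => (isPullback_nash s n h).w }
  equifibered := fun _ _ h => isPullback_nash s n h

/-- The `n`-th Nash modification `N_n(X)` of an integral scheme `X` over a field `k`.

Let `r` be the generic rank of `Pⁿ_X` (for a variety of dimension `d` this is the binomial coefficient of
`n + d` and `d`). On the regular locus `X_reg` (for `k` algebraically closed), or on any smaller dense
open set where `Pⁿ_X` is locally free of rank `r`, the identity of `Pⁿ_X` defines a section of
the Grassmannian of locally free quotients of rank `r` of `Pⁿ_X`, and `N_n(X)` is the closure of its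
image. As `X` is integral, this is the closure, with its reduced structure, of the value of the section
at the generic point. Locally on `X`, over an affine open set `U = Spec A`, we embed the Grassmannian in
the projective space of `Λʳ Pⁿ_A` by the Plücker embedding, a closed immersion. Then the closure is
`Proj (⨁ Eⁱ tⁱ)`, where `E` is the `A`-module spanned by the Plücker coordinates of the generic value
of the section; these local pieces are glued over `X`. -/
def nashModification : Scheme.{u} := (nashGluingData s n).glued

/-- The projection `π_n : N_n(X) ⟶ X`. -/
def nashProjection : nashModification s n ⟶ X := (nashGluingData s n).toBase

end Modification

end HigherNash

end

open CategoryTheory AlgebraicGeometry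

noncomputable section

/-! Both conditions can be tested on the charts U_σ. For each chart both amount to smoothness of the
monoid S = S_σ (`IsSmoothMonoid`): in a suitable basis of the lattice M, the monoid is given by the
nonnegativity of some of the coordinates.

Over U_σ = Spec A the Nash modification is Proj (⨁ Eⁱ tⁱ), with E the module of Plücker coordinates.
If E is free of rank one, the projection is an isomorphism (`isIso_closureToBase`). Conversely, if
it is an isomorphism, then near any point E is generated by one member of any given generating set
(`exists_generator_of_isIso`). For smooth S the monomials of degree ≤ n in the elements 1 ⊗ χ^g -
χ^g ⊗ 1, with g in the basis, span the image of Pⁿ_A in Pⁿ_K, and their number is r = dim Pⁿ_K. So E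
is generated by one determinant.

The hard direction uses the classes ρ(m) of χ^{-m} ⊗ χ^m in Pⁿ_K (`ratio`). They are multiplicative
in m, and ρ(m) - 1 lies in the ideal of the diagonal, whose power of exponent n + 1 is zero. Hence
every linear form composed with ρ is a polynomial function of degree ≤ n on M in the sense of finite
differences, a notion that works in all characteristics. Moreover the ρ(m) span a space of dimension
r over k, not only over K. At the distinguished point of U_σ, E is generated by the Plücker
coordinate of some χ^{m_1}, …, χ^{m_r} with m_i in S. Let f_i(s) ∈ k be the coordinates of ρ(s) in
the basis ρ(m_i). By Cramer's rule, replacing m_i by s ∈ S multiplies the Plücker coordinate by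
f_i(s) χ^{s - m_i}. This is regular at the distinguished point, so s - m_i ∈ S whenever f_i(s) ≠ 0.
These are the main conditions of a `PluckerDatum`.

The rest is combinatorial. Let v_j be the primitive forms of the facets. Then f_b vanishes at the
points of S with v_j smaller than v_j(m_b), and a polynomial function of degree ≤ n that vanishes on
n + 1 consecutive levels of v_j is zero. Hence v_j(m_b) ≤ n, and for each j equality holds for at
most one b. On the other hand, if h generates a ray of S modulo units, comparison of n-th Taylor
coefficients of ρ(nh) yields an m_b equal to nh modulo units. So v_j(h) ≤ 1 for all j, and the
uniqueness of b excludes v_i(h) = v_j(h) = 1 for i ≠ j. The rays are therefore dual to the facets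
(`PluckerDatum.exists_dual`), and S is smooth.

Regularity is treated at the distinguished point as well. Its cotangent space has dimension at least
the number of irreducible elements of S modulo units plus the rank of the group of units. If the
point is regular, this is at most the rank of M, so the irreducible elements form a basis of M
modulo units and S is smooth. Conversely, for smooth S the algebra k[S] is a polynomial ring with
some variables inverted. -/

namespace HigherNash

set_option linter.unusedSectionVars false

/-! ### Polynomial functions on abelian groups -/

section PolynomialFunctions
variable {M R : Type*} [AddCommGroup M] [AddCommGroup R]

/-- Polynomial functions of degree less than `N` on an abelian group: the functions that are killed
by all `N`-fold differences. -/
def IsPolyFun : ℕ → (M → R) → Prop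
  | 0, f => ∀ x, f x = 0
  | N + 1, f => ∀ a, IsPolyFun N fun x => f (x + a) - f x

/-- The difference in the direction `q` also vanishes far out on the ray, so by induction on the
degree it vanishes at every point `x + s • q`. Then `f` is constant along the ray, and far out its
value is zero. -/
lemma IsPolyFun.eq_zero_of_ray {N : ℕ} {f : M → R} (hf : IsPolyFun N f) (q x : M)
    (h : ∃ t : ℕ, ∀ s ≥ t, f (x + s • q) = 0) : f x = 0 := by
  induction N generalizing f x with
  | zero => exact hf x
  | succ N ih =>
    obtain ⟨t, ht⟩ := h
    have key : ∀ s : ℕ, f (x + s • q + q) - f (x + s • q) = 0 := by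
      intro s
      refine ih (hf q) (x + s • q) ⟨t, fun u hu => ?_⟩
      rw [show x + s • q + u • q + q = x + (s + u + 1) • q by module,
        show x + s • q + u • q = x + (s + u) • q by module, ht _ (by omega), ht _ (by omega),
        sub_zero]
    have : ∀ s : ℕ, f (x + s • q) = f x := by
      intro s
      induction s with
      | zero => simp
      | succ s ihs =>
        rw [← ihs, ← sub_eq_zero, ← key s]
        congr 2
        module
    rw [← this t, ht t le_rfl]

/-- A difference in a direction `a` with `v a` equal to 0 or 1 vanishes on a slab with one level
less, hence everywhere by induction. So `f` is invariant under the kernel of `v` and under a vector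
with value 1, that is, constant. No factorials are inverted. -/
lemma IsPolyFun.eq_zero_of_slab {N : ℕ} {f : M → R} (hf : IsPolyFun N f) (v : M →+ ℤ)
    (h1 : ∃ e, v e = 1) (h : ∀ x, 0 ≤ v x → v x < N → f x = 0) (x : M) : f x = 0 := by
  induction N generalizing f x with
  | zero => exact hf x
  | succ N ih =>
    obtain ⟨e, he⟩ := h1
    have key : ∀ a, v a = 0 ∨ v a = 1 → ∀ x, f (x + a) = f x := by
      intro a ha x
      refine sub_eq_zero.mp (ih (hf a) (fun y h0 h2 => ?_) x)
      rw [h y h0 (by push_cast; omega), sub_zero]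
      rw [h (y + a)]
      · rw [map_add]; omega
      · rw [map_add]; push_cast; omega
    have key2 : ∀ c : ℤ, f (c • e) = f 0 := by
      intro c
      induction c with
      | zero => simp
      | succ i ih' => rw [add_smul, one_smul, key e (.inr he), ih']
      | pred i ih' =>
        rw [← ih', ← key e (.inr he)]
        congr 1
        module
    have h2 := key (x - v x • e) (.inl (by simp [he])) (v x • e)
    rw [add_sub_cancel, key2, h 0 (by simp) (by simp only [map_zero]; positivity)] at h2
    exact h2
end PolynomialFunctions

/-! ### Levels of the points of a Plücker datum with respect to the facets -/

section Combinatorics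
variable {M : Type*} [AddCommGroup M] {ι : Type*}

/-- A system of integral linear forms `v i` on a lattice, each taking the value `1` and each defining
a facet of the cone where all of them are nonnegative. -/
structure IsFacetSystem (v : ι → M →+ ℤ) : Prop where
  exists_eq_one : ∀ i, ∃ e, v i e = 1
  exists_facet : ∀ i, ∃ q, v i q = 0 ∧ ∀ j ≠ i, 0 < v j q

/-- The data that a locally principal module of Plücker coordinates of order `n` gives: points `m i` of
the monoid `S`, and polynomial functions `f i` of degree at most `n` dual to them, such that `s - m i`
is in `S` when `s` is in `S` and `f i s ≠ 0`. -/
structure PluckerDatum {K κ : Type*} [Field K] (S : AddSubmonoid M) (n : ℕ) (m : κ → M)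
    (f : κ → M → K) : Prop where
  mem : ∀ i, m i ∈ S
  isPolyFun : ∀ i, IsPolyFun (n + 1) (f i)
  apply_self : ∀ i, f i (m i) = 1
  apply_ne : ∀ i j, i ≠ j → f i (m j) = 0
  sub_mem : ∀ s ∈ S, ∀ i, f i s ≠ 0 → s - m i ∈ S
  exists_form : ∀ (w : M →+ ℤ) (q : M), w q = n → ∃ i, f i q ≠ 0 ∧ ¬ (0 ≤ w (m i) ∧ w (m i) < n)

variable [Finite ι] {v : ι → M →+ ℤ} {S : AddSubmonoid M} (hv : IsFacetSystem v)
  (hS : ∀ x, x ∈ S ↔ ∀ i, 0 ≤ v i x)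
include hv hS

/-- Multiples of a vector `q` in the relative interior of the facet move any point of the level `v i
= c` into `S` without leaving the level, so `IsPolyFun.eq_zero_of_ray` applies. -/
lemma IsFacetSystem.eq_zero_of_level {R : Type*} [AddCommGroup R] {N : ℕ} {f : M → R} (hf : IsPolyFun N f) (i : ι) (c : ℤ)
    (hc : 0 ≤ c) (h : ∀ x ∈ S, v i x = c → f x = 0) (x : M) (hx : v i x = c) : f x = 0 := by
  obtain ⟨q, hq0, hq⟩ := hv.exists_facet i
  refine hf.eq_zero_of_ray q x ?_
  have key : ∀ j, ∃ t : ℕ, ∀ s : ℕ, t ≤ s → 0 ≤ v j (x + s • q) := by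
    intro j
    by_cases hj : j = i
    · subst hj
      exact ⟨0, fun s _ => by simp [hq0, hx, hc]⟩
    · refine ⟨(v j x).natAbs, fun s hs => ?_⟩
      rw [map_add, map_nsmul, nsmul_eq_mul]
      have : (s : ℤ) ≤ s * v j q := le_mul_of_one_le_right (by positivity) (hq j hj)
      omega
  choose t ht using key
  cases nonempty_fintype ι
  refine ⟨Finset.univ.sup t, fun s hs => h _ ((hS _).mpr fun j =>
    ht j s ((Finset.le_sup (Finset.mem_univ j)).trans hs)) ?_⟩
  simp [hq0, hx]

variable {K κ : Type*} [Field K] {n : ℕ} {m : κ → M} {f : κ → M → K}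
  (D : PluckerDatum S n m f)
include D

/-- Suppose `v i (m b) > n`. At a point `s` of `S` with `v i s ≤ n` the element `s - m b` is
negative under `v i`, so `f b s = 0`. Hence `f b` vanishes on the levels 0, …, n, thus everywhere,
against `f b (m b) = 1`. -/
lemma PluckerDatum.form_le (i : ι) (b : κ) : v i (m b) ≤ n := by
  by_contra! hlt
  have : f b (m b) = 0 := by
    refine (D.isPolyFun b).eq_zero_of_slab (v i) (hv.exists_eq_one i) (fun x h0 h1 => ?_) _
    refine hv.eq_zero_of_level hS (D.isPolyFun b) i (v i x) h0 (fun y hy hyx => ?_) x rfl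
    by_contra hne
    have h2 := (hS _).mp (D.sub_mem y hy b hne) i
    rw [map_sub] at h2
    push_cast at h1
    omega
  rw [D.apply_self] at this
  exact one_ne_zero this

/-- The function `f b` vanishes on the `n` levels below `n`. Its difference in the direction `m c -
m b`, which preserves the levels, vanishes there too and has degree less than `n`, so it is zero. At
`m b` this says `f b (m c) = f b (m b)`, that is, 0 = 1 if `b ≠ c`. -/
lemma PluckerDatum.eq_of_form_eq (i : ι) (b c : κ) (hb : v i (m b) = n) (hc : v i (m c) = n) :
    b = c := by
  by_contra hbc
  have h0 : ∀ x, 0 ≤ v i x → v i x < n → f b x = 0 := by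
    intro x h0 h1
    refine hv.eq_zero_of_level hS (D.isPolyFun b) i (v i x) h0 (fun y hy hyx => ?_) x rfl
    by_contra hne
    have h2 := (hS _).mp (D.sub_mem y hy b hne) i
    rw [map_sub] at h2
    omega
  have := (D.isPolyFun b (m c - m b)).eq_zero_of_slab (v i) (hv.exists_eq_one i) (fun x h1 h2 => by
    rw [h0 x h1 h2, sub_zero]
    refine h0 _ ?_ ?_
    all_goals rw [map_add, map_sub, hb, hc]; omega) (m b)
  rw [add_sub_cancel, D.apply_self, D.apply_ne b c hbc] at this
  simp at this

end Combinatorics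

/-! ### Rays of the monoid and the dual system -/

section Rays
variable {M : Type*} [AddCommGroup M] {ι : Type*} [Finite ι] {v : ι → M →+ ℤ} {S : AddSubmonoid M}

/-- If `x` has minimal support among the elements of `S` where `v i` is positive, then the elements of
`S` with support in that of `x` are proportional to `x` modulo the units of `S`. -/
lemma proportional_of_minimal (hS : ∀ x, x ∈ S ↔ ∀ i, 0 ≤ v i x) {i : ι} {x : M} (hx : x ∈ S)
    (hxi : 0 < v i x)
    (hmin : ∀ z ∈ S, 0 < v i z → (∀ j, v j x = 0 → v j z = 0) → ∀ j, v j z = 0 → v j x = 0)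
    {y : M} (hy : y ∈ S) (hyx : ∀ j, v j x = 0 → v j y = 0) (j : ι) :
    v j y * v i x = v i y * v j x := by
  have hle : ∀ y ∈ S, (∀ j, v j x = 0 → v j y = 0) → ∀ j, v j y * v i x ≤ v i y * v j x := by
    intro y hy hyx j
    by_contra! hlt
    have hx0 : ∀ j, 0 ≤ v j x := (hS x).mp hx
    have hy0 : ∀ j, 0 ≤ v j y := (hS y).mp hy
    have hj : 0 < v j x := by
      refine lt_of_le_of_ne (hx0 j) fun h => ?_
      rw [hyx j h.symm, ← h] at hlt
      simp at hlt
    cases nonempty_fintype ι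
    classical
    -- At an index `a` where the ratio of `y` to `x` is largest, the combination `v a y • x - v a x
    -- • y` vanishes, and it is still in `S` and positive under `v i`. This contradicts the
    -- minimality of the support of `x`.
    obtain ⟨a, ha, hmax⟩ := Finset.exists_max_image (Finset.univ.filter fun j => 0 < v j x)
      (fun j => (v j y : ℚ) / v j x) ⟨j, by simpa using hj⟩
    simp only [Finset.mem_filter, Finset.mem_univ, true_and] at ha hmax
    have hmul : ∀ b, 0 < v b x → v b y * v a x ≤ v a y * v b x := by
      intro b hb
      have := hmax b hb
      rw [div_le_div_iff₀ (by exact_mod_cast hb) (by exact_mod_cast ha)] at this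
      exact_mod_cast this
    have hz : v a y • x - v a x • y ∈ S := by
      rw [hS]
      intro b
      simp only [map_sub, map_zsmul, smul_eq_mul]
      rcases (hx0 b).eq_or_lt with hb | hb
      · rw [hyx b hb.symm, ← hb]; simp
      · have := hmul b hb
        nlinarith
    have hzi : 0 < v i (v a y • x - v a x • y) := by
      simp only [map_sub, map_zsmul, smul_eq_mul]
      have h1 := hmul j hj
      have : 0 < v j x * (v a y * v i x - v a x * v i y) := by nlinarith
      exact pos_of_mul_pos_right this hj.le
    have := hmin _ hz hzi (fun b hb => by simp [hb, hyx b hb]) a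
      (by simp only [map_sub, map_zsmul, smul_eq_mul]; ring)
    omega
  have h1 := hle y hy hyx
  -- By the inequalities just proved this element lies in `S`. It is zero under `v i`, so the same
  -- inequalities applied to it give the opposite ones for `y`.
  have hz : v i y • x - v i x • y ∈ S := by
    rw [hS]
    intro b
    simp only [map_sub, map_zsmul, smul_eq_mul]
    have := h1 b
    nlinarith
  have h2 := hle _ hz (fun b hb => by simp [hb, hyx b hb]) j
  simp only [map_sub, map_zsmul, smul_eq_mul] at h2
  have h3 := h1 j
  have : v i x * (v i y * v j x - v i x * v j y) ≤ 0 := by nlinarith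
  have := nonpos_of_mul_nonpos_right this hxi
  nlinarith

/-- If `h` is not divisible modulo the common kernel of the forms `v i`, then some integral form that
factors through the `v i` takes the value `1` at `h`. -/
lemma exists_form_eq_one (v : ι → M →+ ℤ) (h : M)
    (hprim : ∀ (g : ℤ) (y : M), (∀ j, v j h = g * v j y) → IsUnit g) :
    ∃ w : M →+ ℤ, w h = 1 ∧ ∀ x, (∀ j, v j x = 0) → w x = 0 := by
  let V : M →ₗ[ℤ] (ι → ℤ) := LinearMap.pi fun i => (v i).toIntLinearMap
  let b := Module.finBasis ℤ (LinearMap.range V)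
  let h' : LinearMap.range V := V.rangeRestrict h
  -- The generator `g` of `I` is the content of the image of `h` in the lattice of values. The image
  -- is `g` times a lattice vector, so `g` is a unit by assumption, and Bézout coefficients of the
  -- coordinates define the form.
  let I : Ideal ℤ := Ideal.span (Set.range fun a => b.repr h' a)
  obtain ⟨g, hg⟩ := (IsPrincipalIdealRing.principal I).principal
  have hdvd : ∀ a, ∃ c, b.repr h' a = g * c := by
    intro a
    have : b.repr h' a ∈ I := Ideal.subset_span ⟨a, rfl⟩
    rw [hg] at this
    exact Ideal.mem_span_singleton.mp this
  choose c hc using hdvd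
  obtain ⟨y, hy⟩ := V.surjective_rangeRestrict (∑ a, c a • b a)
  have hgu : IsUnit g := by
    refine hprim g y fun j => ?_
    have h1 : h' = g • ∑ a, c a • b a := by
      rw [← b.sum_repr h', Finset.smul_sum]
      exact Finset.sum_congr rfl fun a _ => by rw [hc, mul_smul]
    rw [← hy] at h1
    exact congrFun (congrArg Subtype.val h1) j
  have h1 : (1 : ℤ) ∈ I := by
    exact (Ideal.eq_top_iff_one I).mp (hg.trans (Ideal.span_singleton_eq_top.mpr hgu))
  obtain ⟨e, he⟩ := Ideal.mem_span_range_iff_exists_fun.mp h1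
  refine ⟨((∑ a, e a • b.coord a) ∘ₗ V.rangeRestrict).toAddMonoidHom, ?_, fun x hx => ?_⟩
  · change (∑ a, e a • b.coord a) (V.rangeRestrict h) = 1
    rw [← he]
    simp [h']
  · change (∑ a, e a • b.coord a) (V.rangeRestrict x) = 0
    have : V.rangeRestrict x = 0 := Subtype.ext (funext fun j => hx j)
    rw [this, map_zero]

/-- By `proportional_of_minimal` an element of minimal support spans a ray modulo units. Since only
finitely many supports occur, extremal rays are found without convex geometry. -/
lemma exists_minimal_support {i : ι} {y : M} (hy : y ∈ S)
    (hyi : 0 < v i y) : ∃ x ∈ S, 0 < v i x ∧ (∀ j, v j y = 0 → v j x = 0) ∧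
      ∀ z ∈ S, 0 < v i z → (∀ j, v j x = 0 → v j z = 0) → ∀ j, v j z = 0 → v j x = 0 := by
  have hfin : {T : Set ι | ∃ x ∈ S, 0 < v i x ∧ (∀ j, v j y = 0 → v j x = 0) ∧
      T = {j | v j x ≠ 0}}.Finite := Set.toFinite _
  obtain ⟨T, ⟨x, hx, hxi, hxy, rfl⟩, hT⟩ := hfin.exists_minimal ⟨_, y, hy, hyi, fun _ h => h, rfl⟩
  refine ⟨x, hx, hxi, hxy, fun z hz hzi hzx j hj => ?_⟩
  have := hT ⟨z, hz, hzi, fun j h => hzx j (hxy j h), rfl⟩ (fun j hj h => hj (hzx j h))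
  by_contra h
  exact this h hj

/-- The primitive generator of the ray of `S` through `x`. -/
lemma exists_primitive (hS : ∀ x, x ∈ S ↔ ∀ i, 0 ≤ v i x) {i : ι} {x : M} (hx : x ∈ S)
    (hxi : 0 < v i x) : ∃ h ∈ S, 0 < v i h ∧ (∀ j, v j x = 0 → v j h = 0) ∧
      (∀ z, (∀ j, v j z * v i x = v i z * v j x) → ∃ c : ℤ, ∀ j, v j z = c * v j h) ∧
      ∀ (g : ℤ) (y : M), (∀ j, v j h = g * v j y) → IsUnit g := by
  have hx0 : ∀ j, 0 ≤ v j x := (hS x).mp hx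
  -- The elements proportional to `x` under the forms are a group. An element `h` of this group with
  -- the least positive value of `v i` generates it modulo the common kernel, by division with
  -- remainder.
  have hex : ∃ k : ℕ, 0 < k ∧ ∃ h, (∀ j, v j h * v i x = v i h * v j x) ∧ v i h = k :=
    ⟨(v i x).toNat, by omega, x, fun j => mul_comm _ _, by omega⟩
  classical
  obtain ⟨hk, h, hh, hhk⟩ := Nat.find_spec hex
  have hmin : ∀ z, (∀ j, v j z * v i x = v i z * v j x) → 0 < v i z → v i h ≤ v i z := by
    intro z hz hzi
    rw [hhk]
    have := Nat.find_min' hex ⟨by omega, z, hz, (Int.toNat_of_nonneg hzi.le).symm⟩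
    omega
  have hhi : 0 < v i h := by omega
  have hdiv : ∀ j, v j x = 0 → v j h = 0 := by
    intro j hj
    have := hh j
    rw [hj, mul_zero] at this
    exact (mul_eq_zero.mp this).resolve_right hxi.ne'
  refine ⟨h, ?_, hhi, hdiv, ?_, ?_⟩
  · rw [hS]
    intro j
    have h1 : 0 ≤ v j h * v i x := by
      rw [hh]
      exact mul_nonneg hhi.le (hx0 j)
    exact nonneg_of_mul_nonneg_left h1 hxi
  · intro z hz
    refine ⟨v i z / v i h, ?_⟩
    set c := v i z / v i h
    have h1 : v i (z - c • h) = v i z % v i h := by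
      rw [map_sub, map_zsmul, smul_eq_mul, Int.emod_def, mul_comm]
    have h2 : ∀ j, v j (z - c • h) * v i x = v i (z - c • h) * v j x := by
      intro j
      simp only [map_sub, map_zsmul, smul_eq_mul, sub_mul, mul_assoc, hz, hh]
    have h3 : v i (z - c • h) = 0 := by
      by_contra hne
      have h4 := Int.emod_nonneg (v i z) hhi.ne'
      have h5 := Int.emod_lt_of_pos (v i z) hhi
      have := hmin _ h2 (by omega)
      omega
    intro j
    have h4 := h2 j
    rw [h3, zero_mul] at h4
    have h5 := (mul_eq_zero.mp h4).resolve_right hxi.ne'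
    rwa [map_sub, map_zsmul, smul_eq_mul, sub_eq_zero] at h5
  · intro g y hy
    have hg : g ≠ 0 := by
      rintro rfl
      have := hy i
      omega
    have hyG : ∀ j, v j y * v i x = v i y * v j x := by
      intro j
      have := hh j
      rw [hy, hy i, mul_assoc, mul_assoc] at this
      exact mul_left_cancel₀ hg this
    rw [Int.isUnit_iff_natAbs_eq]
    have hi := hy i
    -- One of `y` and `-y` belongs to the same group with a positive value, so the minimality of `v
    -- i h` forces `g` to be 1 or -1.
    have hle : v i h ≤ |v i y| := by
      rcases lt_trichotomy (v i y) 0 with h0 | h0 | h0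
      · rw [abs_of_neg h0, ← map_neg]
        refine hmin (-y) (fun j => ?_) (by rw [map_neg]; omega)
        rw [map_neg, map_neg, neg_mul, neg_mul, hyG]
      · rw [h0] at hi; omega
      · rw [abs_of_pos h0]
        exact hmin y hyG h0
    have h1 : v i h = |g| * |v i y| := by rw [← abs_mul, ← hi, abs_of_pos hhi]
    have h2 : 0 < |v i y| := by omega
    have h3 : 0 < |g| := abs_pos.mpr hg
    have : |g| ≤ 1 := by
      by_contra! h4
      nlinarith
    rw [Int.abs_eq_natAbs] at this h3
    omega

variable (hv : IsFacetSystem v) (hS : ∀ x, x ∈ S ↔ ∀ i, 0 ≤ v i x)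
  {K κ : Type*} [Field K] {n : ℕ} {m : κ → M} {f : κ → M → K}
  (D : PluckerDatum S n m f)
include hv hS D

/-- Choose a primitive generator `h` of a ray in the face of `y`, and an integral form `w` with `w h
= 1` that is trivial on the common kernel. The condition `exists_form` at `n • h` yields `m b` with
`n • h - m b` in `S`, so `m b` lies on the ray, and `w` locates it at `n • h`. Then
`PluckerDatum.form_le` bounds all values of `h` by 1. -/
lemma PluckerDatum.exists_ray (hn : 1 ≤ n) {i : ι} {y : M} (hy : y ∈ S) (hyi : 0 < v i y) :
    ∃ h ∈ S, (∀ j, v j y = 0 → v j h = 0) ∧ v i h = 1 ∧ (∀ j, v j h ≤ 1) ∧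
      ∃ b, ∀ j, v j (m b) = n * v j h := by
  obtain ⟨x, hx, hxi, hxy, hmin⟩ := exists_minimal_support hy hyi
  obtain ⟨h, hh, hhi, hhx, hG, hprim⟩ := exists_primitive hS hx hxi
  obtain ⟨w, hw1, hw0⟩ := exists_form_eq_one v h hprim
  obtain ⟨b, hb, hwb⟩ := D.exists_form w (n • h) (by simp [hw1])
  have hsub := (hS _).mp (D.sub_mem _ (S.nsmul_mem hh n) b hb)
  have hb0 := (hS _).mp (D.mem b)
  simp only [map_sub, map_nsmul, nsmul_eq_mul, sub_nonneg] at hsub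
  -- Both `m b` and `n • h - m b` are in `S`, hence `m b` vanishes wherever `x` does and is
  -- proportional to it.
  obtain ⟨c, hc⟩ := hG (m b) (fun j => proportional_of_minimal hS hx hxi hmin (D.mem b)
    (fun j hj => by
      have h1 := hsub j
      rw [hhx j hj, mul_zero] at h1
      exact le_antisymm h1 (hb0 j)) j)
  have hwc : w (m b) = c := by
    have := hw0 (m b - c • h) (fun j => by simp [hc])
    rwa [map_sub, map_zsmul, hw1, smul_eq_mul, mul_one, sub_eq_zero] at this
  have h1 := hsub i
  have h2 := hb0 i
  rw [hc] at h1 h2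
  have h3 : 0 ≤ c := nonneg_of_mul_nonneg_left h2 hhi
  have h4 : c ≤ n := le_of_mul_le_mul_right h1 hhi
  -- The value `w (m b) = c` is between 0 and `n`, and `hwb` excludes everything below `n`.
  have h5 : c = n := by omega
  subst h5
  have h6 : ∀ j, v j h ≤ 1 := by
    intro j
    have := D.form_le hv hS j b
    rw [hc] at this
    exact le_of_mul_le_mul_left (this.trans (mul_one _).ge) (by exact_mod_cast hn)
  exact ⟨h, hh, fun j hj => hhx j (hxy j hj), le_antisymm (h6 i) hhi, h6, b, hc⟩

/-- If the monoid `S` has a Plücker datum, then the primitive generators of its facet system have a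
dual system in `S`. -/
theorem PluckerDatum.exists_dual (hn : 1 ≤ n) (i : ι) :
    ∃ h, v i h = 1 ∧ ∀ j ≠ i, v j h = 0 := by
  obtain ⟨y, hy, hyi⟩ : ∃ y ∈ S, 0 < v i y := by
    obtain ⟨q, hq0, hq⟩ := hv.exists_facet i
    obtain ⟨e, he⟩ := hv.exists_eq_one i
    have key : ∀ j, ∃ t : ℕ, ∀ s : ℕ, t ≤ s → 0 ≤ v j (e + s • q) := by
      intro j
      by_cases hj : j = i
      · subst hj
        exact ⟨0, fun s _ => by simp [hq0, he]⟩
      · refine ⟨(v j e).natAbs, fun s hs => ?_⟩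
        rw [map_add, map_nsmul, nsmul_eq_mul]
        have : (s : ℤ) ≤ s * v j q := le_mul_of_one_le_right (by positivity) (hq j hj)
        omega
    choose t ht using key
    cases nonempty_fintype ι
    exact ⟨e + Finset.univ.sup t • q, (hS _).mpr fun j =>
      ht j _ (Finset.le_sup (Finset.mem_univ j)), by simp [hq0, he]⟩
  obtain ⟨h, hh, -, hi, hle, b, hb⟩ := D.exists_ray hv hS hn hy hyi
  refine ⟨h, hi, fun j hj => ?_⟩
  by_contra hne
  have h1 : v j h = 1 := by
    have := (hS _).mp hh j
    have := hle j
    omega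
  obtain ⟨q, hq0, hq⟩ := hv.exists_facet i
  have hqS : q ∈ S := by
    rw [hS]
    intro a
    by_cases ha : a = i
    · rw [ha, hq0]
    · exact (hq a ha).le
  -- A second ray, inside the facet of `v i`, with value 1 under `v j`. Both `m b` and `m c` reach
  -- the maximal level `n` of `v j`, so `b = c`; but `v i` is `n` at `m b` and 0 at `m c`, and `n ≥
  -- 1`.
  obtain ⟨h', -, hq', hj', -, c, hc⟩ := D.exists_ray hv hS hn hqS (hq j hj)
  have hbc := D.eq_of_form_eq hv hS j b c (by simp [hb, h1]) (by simp [hc, hj'])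
  have h2 := hb i
  rw [hbc, hc, hi, hq' i hq0, mul_zero, mul_one] at h2
  omega

end Rays

/-! ### Taylor expansion on the torus -/

section Taylor
open TensorProduct
variable {k : Type u} [Field k] {M : Type} [AddCommGroup M] {K : Type u} [Field K] [Algebra k K]
  [Algebra (AddMonoidAlgebra k M) K] [IsScalarTower k (AddMonoidAlgebra k M) K]

variable (k K) in
/-- The character `χ^m` as an element of the field `K` of rational functions on the torus. -/
def torusChar (m : M) : K := algebraMap (AddMonoidAlgebra k M) K (AddMonoidAlgebra.single m 1)

lemma torusChar_zero : torusChar k K (0 : M) = 1 := map_one _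

lemma torusChar_add (a b : M) : torusChar k K (a + b) = torusChar k K a * torusChar k K b := by
  rw [torusChar, torusChar, torusChar, ← map_mul, AddMonoidAlgebra.single_mul_single, one_mul]

lemma torusChar_ne_zero (m : M) : torusChar k K m ≠ 0 := by
  intro h
  have := torusChar_add (k := k) (K := K) m (-m)
  rw [h, zero_mul, add_neg_cancel, torusChar_zero] at this
  exact one_ne_zero this

variable {T : Type} [Fintype T]

variable (K) in
/-- The unit `1 + X j` of the ring of power series. -/
def oneAddX (j : T) : (MvPowerSeries T K)ˣ :=
  IsUnit.unit (a := 1 + MvPowerSeries.X j)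
    (by rw [MvPowerSeries.isUnit_iff_constantCoeff]; simp)

variable (K) in
/-- The homomorphism `m ↦ ∏ⱼ (1 + X j) ^ (w j m)`. -/
def taylorUnit (w : T → M →+ ℤ) : Multiplicative M →* (MvPowerSeries T K)ˣ where
  toFun m := ∏ j, oneAddX K j ^ w j m.toAdd
  map_one' := by simp
  map_mul' a b := by simp [zpow_add, Finset.prod_mul_distrib]

lemma constantCoeff_taylorUnit (w : T → M →+ ℤ) (m : Multiplicative M) :
    MvPowerSeries.constantCoeff (taylorUnit K w m : MvPowerSeries T K) = 1 := by
  have h : ∀ j : T, Units.map (MvPowerSeries.constantCoeff (σ := T) (R := K)).toMonoidHom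
      (oneAddX K j) = 1 := by
    intro j
    ext
    simp [oneAddX]
  have : Units.map (MvPowerSeries.constantCoeff (σ := T) (R := K)).toMonoidHom
      (taylorUnit K w m) = 1 := by
    change Units.map _ (∏ j, oneAddX K j ^ w j m.toAdd) = 1
    rw [map_prod]
    exact Finset.prod_eq_one fun j _ => by rw [map_zpow, h, one_zpow]
  exact congrArg Units.val this

variable (k K) in
/-- The Taylor expansion `χ^m ↦ χ^m ∏ⱼ (1 + X j) ^ (w j m)`. -/
def taylorHom (w : T → M →+ ℤ) : AddMonoidAlgebra k M →ₐ[k] MvPowerSeries T K :=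
  AddMonoidAlgebra.lift k (MvPowerSeries T K) M
    { toFun := fun m => (MvPowerSeries.C (torusChar k K m.toAdd) : MvPowerSeries T K) *
        (taylorUnit K w m : MvPowerSeries T K)
      map_one' := by simp [torusChar_zero]
      map_mul' := fun a b => by
        simp only [toAdd_mul, torusChar_add, map_mul, Units.val_mul]
        ring }

lemma taylorHom_single (w : T → M →+ ℤ) (m : M) :
    taylorHom k K w (AddMonoidAlgebra.single m 1) =
      (MvPowerSeries.C (torusChar k K m) : MvPowerSeries T K) *
        (taylorUnit K w (.ofAdd m) : MvPowerSeries T K) := by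
  simp [taylorHom]

lemma constantCoeff_taylorHom (w : T → M →+ ℤ) (x : AddMonoidAlgebra k M) :
    MvPowerSeries.constantCoeff (taylorHom k K w x) = algebraMap _ K x := by
  induction x using AddMonoidAlgebra.induction_on with
  | of m =>
    change MvPowerSeries.constantCoeff (taylorHom k K w (AddMonoidAlgebra.single m 1)) = _
    rw [taylorHom_single, map_mul, constantCoeff_taylorUnit, mul_one]
    simp [torusChar]
  | add x y hx hy => rw [map_add, map_add, map_add, hx, hy]
  | smul r x hx =>
    rw [map_smul, IsScalarTower.algebraMap_smul K r _ |>.symm, MvPowerSeries.constantCoeff_smul, hx,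
      Algebra.smul_def r x, map_mul, ← IsScalarTower.algebraMap_apply, smul_eq_mul]

variable [IsFractionRing (AddMonoidAlgebra k M) K]

lemma isUnit_taylorHom (w : T → M →+ ℤ) (y : nonZeroDivisors (AddMonoidAlgebra k M)) :
    IsUnit (taylorHom k K w y) := by
  rw [MvPowerSeries.isUnit_iff_constantCoeff, constantCoeff_taylorHom]
  exact IsLocalization.map_units K y

variable (k K) in
/-- The extension of the Taylor expansion to the field of rational functions. -/
def taylorLift (w : T → M →+ ℤ) : K →ₐ[k] MvPowerSeries T K where
  __ := (IsLocalization.lift (isUnit_taylorHom (k := k) (K := K) w) : K →+* MvPowerSeries T K)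
  commutes' r := by
    change IsLocalization.lift (isUnit_taylorHom (k := k) (K := K) w) (algebraMap k K r) = _
    rw [IsScalarTower.algebraMap_apply k (AddMonoidAlgebra k M) K, IsLocalization.lift_eq]
    exact (taylorHom k K w).commutes r

lemma taylorLift_algebraMap (w : T → M →+ ℤ) (x : AddMonoidAlgebra k M) :
    taylorLift k K w (algebraMap _ K x) = taylorHom k K w x :=
  IsLocalization.lift_eq (isUnit_taylorHom (k := k) (K := K) w) x

lemma constantCoeff_taylorLift (w : T → M →+ ℤ) (x : K) :
    MvPowerSeries.constantCoeff (taylorLift k K w x) = x := by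
  have : (MvPowerSeries.constantCoeff (σ := T) (R := K)).comp
      (taylorLift k K w : K →+* MvPowerSeries T K) = RingHom.id K := by
    refine IsLocalization.ringHom_ext (nonZeroDivisors (AddMonoidAlgebra k M)) ?_
    ext x
    · change MvPowerSeries.constantCoeff (taylorLift k K w (algebraMap _ K _)) = _
      rw [taylorLift_algebraMap, constantCoeff_taylorHom]
      rfl
    · change MvPowerSeries.constantCoeff (taylorLift k K w (algebraMap _ K _)) = _
      rw [taylorLift_algebraMap, constantCoeff_taylorHom]
      rfl
  exact congrArg (fun g => g x) this

variable (k K) in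
/-- The homomorphism `K ⊗ K → K⟦X⟧` given by the constants and by the Taylor expansion. -/
def taylorTensor (w : T → M →+ ℤ) : K ⊗[k] K →ₐ[K] MvPowerSeries T K :=
  Algebra.TensorProduct.lift (Algebra.ofId K _) (taylorLift k K w) fun _ _ => Commute.all _ _

lemma taylorTensor_tmul (w : T → M →+ ℤ) (a b : K) :
    taylorTensor k K w (a ⊗ₜ b) = MvPowerSeries.C a * taylorLift k K w b := by
  rw [taylorTensor, Algebra.TensorProduct.lift_tmul]
  rfl

lemma constantCoeff_taylorTensor (w : T → M →+ ℤ) (z : K ⊗[k] K) :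
    MvPowerSeries.constantCoeff (taylorTensor k K w z) = Algebra.TensorProduct.lmul' k z := by
  induction z using TensorProduct.induction_on with
  | zero => simp
  | add x y hx hy => rw [map_add, map_add, map_add, hx, hy]
  | tmul a b =>
    rw [taylorTensor_tmul, map_mul, constantCoeff_taylorLift]
    simp

/-- The ideal of the diagonal goes to series without constant term, hence its power of exponent `n +
1` to series of order at least `n + 1`. So the Taylor coefficients of degree at most `n` define
linear forms on Pⁿ_K. -/
lemma coeff_taylorTensor_eq_zero (w : T → M →+ ℤ) {n : ℕ} {z : K ⊗[k] K}
    (hz : z ∈ KaehlerDifferential.ideal k K ^ (n + 1)) (a : T →₀ ℕ) (ha : a.degree ≤ n) :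
    MvPowerSeries.coeff a (taylorTensor k K w z) = 0 := by
  have key : ∀ (N : ℕ) (z : K ⊗[k] K), z ∈ KaehlerDifferential.ideal k K ^ N →
      (N : ℕ∞) ≤ (taylorTensor k K w z).order := by
    intro N
    induction N with
    | zero => simp
    | succ N ih =>
      intro z hz
      rw [pow_succ] at hz
      induction hz using Submodule.mul_induction_on' with
      | mem_mul_mem x hx y hy =>
        rw [map_mul]
        refine le_trans ?_ MvPowerSeries.le_order_mul
        push_cast
        refine add_le_add (ih x hx) ?_
        rw [MvPowerSeries.one_le_order_iff_constCoeff_eq_zero, constantCoeff_taylorTensor]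
        exact hy
      | add x _ y _ hx hy =>
        rw [map_add]
        exact le_trans (le_min hx hy) MvPowerSeries.min_order_le_add
  refine MvPowerSeries.coeff_of_lt_order (lt_of_lt_of_le ?_ (key _ z hz))
  exact_mod_cast Nat.lt_succ_of_le ha

variable (k K) in
/-- The element `χ^{-m} ⊗ χ^m` of `K ⊗ K`. -/
def ratioTensor (m : M) : K ⊗[k] K := (torusChar k K m)⁻¹ ⊗ₜ torusChar k K m

lemma taylorTensor_ratioTensor (w : T → M →+ ℤ) (m : M) :
    taylorTensor k K w (ratioTensor k K m) = taylorUnit K w (.ofAdd m) := by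
  rw [ratioTensor, taylorTensor_tmul, torusChar, taylorLift_algebraMap, taylorHom_single,
    ← mul_assoc, ← map_mul, ← torusChar, inv_mul_cancel₀ (torusChar_ne_zero m), map_one, one_mul]

end Taylor

/-! ### The classes of χ^{-m} ⊗ χ^m -/

section Ratio
open TensorProduct
variable (k : Type u) [Field k] {M : Type} [AddCommGroup M] (K : Type u) [Field K] [Algebra k K]
  [Algebra (AddMonoidAlgebra k M) K] (n : ℕ)

/-- The class of `χ^{-m} ⊗ χ^m` in `Pⁿ_K`. -/
def ratio (m : M) : PrincipalParts k K n := Ideal.Quotient.mk _ (ratioTensor k K m)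

variable {k K n} [IsScalarTower k (AddMonoidAlgebra k M) K]

lemma ratio_zero : ratio k K n (0 : M) = 1 := by
  rw [ratio, ratioTensor, torusChar_zero, inv_one]
  rfl

lemma ratio_add (a b : M) : ratio k K n (a + b) = ratio k K n a * ratio k K n b := by
  rw [ratio, ratio, ratio, ← map_mul, ratioTensor, ratioTensor, ratioTensor,
    Algebra.TensorProduct.tmul_mul_tmul, torusChar_add, mul_inv]

lemma ratio_sub_one_mem (m : M) : ratio k K n m - 1 ∈
    (KaehlerDifferential.ideal k K).map (Ideal.Quotient.mk (KaehlerDifferential.ideal k K ^ (n + 1))) := by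
  rw [ratio, ← map_one (Ideal.Quotient.mk _), ← map_sub]
  refine Ideal.mem_map_of_mem _ ?_
  change Algebra.TensorProduct.lmul' k (ratioTensor k K m - 1) = 0
  rw [map_sub, map_one, ratioTensor, Algebra.TensorProduct.lmul'_apply_tmul,
    inv_mul_cancel₀ (torusChar_ne_zero m), sub_self]

lemma prod_eq_zero_of_mem_map {ι : Type} [Fintype ι] {t : ι → PrincipalParts k K n}
    (ht : ∀ i, t i ∈ (KaehlerDifferential.ideal k K).map
      (Ideal.Quotient.mk (KaehlerDifferential.ideal k K ^ (n + 1)))) (a : ι →₀ ℕ) (ha : n < a.degree) :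
    ∏ i, t i ^ a i = 0 := by
  set J := (KaehlerDifferential.ideal k K).map
    (Ideal.Quotient.mk (KaehlerDifferential.ideal k K ^ (n + 1)))
  have h1 : ∏ i, t i ^ a i ∈ ∏ i, J ^ a i :=
    Ideal.prod_mem_prod fun i _ => Ideal.pow_mem_pow (ht i) _
  rw [Finset.prod_pow_eq_pow_sum, ← Finsupp.degree_eq_sum] at h1
  have h2 := Ideal.pow_le_pow_right (Nat.succ_le_of_lt ha) h1
  rw [← Ideal.map_pow, Ideal.map_quotient_self] at h2
  exact h2

end Ratio

/-! ### Subalgebras generated by nilpotent elements -/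

section Span
variable {F P : Type*} [CommRing F] [CommRing P] [Algebra F P]

lemma adjoin_le_span_monomials {ι : Type} [Fintype ι] (t : ι → P) (n : ℕ)
    (h : ∀ a : ι →₀ ℕ, n < a.degree → ∏ i, t i ^ a i = 0) :
    Subalgebra.toSubmodule (Algebra.adjoin F (Set.range t)) ≤
      Submodule.span F (Set.range fun a : {a : ι →₀ ℕ // a.degree ≤ n} => ∏ i, t i ^ a.1 i) := by
  intro x hx
  rw [Subalgebra.mem_toSubmodule, Algebra.adjoin_range_eq_range_aeval] at hx
  obtain ⟨p, rfl⟩ := hx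
  change MvPolynomial.aeval t p ∈ _
  rw [MvPolynomial.aeval_def, MvPolynomial.eval₂_eq']
  refine Submodule.sum_mem _ fun a _ => ?_
  rw [← Algebra.smul_def]
  refine Submodule.smul_mem _ _ ?_
  by_cases ha : a.degree ≤ n
  · exact Submodule.subset_span ⟨⟨a, ha⟩, rfl⟩
  · rw [h a (not_le.mp ha)]
    exact Submodule.zero_mem _

/-- A unit of `B` plus a nilpotent element of `B` is a unit of `B`, and inverses are unique. In the
algebra of principal parts 1 ⊗ x is a nilpotent perturbation of x ⊗ 1, so this provides inverses of
elements of the right factor. -/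
lemma mem_of_mul_eq_one {B : Subalgebra F P} {x y ν z : P} (hx : x ∈ B) (hy : y ∈ B) (hν : ν ∈ B)
    (hn : IsNilpotent ν) (hxy : x * y = 1) (hz : (x + ν) * z = 1) : z ∈ B := by
  have h1 : IsUnit (⟨x, hx⟩ : B) := .of_mul_eq_one ⟨y, hy⟩ (Subtype.ext hxy)
  have h2 : IsNilpotent (⟨ν, hν⟩ : B) := by
    obtain ⟨N, hN⟩ := hn
    exact ⟨N, Subtype.ext hN⟩
  obtain ⟨c, hc⟩ := (IsNilpotent.isUnit_add_left_of_commute h2 h1 (Commute.all _ _)).exists_right_inv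
  have hc : (x + ν) * (c : P) = 1 := congrArg Subtype.val hc
  have : z = c := by
    calc z = z * ((x + ν) * c) := by rw [hc, mul_one]
      _ = ((x + ν) * z) * c := by ring
      _ = c := by rw [hz, one_mul]
  rw [this]
  exact c.2

end Span

/-! ### A monomial basis of the principal parts of the function field -/

section Basis
open TensorProduct
variable {k : Type u} [Field k] {M : Type} [AddCommGroup M] {K : Type u} [Field K] [Algebra k K]
  [Algebra (AddMonoidAlgebra k M) K] [IsScalarTower k (AddMonoidAlgebra k M) K]
  {ι : Type} [Fintype ι] (g : Module.Basis ι ℤ M) (n : ℕ)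

variable (k K) in
/-- The monomials in the elements `χ^{-g i} ⊗ χ^{g i} - 1` of `Pⁿ_K`, for a basis `g` of the lattice. -/
def ratioMonomial (a : {a : ι →₀ ℕ // a.degree ≤ n}) : PrincipalParts k K n :=
  ∏ i, (ratio k K n (g i) - 1) ^ a.1 i

instance : Finite {a : ι →₀ ℕ // a.degree ≤ n} := Finsupp.finite_of_degree_le n

lemma prod_ratio_eq_zero (a : ι →₀ ℕ) (ha : n < a.degree) :
    ∏ i, (ratio k K n (g i) - 1) ^ a i = 0 :=
  prod_eq_zero_of_mem_map (fun i => ratio_sub_one_mem (g i)) a ha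

lemma isNilpotent_ratio_sub_one (m : M) : IsNilpotent (ratio k K n m - 1) := by
  refine ⟨n + 1, ?_⟩
  have := prod_eq_zero_of_mem_map (ι := Unit) (fun _ => ratio_sub_one_mem (k := k) (K := K) (n := n) m)
    (Finsupp.single () (n + 1)) (by simp)
  simpa using this

/-- The class for `-g i` is the inverse of 1 plus the nilpotent element `ratio k K n (g i) - 1`, so
it lies in the algebra generated by the latter. It matters that this is an algebra over `k` and not
over `K`: this makes the coordinates of the classes constants later on. -/
lemma ratio_mem_adjoin (m : M) :
    ratio k K n m ∈ Algebra.adjoin k (Set.range fun i => ratio k K n (g i) - 1) := by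
  set B := Algebra.adjoin k (Set.range fun i => ratio k K n (g i) - 1)
  have ht : ∀ i, ratio k K n (g i) - 1 ∈ B := fun i => Algebra.subset_adjoin ⟨i, rfl⟩
  have h1 : ∀ i, ratio k K n (g i) ∈ B := fun i => by
    simpa using B.add_mem (ht i) B.one_mem
  have h2 : ∀ i, ratio k K n (-g i) ∈ B := fun i => by
    refine mem_of_mul_eq_one B.one_mem B.one_mem (ht i) (isNilpotent_ratio_sub_one n (g i))
      (one_mul 1) ?_
    rw [add_sub_cancel, ← ratio_add, add_neg_cancel, ratio_zero]
  have hm : m ∈ AddSubgroup.closure (Set.range g) := by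
    have : m ∈ Submodule.span ℤ (Set.range g) := by rw [g.span_eq]; trivial
    rwa [← Submodule.mem_toAddSubgroup, Submodule.span_int_eq_addSubgroupClosure] at this
  rw [← AddSubgroup.mem_toAddSubmonoid, AddSubgroup.closure_toAddSubmonoid] at hm
  induction hm using AddSubmonoid.closure_induction with
  | mem x hx =>
    rcases hx with ⟨i, rfl⟩ | ⟨i, hi⟩
    · exact h1 i
    · rw [← neg_neg x, ← hi]
      exact h2 i
  | zero =>
    rw [ratio_zero]
    exact B.one_mem
  | add x y _ _ hx hy =>
    rw [ratio_add]
    exact B.mul_mem hx hy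

lemma ratio_mem_span (m : M) :
    ratio k K n m ∈ Submodule.span k (Set.range (ratioMonomial k K g n)) :=
  adjoin_le_span_monomials (F := k) _ n (prod_ratio_eq_zero g n) (ratio_mem_adjoin g n m)

variable [IsFractionRing (AddMonoidAlgebra k M) K]

lemma mk_one_tmul_torusChar (m : M) :
    (Ideal.Quotient.mk (KaehlerDifferential.ideal k K ^ (n + 1)) (1 ⊗ₜ torusChar k K m)) =
      torusChar k K m • ratio k K n m := by
  change _ = Ideal.Quotient.mk _ (torusChar k K m • ratioTensor k K m)
  rw [ratioTensor, TensorProduct.smul_tmul', smul_eq_mul, mul_inv_cancel₀ (torusChar_ne_zero m)]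

/-- Over `K`, Pⁿ_K is spanned by the elements 1 ⊗ b. For a character b this is a multiple of a
`ratio`; for a fraction, the denominator on the right is inverted as a nilpotent perturbation of the
same denominator on the left. -/
lemma span_ratioMonomial_eq_top :
    Submodule.span K (Set.range (ratioMonomial k K g n)) = ⊤ := by
  set B := Algebra.adjoin K (Set.range fun i => ratio k K n (g i) - 1)
  have hB : Subalgebra.toSubmodule B ≤ Submodule.span K (Set.range (ratioMonomial k K g n)) :=
    adjoin_le_span_monomials (F := K) _ n (prod_ratio_eq_zero g n)
  let τ : K →ₐ[k] PrincipalParts k K n :=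
    (Ideal.Quotient.mkₐ k _).comp Algebra.TensorProduct.includeRight
  have h1 : ∀ m : M, ratio k K n m ∈ B := by
    intro m
    have h := ratio_mem_adjoin (k := k) (K := K) g n m
    have hle : Algebra.adjoin k (Set.range fun i => ratio k K n (g i) - 1) ≤
        B.restrictScalars k := Algebra.adjoin_le Algebra.subset_adjoin
    exact hle h
  have h2 : ∀ x : AddMonoidAlgebra k M, τ (algebraMap _ K x) ∈ B := by
    intro x
    induction x using AddMonoidAlgebra.induction_on with
    | of m =>
      change Ideal.Quotient.mk _ (1 ⊗ₜ torusChar k K m) ∈ B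
      rw [mk_one_tmul_torusChar]
      exact B.smul_mem (h1 m) _
    | add x y hx hy =>
      rw [map_add, map_add]
      exact B.add_mem hx hy
    | smul r x hx =>
      rw [Algebra.smul_def r x, map_mul, ← IsScalarTower.algebraMap_apply, map_mul, AlgHom.commutes,
        ← Algebra.smul_def, ← algebraMap_smul K r]
      exact B.smul_mem hx _
  have h3 : ∀ x : K, τ x ∈ B := by
    intro x
    obtain ⟨a, b, hb, rfl⟩ := IsFractionRing.div_surjective (A := AddMonoidAlgebra k M) x
    have hb0 : algebraMap _ K b ≠ 0 :=
      IsFractionRing.to_map_ne_zero_of_mem_nonZeroDivisors hb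
    rw [div_eq_mul_inv, map_mul]
    refine B.mul_mem (h2 a) ?_
    refine mem_of_mul_eq_one (x := algebraMap K _ (algebraMap _ K b))
      (y := algebraMap K _ (algebraMap _ K b)⁻¹)
      (ν := τ (algebraMap _ K b) - algebraMap K _ (algebraMap _ K b)) (B.algebraMap_mem _)
      (B.algebraMap_mem _) (B.sub_mem (h2 b) (B.algebraMap_mem _)) ⟨n + 1, ?_⟩ ?_ ?_
    · change (Ideal.Quotient.mk (KaehlerDifferential.ideal k K ^ (n + 1))
        (1 ⊗ₜ (algebraMap _ K b) - (algebraMap _ K b) ⊗ₜ 1)) ^ (n + 1) = 0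
      rw [← map_pow, Ideal.Quotient.eq_zero_iff_mem]
      exact Ideal.pow_mem_pow (KaehlerDifferential.one_smul_sub_smul_one_mem_ideal k _) _
    · rw [← map_mul, mul_inv_cancel₀ hb0, map_one]
    · rw [add_sub_cancel, ← map_mul, mul_inv_cancel₀ hb0, map_one]
  rw [eq_top_iff]
  rintro p -
  apply hB
  obtain ⟨z, rfl⟩ := Ideal.Quotient.mk_surjective p
  induction z using TensorProduct.induction_on with
  | zero =>
    rw [map_zero]
    exact Submodule.zero_mem _
  | add x y hx hy =>
    rw [map_add]
    exact Submodule.add_mem _ hx hy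
  | tmul a b =>
    have : Ideal.Quotient.mk (KaehlerDifferential.ideal k K ^ (n + 1)) (a ⊗ₜ[k] b) = a • τ b := by
      change _ = Ideal.Quotient.mk _ (a • (1 : K) ⊗ₜ[k] b)
      rw [TensorProduct.smul_tmul', smul_eq_mul, mul_one]
    rw [this]
    exact B.smul_mem (h3 b) _

/-- The Taylor expansion along the coordinate forms of `g` maps `ratioTensor k K (g i) - 1` to the
variable `X i`. A relation thus gives a combination of distinct monomials of degree at most `n`
whose coefficients up to degree `n` vanish. -/
lemma linearIndependent_ratioMonomial : LinearIndependent K (ratioMonomial k K g n) := by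
  classical
  cases nonempty_fintype {a : ι →₀ ℕ // a.degree ≤ n}
  rw [Fintype.linearIndependent_iff]
  intro c hc b
  let w : ι → M →+ ℤ := fun i => (g.coord i).toAddMonoidHom
  have h1 : ∑ a, c a • ∏ i, (ratioTensor k K (g i) - 1) ^ a.1 i ∈
      KaehlerDifferential.ideal k K ^ (n + 1) := by
    rw [← Ideal.Quotient.eq_zero_iff_mem, ← hc, map_sum]
    refine Finset.sum_congr rfl fun a _ => ?_
    change _ = c a • ∏ i, (Ideal.Quotient.mk _ _ - 1) ^ a.1 i
    rw [← map_one (Ideal.Quotient.mk _)]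
    simp only [← map_sub, ← map_pow, ← map_prod]
    rfl
  have h2 := coeff_taylorTensor_eq_zero w h1 b.1 b.2
  have h3 : ∀ i, taylorTensor k K w (ratioTensor k K (g i) - 1) = MvPowerSeries.X i := by
    intro i
    rw [map_sub, map_one, taylorTensor_ratioTensor]
    have : taylorUnit K w (.ofAdd (g i)) = oneAddX K i := by
      change ∏ j, oneAddX K j ^ w j (g i) = _
      rw [Finset.prod_eq_single i]
      · simp [w]
      · intro j _ hj
        simp [w, hj.symm]
      · simp
    rw [this]
    simp [oneAddX]
  simp only [map_sum, map_smul, map_prod, map_pow, h3] at h2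
  rw [Finset.sum_eq_single b] at h2
  · have h4 : ∏ i, (MvPowerSeries.X i : MvPowerSeries ι K) ^ b.1 i = MvPowerSeries.monomial b.1 1 := by
      rw [MvPowerSeries.monomial_one_eq, Finsupp.prod_fintype _ _ (by simp)]
    rw [h4] at h2
    simpa using h2
  · intro a _ hab
    have h4 : ∏ i, (MvPowerSeries.X i : MvPowerSeries ι K) ^ a.1 i = MvPowerSeries.monomial a.1 1 := by
      rw [MvPowerSeries.monomial_one_eq, Finsupp.prod_fintype _ _ (by simp)]
    rw [h4, MvPowerSeries.coeff_monomial_ne (fun h => hab (Subtype.ext h.symm)), smul_zero]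
  · simp

variable (k K) in
/-- The basis of `Pⁿ_K` given by the monomials in `χ^{-g i} ⊗ χ^{g i} - 1`. -/
def ratioBasis : Module.Basis {a : ι →₀ ℕ // a.degree ≤ n} K (PrincipalParts k K n) :=
  .mk (linearIndependent_ratioMonomial g n) (span_ratioMonomial_eq_top g n).ge

include g in
/-- Relations between the classes of `χ^{-m} ⊗ χ^m` are defined over `k`. -/
lemma ratio_mem_span_of_linearIndependent {κ : Type} [Fintype κ]
    (hκ : Fintype.card κ = Module.finrank K (PrincipalParts k K n)) {m : κ → M}
    (hm : LinearIndependent K fun i => ratio k K n (m i)) (s : M) :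
    ratio k K n s ∈ Submodule.span k (Set.range fun i => ratio k K n (m i)) := by
  cases nonempty_fintype {a : ι →₀ ℕ // a.degree ≤ n}
  have h1 : Submodule.span k (Set.range fun i => ratio k K n (m i)) ≤
      Submodule.span k (Set.range (ratioMonomial k K g n)) := by
    rw [Submodule.span_le]
    rintro _ ⟨i, rfl⟩
    exact ratio_mem_span g n (m i)
  have h2 := finrank_span_eq_card (hm.restrict_scalars' k)
  have h3 := finrank_span_eq_card
    ((linearIndependent_ratioMonomial (k := k) (K := K) g n).restrict_scalars' k)
  have : FiniteDimensional k (Submodule.span k (Set.range (ratioMonomial k K g n))) :=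
    FiniteDimensional.span_of_finite k (Set.finite_range _)
  -- Both spaces have the dimension of Pⁿ_K over `K` as their dimension over `k`, because
  -- independence over `K` implies independence over `k`.
  rw [Submodule.eq_of_le_of_finrank_eq h1]
  · exact ratio_mem_span g n s
  · rw [h2, h3, hκ, Module.finrank_eq_card_basis (ratioBasis k K g n)]

-- The basis `ratioBasis` shows that Pⁿ_K has finite dimension, so the form is not the default value
-- 0.
include g in
lemma exists_pluckerForm_eq_det : ∃ b : Module.Basis
    (Fin (Module.finrank K (PrincipalParts k K n))) K (PrincipalParts k K n),
    pluckerForm k K n = b.det := by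
  have : Module.Finite K (PrincipalParts k K n) := .of_basis (ratioBasis k K g n)
  have h : Nonempty (Module.Basis (Fin (Module.finrank K (PrincipalParts k K n))) K
      (PrincipalParts k K n)) := ⟨Module.finBasis K _⟩
  refine ⟨h.some, ?_⟩
  rw [pluckerForm, dif_pos h]

end Basis

/-! ### From a local generator of the Plücker module to a Plücker datum -/

section Datum
open TensorProduct
variable {k : Type u} [Field k] {M : Type} [AddCommGroup M] {K : Type u} [Field K] [Algebra k K]
  [Algebra (AddMonoidAlgebra k M) K] [IsScalarTower k (AddMonoidAlgebra k M) K] {n : ℕ}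

/-- A difference in the direction `a` multiplies by `ratio k K n a - 1`, which lies in the ideal `J`
of the diagonal. After `n + 1` differences the factor is in the power of `J` of exponent `n + 1`,
which is zero. -/
lemma isPolyFun_ratio (c : PrincipalParts k K n →ₗ[K] K) :
    IsPolyFun (n + 1) fun m : M => c (ratio k K n m) := by
  set J := (KaehlerDifferential.ideal k K).map
    (Ideal.Quotient.mk (KaehlerDifferential.ideal k K ^ (n + 1)))
  have key : ∀ N j : ℕ, N + j = n + 1 → ∀ z ∈ J ^ j,
      IsPolyFun N fun m : M => c (z * ratio k K n m) := by
    intro N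
    induction N with
    | zero =>
      intro j hj z hz m
      rw [← Ideal.map_pow, show j = n + 1 by omega, Ideal.map_quotient_self] at hz
      change c (z * ratio k K n m) = 0
      rw [show z = 0 from hz, zero_mul, map_zero]
    | succ N ih =>
      intro j hj z hz a
      have := ih (j + 1) (by omega) (z * (ratio k K n a - 1))
        (by rw [pow_succ (M := Ideal (PrincipalParts k K n)) J]; exact Ideal.mul_mem_mul hz (ratio_sub_one_mem a))
      convert this using 2 with m
      rw [← map_sub, ratio_add]
      congr 1
      ring
  simpa using key (n + 1) 0 rfl 1 (by simp)

lemma coeff_taylorUnit_nat (w : M →+ ℤ) (m : M) (j : ℕ) (hj : w m = j) :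
    MvPowerSeries.coeff (Finsupp.single () n)
      (taylorUnit K (fun _ : Unit => w) (.ofAdd m) : MvPowerSeries Unit K) = (j.choose n : K) := by
  have : (taylorUnit K (fun _ : Unit => w) (.ofAdd m) : MvPowerSeries Unit K) =
      (1 + MvPowerSeries.X ()) ^ j := by
    change ((∏ _j : Unit, oneAddX K _j ^ w m : (MvPowerSeries Unit K)ˣ) : MvPowerSeries Unit K) = _
    rw [hj]
    simp [oneAddX]
  rw [this]
  have h := Polynomial.coeff_one_add_X_pow K j n
  rw [← Polynomial.coeff_coe] at h
  push_cast at h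
  exact h

variable [IsFractionRing (AddMonoidAlgebra k M) K]

/-- The Taylor coefficient of degree `n` along `w` of the class of `m` is the binomial coefficient
of `w m` and `n` when `w m ≥ 0`. It is 1 at `q` and 0 for `0 ≤ w (m i) < n`, in every
characteristic. -/
lemma sum_choose_eq {κ : Type} [Fintype κ] (w : M →+ ℤ) {m : κ → M} {c : κ → K} {q : M}
    (h : ratio k K n q = ∑ i, c i • ratio k K n (m i)) (hq : w q = n)
    (hm : ∀ i, c i ≠ 0 → 0 ≤ w (m i) ∧ w (m i) < n) : False := by
  have h1 : ratioTensor k K q - ∑ i, c i • ratioTensor k K (m i) ∈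
      KaehlerDifferential.ideal k K ^ (n + 1) := by
    rw [← Ideal.Quotient.eq_zero_iff_mem, map_sub, sub_eq_zero, map_sum]
    exact h
  have h2 := coeff_taylorTensor_eq_zero (fun _ : Unit => w) h1 (Finsupp.single () n) (by simp)
  rw [map_sub, map_sub, map_sum, map_sum, taylorTensor_ratioTensor, coeff_taylorUnit_nat w q n hq,
    Finset.sum_eq_zero] at h2
  · simp at h2
  · intro i _
    rw [map_smul, map_smul, taylorTensor_ratioTensor]
    by_cases hc : c i = 0
    · rw [hc, zero_smul]
    · obtain ⟨h0, h1⟩ := hm i hc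
      rw [coeff_taylorUnit_nat w (m i) (w (m i)).toNat (by omega), Nat.choose_eq_zero_of_lt (by omega)]
      simp

variable {ι : Type} [Fintype ι] (g : Module.Basis ι ℤ M)

include g in
/-- If, locally at a point where only the monomials in `S` are regular, the module of Plücker
coordinates is generated by one of the Plücker coordinates of monomials in `S`, then there is a
Plücker datum for `S`. -/
theorem exists_pluckerDatum {A : Type u} [CommRing A] [Algebra A K] {S : AddSubmonoid M}
    {p : Ideal A}
    (hp : ∀ q : M, (∃ a b : A, b ∉ p ∧ algebraMap A K b * torusChar k K q = algebraMap A K a) → q ∈ S)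
    (hk : ∀ c : k, ∃ a : A, algebraMap A K a = algebraMap k K c)
    {m : Fin (Module.finrank K (PrincipalParts k K n)) → M} (hm : ∀ i, m i ∈ S)
    (hne : pluckerForm k K n (fun i => Ideal.Quotient.mk _ (1 ⊗ₜ torusChar k K (m i))) ≠ 0)
    (hgen : ∀ m' : Fin (Module.finrank K (PrincipalParts k K n)) → M, (∀ i, m' i ∈ S) →
      ∃ a b : A, b ∉ p ∧
        algebraMap A K b * pluckerForm k K n (fun i => Ideal.Quotient.mk _ (1 ⊗ₜ torusChar k K (m' i))) =
        algebraMap A K a * pluckerForm k K n (fun i => Ideal.Quotient.mk _ (1 ⊗ₜ torusChar k K (m i)))) :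
    ∃ f : Fin (Module.finrank K (PrincipalParts k K n)) → M → K, PluckerDatum S n m f := by
  classical
  obtain ⟨b₀, hb₀⟩ := exists_pluckerForm_eq_det (k := k) (K := K) g n
  -- As 1 ⊗ χ^m is χ^m times the class `ratio k K n m`, multilinearity splits off a character.
  have hmul : ∀ m' : Fin (Module.finrank K (PrincipalParts k K n)) → M,
      pluckerForm k K n (fun i => Ideal.Quotient.mk _ (1 ⊗ₜ torusChar k K (m' i))) =
        (∏ i, torusChar k K (m' i)) * pluckerForm k K n (fun i => ratio k K n (m' i)) := by
    intro m'
    simp only [mk_one_tmul_torusChar]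
    rw [← smul_eq_mul]
    exact (pluckerForm k K n).toMultilinearMap.map_smul_univ _ _
  have hdet : pluckerForm k K n (fun i => ratio k K n (m i)) ≠ 0 := by
    intro h
    rw [hmul, h, mul_zero] at hne
    exact hne rfl
  have hbasis : IsUnit (b₀.det fun i => ratio k K n (m i)) := by
    rw [← hb₀]
    exact hdet.isUnit
  obtain ⟨hli, hsp⟩ := (b₀.is_basis_iff_det).mpr hbasis
  let β := Module.Basis.mk hli hsp.ge
  have hβ : ∀ i, β i = ratio k K n (m i) := fun i => Module.Basis.mk_apply _ _ _
  -- The coordinates are constants, so a nonzero one can be divided out without changing which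
  -- functions are regular.
  have hrat : ∀ i (s : M), ∃ c : k, β.coord i (ratio k K n s) = algebraMap k K c := by
    intro i s
    have := ratio_mem_span_of_linearIndependent (k := k) g n (Fintype.card_fin _) hli s
    obtain ⟨c, hc⟩ := (Submodule.mem_span_range_iff_exists_fun k).mp this
    refine ⟨c i, ?_⟩
    rw [← hc, map_sum, Finset.sum_eq_single i]
    · rw [← hβ, ← algebraMap_smul K (c i), map_smul]
      simp
    · intro j _ hj
      rw [← hβ, ← algebraMap_smul K (c j), map_smul]
      simp [hj.symm]
    · simp
  -- Cramer's rule for the basis `β`.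
  have hupd : ∀ i (s : M), pluckerForm k K n (fun j => ratio k K n (Function.update m i s j)) =
      β.coord i (ratio k K n s) * pluckerForm k K n (fun j => ratio k K n (m j)) := by
    intro i s
    have h1 : (fun j => ratio k K n (Function.update m i s j)) =
        Function.update (fun j => β j) i (ratio k K n s) := by
      funext j
      by_cases hj : j = i
      · subst hj; simp
      · simp [hj, hβ]
    have h2 : (fun j => ratio k K n (m j)) = fun j => β j := funext fun j => (hβ j).symm
    have h3 : ∀ j, (pluckerForm k K n) (Function.update (fun j => β j) i (β j)) =
        if j = i then (pluckerForm k K n) (fun j => β j) else 0 := by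
      intro j
      split_ifs with h
      · subst h
        rw [Function.update_eq_self]
      · refine (pluckerForm k K n).map_eq_zero_of_eq _ (i := i) (j := j) ?_ (Ne.symm h)
        simp [h]
    rw [h1, h2]
    conv_lhs => rw [← β.sum_repr (ratio k K n s)]
    rw [AlternatingMap.map_update_sum]
    simp only [AlternatingMap.map_update_smul, h3]
    simp
  refine ⟨fun i (s : M) => β.coord i (ratio k K n s), hm, fun i => isPolyFun_ratio (k := k) (M := M) (β.coord i), fun i => ?_,
    fun i j hij => ?_, fun s hs i hne' => ?_, fun w q hq => ?_⟩
  · rw [← hβ]; simp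
  · rw [← hβ]; simp [hij]
  -- With `s` in place of `m i` the Plücker coordinate is multiplied by χ^{s - m i} times a nonzero
  -- constant. By `hgen` this factor is regular at `p`, and `hp` puts `s - m i` in `S`.
  · obtain ⟨a, b, hb, hab⟩ := hgen (Function.update m i s) (fun j => by
      by_cases hj : j = i
      · subst hj; simpa using hs
      · simpa [hj] using hm j)
    obtain ⟨c, hc⟩ := hrat i s
    rw [hmul, hmul, hupd, hc] at hab
    have hprod : ∏ j, torusChar k K (Function.update m i s j) =
        torusChar k K (s - m i) * ∏ j, torusChar k K (m j) := by
      have : (fun j => torusChar k K (Function.update m i s j)) =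
          Function.update (fun j => torusChar k K (m j)) i (torusChar k K s) := by
        funext j
        by_cases hj : j = i
        · subst hj; simp
        · simp [hj]
      rw [this, Finset.prod_update_of_mem (Finset.mem_univ i),
        ← Finset.mul_prod_erase _ _ (Finset.mem_univ i), ← mul_assoc, ← torusChar_add,
        sub_add_cancel, Finset.sdiff_singleton_eq_erase]
    have hc0 : algebraMap k K c ≠ 0 := by
      rw [← hc]
      exact hne'
    have hP : ∏ j, torusChar k K (m j) ≠ 0 :=
      Finset.prod_ne_zero_iff.mpr fun j _ => torusChar_ne_zero _
    have h4 : algebraMap A K b * (torusChar k K (s - m i) * algebraMap k K c) = algebraMap A K a := by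
      refine mul_right_cancel₀ (mul_ne_zero hP hdet) ?_
      rw [← hab, hprod]
      ring
    obtain ⟨c', hc'⟩ := hk c⁻¹
    refine hp _ ⟨a * c', b, hb, ?_⟩
    rw [map_mul, ← h4, hc', map_inv₀]
    field_simp
  -- Otherwise the expansion of the class of `q` in the basis would involve only points with `w` in
  -- [0, n), which `sum_choose_eq` forbids.
  · by_contra! hcon
    have h5 : ratio k K n q = ∑ i, β.coord i (ratio k K n q) • ratio k K n (m i) := by
      conv_lhs => rw [← β.sum_repr (ratio k K n q)]
      exact Finset.sum_congr rfl fun i _ => by rw [hβ]; rfl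
    exact sum_choose_eq w h5 hq hcon

end Datum

/-! ### The Plücker module of a smooth chart -/

section SmoothPlucker
open TensorProduct
variable {k : Type u} [Field k] {M : Type} [AddCommGroup M] {K : Type u} [Field K] [Algebra k K]
  [Algebra (AddMonoidAlgebra k M) K] [IsScalarTower k (AddMonoidAlgebra k M) K] {n : ℕ}
  {ι : Type} [Fintype ι] (g : Module.Basis ι ℤ M) {J : Set ι}

lemma mem_closure_of_repr_nonneg {s : M} (hs : ∀ j ∈ J, 0 ≤ g.repr s j) :
    s ∈ AddSubmonoid.closure (Set.range g ∪ (fun i => -g i) '' Jᶜ) := by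
  set N := AddSubmonoid.closure (Set.range g ∪ (fun i => -g i) '' Jᶜ)
  rw [← g.sum_repr s]
  refine N.sum_mem fun i _ => ?_
  rcases le_or_gt 0 (g.repr s i) with h | h
  · obtain ⟨c, hc⟩ := Int.eq_ofNat_of_zero_le h
    rw [hc, natCast_zsmul]
    exact N.nsmul_mem (AddSubmonoid.subset_closure (.inl ⟨i, rfl⟩)) c
  · have hi : i ∉ J := fun hi => absurd (hs i hi) (not_le.mpr h)
    obtain ⟨c, hc⟩ := Int.eq_ofNat_of_zero_le (neg_nonneg.mpr h.le)
    rw [← neg_neg (g.repr s i), hc, neg_smul, ← smul_neg, natCast_zsmul]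
    exact N.nsmul_mem (AddSubmonoid.subset_closure (.inr ⟨i, hi, rfl⟩)) c

variable (k K n) in
/-- The element `1 ⊗ χ^m - χ^m ⊗ 1` of `Pⁿ_K`. -/
def torusDiff (m : M) : PrincipalParts k K n := torusChar k K m • (ratio k K n m - 1)

variable [IsFractionRing (AddMonoidAlgebra k M) K]

lemma mk_one_tmul_eq_add (m : M) :
    (Ideal.Quotient.mk (KaehlerDifferential.ideal k K ^ (n + 1)) (1 ⊗ₜ torusChar k K m)) =
      algebraMap K _ (torusChar k K m) + torusDiff k K n m := by
  rw [mk_one_tmul_torusChar, torusDiff, smul_sub, Algebra.algebraMap_eq_smul_one]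
  abel

lemma prod_torusDiff (a : {a : ι →₀ ℕ // a.degree ≤ n}) :
    ∏ i, torusDiff k K n (g i) ^ a.1 i =
      (∏ i, torusChar k K (g i) ^ a.1 i) • ratioMonomial k K g n a := by
  simp only [torusDiff, smul_pow, ratioMonomial]
  exact Finset.prod_smul ..

variable {A : Type u} [CommRing A] [Algebra k A] [Algebra A K] [IsScalarTower k A K]
  {S : AddSubmonoid M}
  (hchar : ∀ s ∈ S, ∃ a : A, algebraMap A K a = torusChar k K s)
  (hspan : ∀ a : A, algebraMap A K a ∈ Submodule.span k (torusChar k K '' (S : Set M)))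
  (hS : ∀ s, s ∈ S ↔ ∀ j ∈ J, 0 ≤ g.repr s j)
include hchar hspan hS

/-- The elements 1 ⊗ χ^g - χ^g ⊗ 1, for g in the basis, come from `A`, whereas χ^{-g} need not.
Together with `A` they generate 1 ⊗ χ^g, and for a basis vector outside `J`, where χ^{-g} is in `A`,
also its inverse, by nilpotent perturbation. These elements generate all 1 ⊗ χ^s with `s` in `S`. -/
lemma range_principalPartsMap_le (p : PrincipalParts k A n) :
    principalPartsMap (IsScalarTower.toAlgHom k A K) n p ∈
      Submodule.span A (Set.range fun a : {a : ι →₀ ℕ // a.degree ≤ n} =>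
        ∏ i, torusDiff k K n (g i) ^ a.1 i) := by
  set B := Algebra.adjoin A (Set.range fun i => torusDiff k K n (g i))
  have hmap : ∀ i, torusDiff k K n (g i) ∈ (KaehlerDifferential.ideal k K).map
      (Ideal.Quotient.mk (KaehlerDifferential.ideal k K ^ (n + 1))) :=
    fun i => Submodule.smul_of_tower_mem _ _ (ratio_sub_one_mem (g i))
  have hB : Subalgebra.toSubmodule B ≤ _ :=
    adjoin_le_span_monomials (F := A) (fun i => torusDiff k K n (g i)) n
      fun a ha => prod_eq_zero_of_mem_map hmap a ha
  have hdiff : ∀ i, torusDiff k K n (g i) ∈ B := fun i => Algebra.subset_adjoin ⟨i, rfl⟩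
  have hconst : ∀ s ∈ S, algebraMap K (PrincipalParts k K n) (torusChar k K s) ∈ B := by
    intro s hs
    obtain ⟨a, ha⟩ := hchar s hs
    rw [← ha, ← IsScalarTower.algebraMap_apply]
    exact B.algebraMap_mem a
  let τ : K →ₐ[k] PrincipalParts k K n :=
    (Ideal.Quotient.mkₐ k _).comp Algebra.TensorProduct.includeRight
  have hτ : ∀ m : M, τ (torusChar k K m) =
      algebraMap K _ (torusChar k K m) + torusDiff k K n m := mk_one_tmul_eq_add
  have hgS : ∀ i, g i ∈ S := fun i => (hS _).mpr fun j _ => by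
    classical
    rw [g.repr_self, Finsupp.single_apply]
    split_ifs <;> simp
  have hgS' : ∀ i ∉ J, -g i ∈ S := fun i hi => (hS _).mpr fun j hj => by
    have : i ≠ j := fun h => hi (h ▸ hj)
    rw [map_neg, g.repr_self, Finsupp.neg_apply, Finsupp.single_eq_of_ne this.symm, neg_zero]
  have h1 : ∀ i, τ (torusChar k K (g i)) ∈ B := fun i => by
    rw [hτ]
    exact B.add_mem (hconst _ (hgS i)) (hdiff i)
  have h2 : ∀ i ∉ J, τ (torusChar k K (-g i)) ∈ B := fun i hi => by
    refine mem_of_mul_eq_one (hconst _ (hgS i)) (hconst _ (hgS' i hi)) (hdiff i) ?_ ?_ ?_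
    · obtain ⟨N, hN⟩ := isNilpotent_ratio_sub_one (k := k) (K := K) n (g i)
      exact ⟨N, by rw [torusDiff, smul_pow, hN, smul_zero]⟩
    · rw [← map_mul, ← torusChar_add, add_neg_cancel, torusChar_zero, map_one]
    · rw [← hτ, ← map_mul, ← torusChar_add, add_neg_cancel, torusChar_zero, map_one]
  have h3 : ∀ s ∈ S, τ (torusChar k K s) ∈ B := by
    intro s hs
    replace hs := mem_closure_of_repr_nonneg g ((hS s).mp hs)
    induction hs using AddSubmonoid.closure_induction with
    | mem x hx =>
      rcases hx with ⟨i, rfl⟩ | ⟨i, hi, rfl⟩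
      · exact h1 i
      · exact h2 i hi
    | zero =>
      rw [torusChar_zero, map_one]
      exact B.one_mem
    | add x y _ _ hx hy =>
      rw [torusChar_add, map_mul]
      exact B.mul_mem hx hy
  have h4 : ∀ a : A, τ (algebraMap A K a) ∈ B := by
    intro a
    have ha := hspan a
    generalize algebraMap A K a = y at ha
    induction ha using Submodule.span_induction with
    | mem x hx =>
      obtain ⟨s, hs, rfl⟩ := hx
      exact h3 s hs
    | zero =>
      rw [map_zero]
      exact B.zero_mem
    | add x y _ _ hx hy =>
      rw [map_add]
      exact B.add_mem hx hy
    | smul c x _ hx =>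
      rw [map_smul, ← algebraMap_smul A c]
      exact B.smul_mem hx _
  apply hB
  obtain ⟨z, rfl⟩ := Ideal.Quotient.mk_surjective p
  induction z using TensorProduct.induction_on with
  | zero =>
    rw [map_zero, map_zero]
    exact Submodule.zero_mem _
  | add x y hx hy =>
    rw [map_add, map_add]
    exact Submodule.add_mem _ hx hy
  | tmul a b =>
    rw [principalPartsMap_mk]
    have : Ideal.Quotient.mk (KaehlerDifferential.ideal k K ^ (n + 1))
        (algebraMap A K a ⊗ₜ[k] algebraMap A K b) = a • τ (algebraMap A K b) := by
      rw [← algebraMap_smul K a]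
      change _ = Ideal.Quotient.mk _ (algebraMap A K a • (1 : K) ⊗ₜ[k] algebraMap A K b)
      rw [TensorProduct.smul_tmul', smul_eq_mul, mul_one]
    refine Eq.mpr (congrArg (· ∈ B) this) ?_
    exact B.smul_mem (h4 b) a

/-- The module of Plücker coordinates of a smooth affine toric variety is free of rank one. -/
theorem exists_pluckerModule_eq_span : ∃ x : K, x ≠ 0 ∧
    pluckerModule k A K n = Submodule.span A {x} := by
  cases nonempty_fintype {a : ι →₀ ℕ // a.degree ≤ n}
  obtain ⟨b₀, hb₀⟩ := exists_pluckerForm_eq_det (k := k) (K := K) g n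
  let e : Fin (Module.finrank K (PrincipalParts k K n)) ≃ {a : ι →₀ ℕ // a.degree ≤ n} :=
    Fintype.equivOfCardEq (by
      rw [Fintype.card_fin, Module.finrank_eq_card_basis (ratioBasis k K g n)])
  let D : {a : ι →₀ ℕ // a.degree ≤ n} → PrincipalParts k K n :=
    fun a => ∏ i, torusDiff k K n (g i) ^ a.1 i
  have hgS : ∀ i, g i ∈ S := fun i => (hS _).mpr fun j _ => by
    classical
    rw [g.repr_self, Finsupp.single_apply]
    split_ifs <;> simp
  have hDimage : ∀ a, ∃ p : PrincipalParts k A n,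
      principalPartsMap (IsScalarTower.toAlgHom k A K) n p = D a := by
    intro a
    choose c hc using fun i => hchar (g i) (hgS i)
    refine ⟨∏ i, (Ideal.Quotient.mk _ (1 ⊗ₜ c i) - Ideal.Quotient.mk _ (c i ⊗ₜ 1)) ^ a.1 i, ?_⟩
    rw [map_prod]
    refine Finset.prod_congr rfl fun i _ => ?_
    rw [map_pow, map_sub, principalPartsMap_mk, principalPartsMap_mk, map_one]
    change (Ideal.Quotient.mk _ (1 ⊗ₜ algebraMap A K (c i)) -
      Ideal.Quotient.mk _ (algebraMap A K (c i) ⊗ₜ 1)) ^ _ = _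
    rw [hc, mk_one_tmul_eq_add]
    congr 1
    exact add_sub_cancel_left _ _
  refine ⟨pluckerForm k K n (D ∘ e), ?_, le_antisymm ?_ ?_⟩
  · have h1 : D ∘ e = fun j => (∏ i, torusChar k K (g i) ^ (e j).1 i) • ratioMonomial k K g n (e j) :=
      funext fun j => prod_torusDiff g (e j)
    have h2 : pluckerForm k K n (D ∘ e) = (∏ j, ∏ i, torusChar k K (g i) ^ (e j).1 i) •
        pluckerForm k K n fun j => ratioMonomial k K g n (e j) := by
      rw [h1]
      exact (pluckerForm k K n).toMultilinearMap.map_smul_univ _ _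
    have h3 : IsUnit (b₀.det fun j => ratioMonomial k K g n (e j)) := by
      have := b₀.isUnit_det ((ratioBasis k K g n).reindex e.symm)
      convert this using 2
      funext j
      rw [Module.Basis.reindex_apply, ratioBasis, Module.Basis.mk_apply, Equiv.symm_symm]
    rw [h2, hb₀]
    exact smul_ne_zero (Finset.prod_ne_zero_iff.mpr fun j _ => Finset.prod_ne_zero_iff.mpr
      fun i _ => pow_ne_zero _ (torusChar_ne_zero _)) h3.ne_zero
  · refine Submodule.span_le.mpr ?_
    rintro _ ⟨p, rfl⟩
    have := multilinear_mem_span (R := A) (pluckerForm k K n) (Set.range D) _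
      (fun i => range_principalPartsMap_le g hchar hspan hS (p i))
    refine Submodule.span_le.mpr ?_ this
    rintro _ ⟨w, hw, rfl⟩
    choose π hπ using hw
    obtain rfl : D ∘ π = w := funext hπ
    -- The family `D` has exactly as many members as the form has arguments. A tuple from `D` is
    -- either a permutation of the family, which changes the value by a sign, or has a repetition,
    -- which makes it zero.
    by_cases hinj : Function.Injective π
    · let ρ : Equiv.Perm (Fin (Module.finrank K (PrincipalParts k K n))) :=
        Equiv.ofBijective (e.symm ∘ π) (Finite.injective_iff_bijective.mp
          (e.symm.injective.comp hinj))
      have h1 : D ∘ π = (D ∘ e) ∘ ρ := by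
        funext j
        simp [ρ]
      rw [h1, AlternatingMap.map_perm]
      rcases Int.units_eq_one_or (Equiv.Perm.sign ρ) with h | h
      · rw [h, one_smul]
        exact Submodule.mem_span_singleton_self _
      · rw [h, Units.neg_smul, one_smul]
        exact Submodule.neg_mem _ (Submodule.mem_span_singleton_self _)
    · simp only [Function.Injective, not_forall] at hinj
      obtain ⟨i, j, hij, hne⟩ := hinj
      rw [(pluckerForm k K n).map_eq_zero_of_eq (D ∘ π) (congrArg D hij) hne]
      exact Submodule.zero_mem _
  · rw [Submodule.span_singleton_le_iff_mem]
    choose q hq using hDimage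
    exact Submodule.subset_span ⟨fun j => q (e j), congrArg _ (funext fun j => hq (e j))⟩

end SmoothPlucker

/-! ### When Proj (⨁ Eⁱ tⁱ) is isomorphic to the base -/

section ProjClosure
open Polynomial
variable {A K : Type u} [CommRing A] [Field K] [Algebra A K] {E : Submodule A K}

/-- The element `x t` of `⨁ Eⁱ tⁱ`, for `x` in `E`. -/
def closureLinear (x : E) : closureRing E :=
  ⟨monomial 1 (x : K), monomial_mem_closureRing (by rw [pow_one]; exact x.2)⟩

lemma closureLinear_mem (x : E) : closureLinear x ∈ closureGrading E 1 :=
  fun _ hj => coeff_monomial_of_ne _ hj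

/-- The ring is generated over `A` by its part of degree one, so every element of positive degree is
a combination of multiples of elements x t with `x` in `G`. Consequently the open sets D₊(x t) cover
Proj. -/
lemma irrelevant_le_span_closureLinear {G : Set K} (hG : E = Submodule.span A G) (hGE : ∀ x : G, (x : K) ∈ E) :
    (HomogeneousIdeal.irrelevant (closureGrading E)).toIdeal ≤
      Ideal.span (Set.range fun x : G => closureLinear (⟨(x : K), hGE x⟩ : E)) := by
  rw [HomogeneousIdeal.toIdeal_irrelevant_le]
  set I := Ideal.span (Set.range fun x : G => closureLinear (⟨(x : K), hGE x⟩ : E))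
  intro i hi f hf
  obtain ⟨j, rfl⟩ := Nat.exists_eq_succ_of_ne_zero hi.ne'
  have key : ∀ c (hc : c ∈ E ^ (j + 1)),
      (⟨monomial (j + 1) c, monomial_mem_closureRing hc⟩ : closureRing E) ∈ I := by
    have hlin : ∀ z (hz : z ∈ E), closureLinear ⟨z, hz⟩ ∈ I := by
      intro z hz
      have hz' := hz
      rw [hG] at hz'
      induction hz' using Submodule.span_induction with
      | mem x hx => exact Ideal.subset_span ⟨⟨x, hx⟩, rfl⟩
      | zero =>
        have h : closureLinear (⟨0, hz⟩ : E) = 0 := Subtype.ext (map_zero _)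
        rw [h]
        exact I.zero_mem
      | add x y hx hy hx' hy' =>
        rw [← hG] at hx hy
        have h : closureLinear (⟨x + y, hz⟩ : E) = closureLinear ⟨x, hx⟩ + closureLinear ⟨y, hy⟩ :=
          Subtype.ext (map_add _ _ _)
        rw [h]
        exact I.add_mem (hx' hx) (hy' hy)
      | smul a x hx hx' =>
        rw [← hG] at hx
        have h : closureLinear (⟨a • x, hz⟩ : E) = a • closureLinear (⟨x, hx⟩ : E) :=
          Subtype.ext (smul_monomial a 1 x).symm
        rw [h]
        exact I.smul_of_tower_mem a (hx' hx)
    intro c hc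
    have hc' := hc
    rw [pow_succ] at hc'
    induction hc' using Submodule.mul_induction_on' with
    | mem_mul_mem y hy z hz =>
      have h : (⟨monomial (j + 1) (y * z), monomial_mem_closureRing hc⟩ : closureRing E) =
          ⟨monomial j y, monomial_mem_closureRing hy⟩ * closureLinear (⟨z, hz⟩ : E) :=
        Subtype.ext (monomial_mul_monomial _ _ _ _).symm
      rw [h]
      exact I.mul_mem_left _ (hlin z hz)
    | add x hx y hy hx' hy' =>
      rw [← pow_succ] at hx hy
      have h : (⟨monomial (j + 1) (x + y), monomial_mem_closureRing hc⟩ : closureRing E) =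
          ⟨monomial (j + 1) x, monomial_mem_closureRing hx⟩ +
          ⟨monomial (j + 1) y, monomial_mem_closureRing hy⟩ := Subtype.ext (map_add _ _ _)
      rw [h]
      exact I.add_mem (hx' hx) (hy' hy)
  have h : f = ⟨monomial (j + 1) ((f : K[X]).coeff (j + 1)), monomial_mem_closureRing (f.2 (j + 1))⟩ :=
    Subtype.ext (eq_monomial_of_mem hf)
  rw [h]
  exact key _ (f.2 (j + 1))

variable (E) in
/-- The homomorphism from `A` to the degree zero part of the localization of `⨁ Eⁱ tⁱ` at `s`. -/
def baseToAway (s : closureRing E) : A →+* HomogeneousLocalization.Away (closureGrading E) s :=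
  (HomogeneousLocalization.fromZeroRingHom (closureGrading E) (.powers s)).comp
    (algebraMap A (closureGrading E 0))

lemma awayι_comp_closureToBase {d : ℕ} (hd : 0 < d) (s : closureRing E) (hs : s ∈ closureGrading E d) :
    Proj.awayι (closureGrading E) s hs hd ≫ closureToBase E =
      Spec.map (CommRingCat.ofHom (baseToAway E s)) :=
  awayι_closureToBase hd s hs

lemma val_baseToAway (s : closureRing E) (a : A) :
    (baseToAway E s a).val = algebraMap (closureRing E) (Localization.Away s) (algebraMap A _ a) := by
  rw [← Localization.mk_one_eq_algebraMap]
  rfl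

lemma algebraMap_away_injective {s : closureRing E} (hs : s ≠ 0) :
    Function.Injective (algebraMap (closureRing E) (Localization.Away s)) :=
  IsLocalization.injective _ (powers_le_nonZeroDivisors_of_noZeroDivisors hs)

/-- If `E` is free of rank one, then the structure morphism of `Proj (⨁ Eⁱ tⁱ)` is an isomorphism. -/
theorem isIso_closureToBase (hA : Function.Injective (algebraMap A K)) {x : K} (hx : x ≠ 0)
    (hE : E = Submodule.span A {x}) : IsIso (closureToBase E) := by
  have hxE : x ∈ E := by rw [hE]; exact Submodule.mem_span_singleton_self x
  let s : closureRing E := closureLinear ⟨x, hxE⟩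
  have hs : s ∈ closureGrading E 1 := closureLinear_mem _
  have hs0 : s ≠ 0 := fun h => hx (by
    have := congrArg (fun f : closureRing E => (f : K[X]).coeff 1) h
    simpa [s, closureLinear] using this)
  have htop := Proj.iSup_basicOpen_eq_top (closureGrading E) _
    (irrelevant_le_span_closureLinear hE (fun y => by rw [Set.mem_singleton_iff.mp y.2]; exact hxE))
  have hs_top : Proj.basicOpen (closureGrading E) s = ⊤ := by
    rw [← htop]
    refine le_antisymm (le_iSup (fun y : ({x} : Set K) => Proj.basicOpen (closureGrading E)
      (closureLinear ⟨(y : K), _⟩)) ⟨x, rfl⟩) (iSup_le fun y => ?_)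
    obtain ⟨y, rfl⟩ := y
    exact le_rfl
  have h1 : IsIso (Proj.awayι (closureGrading E) s hs one_pos) :=
    isIso_of_isOpenImmersion_of_opensRange_eq_top _ (by rw [Proj.opensRange_awayι, hs_top])
  have hbij : Function.Bijective (baseToAway E s) := by
    constructor
    · intro a b hab
      have h2 := congrArg HomogeneousLocalization.val hab
      rw [val_baseToAway, val_baseToAway] at h2
      have h3 := congrArg (fun f : closureRing E => (f : K[X]).coeff 0)
        (algebraMap_away_injective hs0 h2)
      apply hA
      change (C (algebraMap A K a)).coeff 0 = (C (algebraMap A K b)).coeff 0 at h3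
      simpa using h3
    · intro z
      obtain ⟨m, f, hf, rfl⟩ := HomogeneousLocalization.Away.mk_surjective _ hs z
      have hf' : (f : K[X]) = monomial m ((f : K[X]).coeff m) := by
        refine eq_monomial_of_mem ?_
        simpa using hf
      -- The powers of a cyclic module are cyclic, so an element of degree `m` is `a` times the
      -- `m`-th power of x t, and the fraction is the image of `a`.
      have hc : ((f : K[X]).coeff m) ∈ Submodule.span A {x} ^ m := by
        have h := f.2 m
        rwa [congrArg (· ^ m) hE] at h
      rw [Submodule.span_pow, Set.singleton_pow] at hc
      obtain ⟨a, ha⟩ := Submodule.mem_span_singleton.mp hc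
      refine ⟨a, HomogeneousLocalization.val_injective _ ?_⟩
      rw [val_baseToAway, HomogeneousLocalization.Away.val_mk]
      symm
      rw [Localization.mk_eq_mk', IsLocalization.mk'_eq_iff_eq_mul, ← map_mul]
      congr 1
      apply Subtype.ext
      change (f : K[X]) = C (algebraMap A K a) * (monomial 1 x) ^ m
      rw [hf', ← ha, monomial_pow, C_mul_monomial, Algebra.smul_def, one_mul]
  have h2 : IsIso (Spec.map (CommRingCat.ofHom (baseToAway E s))) := by
    have : IsIso (CommRingCat.ofHom (baseToAway E s)) :=
      (ConcreteCategory.isIso_iff_bijective _).mpr hbij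
    infer_instance
  rw [← awayι_comp_closureToBase one_pos s hs] at h2
  exact IsIso.of_isIso_comp_left (Proj.awayι (closureGrading E) s hs one_pos) _

/-- If `Spec` of a ring homomorphism `R → S` is an open immersion, then the homomorphism is bijective on
local rings. -/
lemma exists_mul_eq_of_isOpenImmersion {R S : Type u} [CommRing R] [CommRing S] [IsDomain S]
    (f : R →+* S) [IsOpenImmersion (Spec.map (CommRingCat.ofHom f))] (q : PrimeSpectrum S) (z : S) :
    ∃ a b : R, b ∉ (PrimeSpectrum.comap f q).asIdeal ∧ f b * z = f a := by
  let q' : Spec (CommRingCat.of S) := q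
  have h2 : IsIso ((Spec.map (CommRingCat.ofHom f)).stalkMap q') := inferInstance
  have hcomap : (PrimeSpectrum.comap f q).asIdeal = q.asIdeal.comap f := rfl
  have h3 : IsIso (CommRingCat.ofHom (Localization.localRingHom
    (PrimeSpectrum.comap f q).asIdeal q.asIdeal f hcomap)) :=
    ((MorphismProperty.isomorphisms _).arrow_mk_iso_iff
      (Scheme.arrowStalkMapSpecIso (CommRingCat.ofHom f) q)).mp h2
  obtain ⟨y, hy⟩ := ((ConcreteCategory.isIso_iff_bijective _).mp h3).2
    (algebraMap S (Localization.AtPrime q.asIdeal) z)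
  obtain ⟨a, b, hab⟩ := IsLocalization.exists_mk'_eq (PrimeSpectrum.comap f q).asIdeal.primeCompl
    (show Localization.AtPrime (PrimeSpectrum.comap f q).asIdeal from y)
  refine ⟨a, b, b.2, ?_⟩
  have h4 := Localization.localRingHom_mk' (PrimeSpectrum.comap f q).asIdeal q.asIdeal f hcomap a b
  rw [hab] at h4
  replace hy := hy.symm.trans h4
  rw [IsLocalization.eq_mk'_iff_mul_eq, ← map_mul] at hy
  -- As `S` is a domain, the equation in its localization at `q` already holds in `S`.
  have := IsLocalization.injective (Localization.AtPrime q.asIdeal)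
    q.asIdeal.primeCompl_le_nonZeroDivisors hy
  rw [mul_comm]
  exact this

/-- If the structure morphism of `Proj (⨁ Eⁱ tⁱ)` is an isomorphism, then the localization of `E` at a
prime of `A` is generated by one of the elements of a given generating set of `E`. -/
theorem exists_generator_of_isIso [IsIso (closureToBase E)] {G : Set K} (hG : E = Submodule.span A G)
    (p : PrimeSpectrum A) :
    ∃ x ∈ G, x ≠ 0 ∧ ∀ e ∈ E, ∃ a b : A, b ∉ p.asIdeal ∧
      algebraMap A K b * e = algebraMap A K a * x := by
  have hGE : ∀ x : G, (x : K) ∈ E := fun x => by rw [hG]; exact Submodule.subset_span x.2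
  let y : Proj (closureGrading E) := inv (closureToBase E) p
  have hy : closureToBase E y = p := by
    refine (Scheme.Hom.comp_apply (inv (closureToBase E)) (closureToBase E) _).symm.trans ?_
    rw [IsIso.inv_hom_id]
    rfl
  have htop := Proj.iSup_basicOpen_eq_top (closureGrading E) _ (irrelevant_le_span_closureLinear hG hGE)
  -- The generator whose chart D₊(x t) contains the point over `p` is the required one. The chart is
  -- open in Spec `A` through the isomorphism, so each degree zero fraction e t / x t in its ring
  -- equals some a / b with `b` outside `p`.
  obtain ⟨⟨x, hxG⟩, hyx⟩ := TopologicalSpace.Opens.mem_iSup.mp (htop.ge (Set.mem_univ y))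
  let s : closureRing E := closureLinear ⟨x, hGE ⟨x, hxG⟩⟩
  have hs : s ∈ closureGrading E 1 := closureLinear_mem _
  have hyx : y ∈ Proj.basicOpen (closureGrading E) s := hyx
  have hs0 : s ≠ 0 := by
    intro h
    rw [h, Proj.basicOpen_zero] at hyx
    exact hyx
  have hx0 : x ≠ 0 := by
    rintro rfl
    exact hs0 (Subtype.ext (by simp [s, closureLinear]))
  rw [← Proj.opensRange_awayι (closureGrading E) s hs one_pos] at hyx
  obtain ⟨q, hq⟩ := hyx
  have hfac := awayι_comp_closureToBase one_pos s hs
  have hqp : PrimeSpectrum.comap (baseToAway E s) q = p := by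
    rw [← hy, ← hq, ← Scheme.Hom.comp_apply, hfac]
    rfl
  have : IsOpenImmersion (Spec.map (CommRingCat.ofHom (baseToAway E s))) := by
    rw [← hfac]
    infer_instance
  have : IsDomain (Localization.Away s) :=
    IsLocalization.isDomain_localization (powers_le_nonZeroDivisors_of_noZeroDivisors hs0)
  have : IsDomain (HomogeneousLocalization.Away (closureGrading E) s) :=
    Function.Injective.isDomain (algebraMap (HomogeneousLocalization (closureGrading E) (.powers s))
      (Localization (.powers s))) fun _ _ h => HomogeneousLocalization.val_injective (.powers s) (by
        rwa [HomogeneousLocalization.algebraMap_apply, HomogeneousLocalization.algebraMap_apply] at h)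
  refine ⟨x, hxG, hx0, fun e he => ?_⟩
  obtain ⟨a, b, hb, hab⟩ := exists_mul_eq_of_isOpenImmersion (baseToAway E s) q
    (HomogeneousLocalization.Away.mk (closureGrading E) hs 1 (closureLinear ⟨e, he⟩)
      (closureLinear_mem _))
  refine ⟨a, b, by rwa [hqp] at hb, ?_⟩
  have h2 := congrArg HomogeneousLocalization.val hab
  rw [HomogeneousLocalization.val_mul, val_baseToAway, val_baseToAway,
    HomogeneousLocalization.Away.val_mk, Localization.mk_eq_mk', ← IsLocalization.mk'_one (M := .powers s)
      (S := Localization.Away s) (algebraMap A (closureRing E) b), ← IsLocalization.mk'_mul,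
    IsLocalization.mk'_eq_iff_eq_mul, ← map_mul] at h2
  have h3 := congrArg (fun f : closureRing E => (f : K[X]).coeff 1) (algebraMap_away_injective hs0 h2)
  change (C (algebraMap A K b) * monomial 1 e).coeff 1 =
    (C (algebraMap A K a) * ((1 * (monomial 1 x) ^ 1 : K[X]))).coeff 1 at h3
  rw [pow_one, one_mul, C_mul_monomial, C_mul_monomial] at h3
  simpa using h3

end ProjClosure

/-! ### Smooth monoids and facet systems -/

section SmoothMonoid
variable {M : Type} [AddCommGroup M]

/-- A submonoid of a lattice is smooth if, in some basis of the lattice, it consists of the vectors with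
nonnegative coordinates at some of the places. -/
def IsSmoothMonoid (S : AddSubmonoid M) : Prop :=
  ∃ (ι : Type) (_ : Fintype ι) (g : Module.Basis ι ℤ M) (J : Set ι),
    ∀ s, s ∈ S ↔ ∀ j ∈ J, 0 ≤ g.repr s j

/-- The dual vectors split the map from `M` to ℤ^ι given by the forms. So they and a basis of its
kernel, which is free, form a basis of `M` in which the forms `v i` are coordinates. -/
lemma isSmoothMonoid_of_dual [Module.Finite ℤ M] [Module.Free ℤ M] {S : AddSubmonoid M} {ι : Type}
    [Finite ι] (v : ι → M →+ ℤ) (hS : ∀ x, x ∈ S ↔ ∀ i, 0 ≤ v i x)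
    (hv : ∀ i, ∃ h, v i h = 1 ∧ ∀ j ≠ i, v j h = 0) : IsSmoothMonoid S := by
  classical
  cases nonempty_fintype ι
  choose h h1 h0 using hv
  have hvh : ∀ i j, v i (h j) = if i = j then 1 else 0 := by
    intro i j
    split_ifs with hij
    · rw [hij, h1]
    · exact h0 j i hij
  let V : M →ₗ[ℤ] (ι → ℤ) := LinearMap.pi fun i => (v i).toIntLinearMap
  let W : (ι → ℤ) →ₗ[ℤ] M := Fintype.linearCombination ℤ h
  have hVW : ∀ c, V (W c) = c := by
    intro c
    funext i
    simp [V, W, Fintype.linearCombination_apply, hvh]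
  let e : M ≃ₗ[ℤ] (ι → ℤ) × LinearMap.ker V := LinearEquiv.ofLinearMap
    (V.prod (LinearMap.codRestrict _ (LinearMap.id - W ∘ₗ V) fun x => by simp [hVW]))
    (W.coprod (LinearMap.ker V).subtype)
    (by
      ext x
      · simp [hVW]
      · simp [hVW]
      · simp
      · have : V (x : M) = 0 := x.2
        simp [this])
    (by ext x; simp)
  let b := Module.finBasis ℤ (LinearMap.ker V)
  let g := ((Pi.basisFun ℤ ι).prod b).map e.symm
  refine ⟨ι ⊕ Fin _, inferInstance, g, Set.range Sum.inl, fun s => ?_⟩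
  rw [hS, Set.forall_mem_range]
  refine forall_congr' fun i => ?_
  have : g.repr s (Sum.inl i) = v i s := by
    simp [g, e, V]
  rw [this]

/-- The data of a finite set of surjective integral forms that are all positive at some point `l`, and
define the monoid `S` by the condition that they are nonnegative. -/
structure IsCutOutBy (S : AddSubmonoid M) (Ψ : Set (M →+ ℤ)) (l : M) : Prop where
  finite : Ψ.Finite
  exists_eq_one : ∀ ψ ∈ Ψ, ∃ e, ψ e = 1
  pos : ∀ ψ ∈ Ψ, 0 < ψ l
  mem_iff : ∀ x, x ∈ S ↔ ∀ ψ ∈ Ψ, 0 ≤ ψ x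

/-- Take a minimal subset of `Ψ` that still cuts out `S`. Since no member can be omitted, each is
the only negative form at some point, and moving from there towards `l` one crosses the facet in its
relative interior. -/
lemma IsCutOutBy.exists_facetSystem {S : AddSubmonoid M} {Ψ : Set (M →+ ℤ)} {l : M}
    (h : IsCutOutBy S Ψ l) : ∃ (ι : Type) (_ : Finite ι) (v : ι → M →+ ℤ), IsFacetSystem v ∧
      ∀ x, x ∈ S ↔ ∀ i, 0 ≤ v i x := by
  have hfin : {X : Set (M →+ ℤ) | X ⊆ Ψ ∧ ∀ x, x ∈ S ↔ ∀ ψ ∈ X, 0 ≤ ψ x}.Finite :=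
    h.finite.finite_subsets.subset fun X hX => hX.1
  obtain ⟨X, ⟨hXΨ, hXS⟩, hmin⟩ := hfin.exists_minimal ⟨Ψ, subset_rfl, h.mem_iff⟩
  refine ⟨X, (h.finite.subset hXΨ).to_subtype, fun i => i.1,
    ⟨fun i => h.exists_eq_one _ (hXΨ i.2), fun i => ?_⟩, fun x => by simp [hXS]⟩
  obtain ⟨m, hm, hmi⟩ : ∃ m, (∀ ψ ∈ X, ψ ≠ i.1 → 0 ≤ ψ m) ∧ i.1 m < 0 := by
    by_contra! hcon
    have := hmin (y := X \ {i.1}) ⟨Set.sdiff_subset.trans hXΨ, fun x => ⟨fun hx ψ hψ =>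
      (hXS x).mp hx ψ hψ.1, fun hx => ?_⟩⟩ Set.sdiff_subset
    · exact (this i.2).2 rfl
    · rw [hXS]
      have h1 := hcon x fun ψ hψ hne => hx ψ ⟨hψ, hne⟩
      intro ψ hψ
      by_cases hne : ψ = i.1
      · rw [hne]; exact h1
      · exact hx ψ ⟨hψ, hne⟩
  -- The weights are chosen to make `i` vanish. Both `i.1 l` and `-i.1 m` are positive, the other
  -- forms are nonnegative at `m`, and all are positive at `l`.
  refine ⟨i.1 l • m - i.1 m • l, ?_, fun j hj => ?_⟩
  · simp only [map_sub, map_zsmul, smul_eq_mul]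
    ring
  · simp only [map_sub, map_zsmul, smul_eq_mul]
    have h1 := h.pos _ (hXΨ i.2)
    have h2 := h.pos _ (hXΨ j.2)
    have h3 := hm j.1 j.2 (fun hji => hj (Subtype.ext hji))
    nlinarith

lemma IsCutOutBy.mem {S : AddSubmonoid M} {Ψ : Set (M →+ ℤ)} {l : M} (h : IsCutOutBy S Ψ l) : l ∈ S :=
  (h.mem_iff l).mpr fun ψ hψ => (h.pos ψ hψ).le

lemma IsCutOutBy.exists_add_nsmul_mem {S : AddSubmonoid M} {Ψ : Set (M →+ ℤ)} {l : M}
    (h : IsCutOutBy S Ψ l) (x : M) : ∃ N : ℕ, x + N • l ∈ S := by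
  have key : ∀ ψ ∈ Ψ, ∃ N : ℕ, ∀ N' ≥ N, 0 ≤ ψ (x + N' • l) := by
    intro ψ hψ
    refine ⟨(ψ x).natAbs, fun s hs => ?_⟩
    rw [map_add, map_nsmul, nsmul_eq_mul]
    have : (s : ℤ) ≤ s * ψ l := le_mul_of_one_le_right (by positivity) (h.pos ψ hψ)
    omega
  choose! N hN using key
  exact ⟨h.finite.toFinset.sup N, (h.mem_iff _).mpr fun ψ hψ =>
    hN ψ hψ _ (Finset.le_sup (h.finite.mem_toFinset.mpr hψ))⟩

/-- The least positive value `c` of `φ` divides all its values; `ψ` is the quotient. -/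
lemma exists_surjective_form {φ : M →+ ℤ} {l : M} (hl : 0 < φ l) :
    ∃ ψ : M →+ ℤ, (∃ e, ψ e = 1) ∧ ∃ c : ℤ, 0 < c ∧ ∀ x, φ x = c * ψ x := by
  have hex : ∃ k : ℕ, 0 < k ∧ ∃ x, φ x = k := ⟨(φ l).toNat, by omega, l, by omega⟩
  classical
  obtain ⟨hk, x, hx⟩ := Nat.find_spec hex
  set c := Nat.find hex
  have hdvd : ∀ y, (c : ℤ) ∣ φ y := by
    intro y
    by_contra hnd
    have h1 : 0 < φ y % c := lt_of_le_of_ne (Int.emod_nonneg _ (by omega)) fun h =>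
      hnd (Int.dvd_of_emod_eq_zero h.symm)
    have h2 : φ y % c < c := Int.emod_lt_of_pos _ (by omega)
    have := Nat.find_min' hex (m := (φ y % c).toNat) ⟨by omega, y - (φ y / c) • x, by
      rw [map_sub, map_zsmul, hx, smul_eq_mul, Int.toNat_of_nonneg h1.le, Int.emod_def, mul_comm]⟩
    omega
  refine ⟨{ toFun := fun y => φ y / c, map_zero' := by simp, map_add' := fun a b => (by
    rw [map_add, Int.add_ediv_of_dvd_left (hdvd a)]) }, ⟨x, ?_⟩, c, by omega, fun y => ?_⟩
  · change φ x / c = 1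
    rw [hx, Int.ediv_self (by omega)]
  · exact (Int.mul_ediv_cancel' (hdvd y)).symm

lemma isCutOutBy_of_forms {ι : Type} [Finite ι] (φ : ι → M →+ ℤ) {S : AddSubmonoid M} {l : M}
    (hl : ∀ i, 0 < φ i l) (hS : ∀ x, x ∈ S ↔ ∀ i, 0 ≤ φ i x) :
    ∃ Ψ : Set (M →+ ℤ), IsCutOutBy S Ψ l := by
  choose ψ he c hc hψ using fun i => exists_surjective_form (hl i)
  refine ⟨Set.range ψ, Set.finite_range ψ, ?_, ?_, fun x => ?_⟩
  · rintro _ ⟨i, rfl⟩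
    exact he i
  · rintro _ ⟨i, rfl⟩
    have := hl i
    rw [hψ] at this
    exact pos_of_mul_pos_right this (hc i).le
  · rw [hS, Set.forall_mem_range]
    refine forall_congr' fun i => ?_
    rw [hψ, mul_nonneg_iff_of_pos_left (hc i)]

end SmoothMonoid

/-! ### Strongly convex cones and their integral forms -/

section ConeForms
variable {d : ℕ}

/-- Strong convexity keeps 0 outside the convex hull of the generators: in a vanishing convex
combination some nonzero term would lie in the cone together with its negative. A hyperplane
separating 0 from this compact set gives the form. -/
lemma exists_pos_form {T : Finset (Fin d → ℤ)} (h0 : ∀ v ∈ T, v ≠ 0)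
    (hσ : ∀ x ∈ PointedCone.hull ℝ (latticeVec '' (T : Set (Fin d → ℤ))),
      -x ∈ PointedCone.hull ℝ (latticeVec '' (T : Set (Fin d → ℤ))) → x = 0) :
    ∃ u : Fin d → ℝ, ∀ v ∈ T, 0 < u ⬝ᵥ latticeVec v := by
  set σ := PointedCone.hull ℝ (latticeVec '' (T : Set (Fin d → ℤ)))
  have hmem : ∀ v ∈ T, latticeVec v ∈ σ := fun v hv => Submodule.subset_span ⟨v, hv, rfl⟩
  have hsmul : ∀ (c : ℝ), 0 ≤ c → ∀ x ∈ σ, c • x ∈ σ := fun c hc x hx =>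
    PointedCone.smul_mem σ hc hx
  have hcompact : IsCompact (convexHull ℝ (latticeVec '' (T : Set (Fin d → ℤ)))) :=
    (T.finite_toSet.image _).isCompact_convexHull ℝ
  have hnot : (0 : Fin d → ℝ) ∉ convexHull ℝ (latticeVec '' (T : Set (Fin d → ℤ))) := by
    classical
    intro hz
    rw [← Finset.coe_image, Finset.mem_convexHull'] at hz
    obtain ⟨w, hw0, hw1, hw⟩ := hz
    obtain ⟨y, hy, hwy⟩ : ∃ y ∈ T.image latticeVec, w y ≠ 0 := by
      by_contra! hcon
      rw [Finset.sum_eq_zero hcon] at hw1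
      exact zero_ne_one hw1
    have hyσ : ∀ y ∈ T.image latticeVec, y ∈ σ := by
      intro y hy
      obtain ⟨v, hv, rfl⟩ := Finset.mem_image.mp hy
      exact hmem v hv
    have h1 : -(w y • y) ∈ σ := by
      rw [← Finset.add_sum_erase _ _ hy] at hw
      rw [neg_eq_of_add_eq_zero_right hw]
      exact σ.sum_mem fun z hz => hsmul _ (hw0 z (Finset.mem_of_mem_erase hz)) _
        (hyσ z (Finset.mem_of_mem_erase hz))
    have h2 := hσ _ (hsmul _ (hw0 y hy) _ (hyσ y hy)) h1
    obtain ⟨v, hv, rfl⟩ := Finset.mem_image.mp hy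
    refine h0 v hv ?_
    have h3 := (smul_eq_zero.mp h2).resolve_left hwy
    funext i
    have := congrFun h3 i
    simpa [latticeVec] using this
  obtain ⟨f, r, hf0, hf⟩ := geometric_hahn_banach_point_closed (convex_convexHull ℝ _)
    hcompact.isClosed hnot
  refine ⟨fun i => f (Pi.single i 1), fun v hv => ?_⟩
  have h1 := hf _ (subset_convexHull ℝ _ ⟨v, hv, rfl⟩)
  have h2 : f (latticeVec v) = (fun i => f (Pi.single i 1)) ⬝ᵥ latticeVec v := by
    conv_lhs => rw [← Finset.univ_sum_single (latticeVec v)]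
    rw [map_sum, dotProduct]
    refine Finset.sum_congr rfl fun i _ => ?_
    have : Pi.single i (latticeVec v i) = latticeVec v i • (Pi.single i 1 : Fin d → ℝ) := by
      rw [← Pi.single_smul, smul_eq_mul, mul_one]
    rw [this, map_smul, smul_eq_mul, mul_comm]
  rw [← h2]
  simp only [map_zero] at hf0
  linarith

/-- The dual monoid of a strongly convex rational polyhedral cone is cut out by finitely many integral
forms, all positive at some point. -/
theorem IsSCRPC.exists_isCutOutBy {σ : PointedCone ℝ (Fin d → ℝ)} (hσ : IsSCRPC σ) :
    ∃ Ψ l, IsCutOutBy (dualMonoid σ) Ψ l := by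
  classical
  obtain ⟨⟨T, rfl⟩, hline⟩ := hσ
  have hcast : ∀ a b : Fin d → ℤ, latticeVec a ⬝ᵥ latticeVec b = ((a ⬝ᵥ b : ℤ) : ℝ) := by
    intro a b
    simp [dotProduct, latticeVec]
  -- No form is positive at a zero generator, so it is removed; the cone does not change.
  have herase : PointedCone.hull ℝ (latticeVec '' ((T.erase 0 : Finset _) : Set (Fin d → ℤ))) =
      PointedCone.hull ℝ (latticeVec '' (T : Set (Fin d → ℤ))) := by
    refine le_antisymm (Submodule.span_mono (Set.image_mono (by simp))) (Submodule.span_le.mpr ?_)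
    rintro _ ⟨v, hv, rfl⟩
    by_cases h : v = 0
    · subst h
      rw [show latticeVec (0 : Fin d → ℤ) = 0 by ext; simp [latticeVec]]
      exact Submodule.zero_mem _
    · exact Submodule.subset_span ⟨v, by simpa [h] using hv, rfl⟩
  rw [← herase] at hline ⊢
  obtain ⟨u, hu⟩ := exists_pos_form (fun v hv => (Finset.mem_erase.mp hv).1) hline
  -- The point `l` of the dual lattice has the signs of `u`. Hence all generators, considered as
  -- forms on the dual lattice, are positive at `l`.
  obtain ⟨l, hl⟩ := exists_integral_form (T.erase 0) u fun v hv => (hu v hv).le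
  let φ : (T.erase 0 : Finset (Fin d → ℤ)) → (Fin d → ℤ) →+ ℤ := fun v =>
    { toFun := fun x => x ⬝ᵥ v.1, map_zero' := by simp, map_add' := fun a b => add_dotProduct _ _ _ }
  obtain ⟨Ψ, hΨ⟩ := isCutOutBy_of_forms φ (l := l)
    (S := dualMonoid (PointedCone.hull ℝ (latticeVec '' ((T.erase 0 : Finset _) : Set (Fin d → ℤ)))))
    (fun v => by
      have h1 := hl v.1 v.2
      have h2 : latticeVec l ⬝ᵥ latticeVec v.1 ≠ 0 := fun h => (hu v.1 v.2).ne' (h1.2.mp h)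
      have h3 := lt_of_le_of_ne h1.1 h2.symm
      rw [hcast] at h3
      exact_mod_cast h3)
    (fun x => ⟨fun hx v => by
      have := hx _ (Submodule.subset_span ⟨v.1, v.2, rfl⟩)
      rw [hcast] at this
      exact_mod_cast this, fun hx => dotProduct_nonneg_hull _ _ (by
        rintro _ ⟨v, hv, rfl⟩
        rw [hcast]
        exact_mod_cast hx ⟨v, hv⟩)⟩)
  exact ⟨Ψ, l, hΨ⟩

end ConeForms

/-! ### Bounds for embedding dimension and Krull dimension -/

section Dimension
open IsLocalRing

/-- The number of generators of the maximal ideal of a local ring is bounded below by means of a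
homomorphism to a ring of dual numbers. -/
lemma finrank_le_spanFinrank {k A V : Type*} [Field k] [CommRing A] [AddCommGroup V] [Module k V]
    [Module kᵐᵒᵖ V] [IsCentralScalar k V] (f : A →+* TrivSqZeroExt k V) (p : Ideal A) [p.IsPrime]
    [IsNoetherianRing (Localization.AtPrime p)]
    (hp : ∀ a, a ∈ p ↔ (f a).fst = 0)
    (hV : Submodule.span k ((fun a => (f a).snd) '' (p : Set A)) = ⊤) :
    Module.finrank k V ≤ (maximalIdeal (Localization.AtPrime p)).spanFinrank := by
  have hunit : ∀ y : p.primeCompl, IsUnit (f y) := fun y => by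
    rw [TrivSqZeroExt.isUnit_iff_isUnit_fst, isUnit_iff_ne_zero]
    exact fun h => y.2 ((hp _).mpr h)
  let F : Localization.AtPrime p →+* TrivSqZeroExt k V := IsLocalization.lift hunit
  have hF : ∀ a, F (algebraMap _ _ a) = f a := fun a => IsLocalization.lift_eq hunit a
  set m := maximalIdeal (Localization.AtPrime p)
  have hfg : m.FG := IsNoetherian.noetherian m
  have hF0 : ∀ x ∈ m, (F x).fst = 0 := by
    intro x hx
    obtain ⟨⟨a, s⟩, hs⟩ := IsLocalization.surj p.primeCompl x
    have ha : a ∈ p := by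
      rw [← IsLocalization.AtPrime.to_map_mem_maximal_iff (Localization.AtPrime p) p, ← hs]
      exact Ideal.mul_mem_right _ _ hx
    have h1 := congrArg (fun z => (F z).fst) hs
    simp only [map_mul, hF, TrivSqZeroExt.fst_mul, (hp a).mp ha] at h1
    exact (mul_eq_zero.mp h1).resolve_right fun h => s.2 ((hp _).mpr h)
  -- On the maximal ideal the first component of `F` is zero, so the second component of `F (a * x)`
  -- is that of `F x` times the scalar `(F a).fst`. Generators of the ideal therefore span the image
  -- over `k`.
  have hspan : ∀ x ∈ Submodule.span (Localization.AtPrime p) m.generators,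
      (F x).snd ∈ Submodule.span k ((fun x => (F x).snd) '' m.generators) := by
    intro x hx
    induction hx using Submodule.span_induction with
    | mem x hx => exact Submodule.subset_span ⟨x, hx, rfl⟩
    | zero => simp
    | add x y _ _ hx hy =>
      rw [map_add, TrivSqZeroExt.snd_add]
      exact Submodule.add_mem _ hx hy
    | smul a x hx' hx =>
      rw [Submodule.span_generators] at hx'
      rw [smul_eq_mul, map_mul, TrivSqZeroExt.snd_mul, hF0 x hx', MulOpposite.op_zero, zero_smul,
        add_zero]
      exact Submodule.smul_mem _ _ hx
  have htop : Submodule.span k ((fun x => (F x).snd) '' m.generators) = ⊤ := by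
    rw [eq_top_iff, ← hV, Submodule.span_le]
    rintro _ ⟨a, ha, rfl⟩
    have := hspan (algebraMap _ _ a) (by
      rw [Submodule.span_generators]
      exact (IsLocalization.AtPrime.to_map_mem_maximal_iff (Localization.AtPrime p) p a).mpr ha)
    rwa [hF] at this
  have hfin : ((fun x => (F x).snd) '' m.generators).Finite :=
    (Submodule.FG.finite_generators hfg).image _
  rw [← Submodule.FG.generators_ncard hfg, ← finrank_top k V, ← htop]
  have := hfin.fintype
  refine (finrank_span_le_card _).trans ?_
  rw [← Set.ncard_eq_toFinset_card']
  exact Set.ncard_image_le (Submodule.FG.finite_generators hfg)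

/-- The Krull dimension of a finitely generated algebra is at most its transcendence degree. -/
lemma ringKrullDim_le_of_trdeg_le {k A : Type u} [Field k] [CommRing A] [Nontrivial A] [Algebra k A]
    [Algebra.FiniteType k A] {r : ℕ} (hr : Algebra.trdeg k A ≤ r) : ringKrullDim A ≤ r := by
  -- Noether normalization: `A` is integral over a polynomial ring in `s` variables, with `s` at
  -- most the transcendence degree, and strict inclusions of primes remain strict after contraction
  -- along an integral extension.
  obtain ⟨s, g, hinj, hint⟩ := exists_integral_inj_algHom_of_fg k A
  have h1 : (s : Cardinal.{u}) ≤ r := by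
    have := (trdeg_le_of_injective g hinj).trans hr
    simpa [MvPolynomial.trdeg_of_isDomain] using this
  have h2 : s ≤ r := by exact_mod_cast h1
  have h3 : ringKrullDim A ≤ ringKrullDim (MvPolynomial (Fin s) k) := by
    algebraize [g.toRingHom]
    have : Algebra.IsIntegral (MvPolynomial (Fin s) k) A := ⟨hint⟩
    refine Order.krullDim_le_of_strictMono (fun p => PrimeSpectrum.comap g.toRingHom p) ?_
    intro p q hpq
    exact Ideal.IsIntegral.comap_lt_comap (R := MvPolynomial (Fin s) k) hpq
  refine h3.trans ?_
  rw [MvPolynomial.ringKrullDim_of_isNoetherianRing, ringKrullDim_eq_zero_of_field, zero_add]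
  simpa using h2

end Dimension

/-! ### Finite generation and dimension of the monoid algebra -/

section Gordan
variable {M : Type} [AddCommGroup M]

/-- **Gordan's lemma**. -/
lemma IsCutOutBy.fg [Module.Finite ℤ M] {S : AddSubmonoid M} {Ψ : Set (M →+ ℤ)} {l : M}
    (h : IsCutOutBy S Ψ l) : S.FG := by
  obtain ⟨m, f, hf⟩ := Module.Finite.exists_fin' ℤ M
  have := h.finite.to_subtype
  -- The variables are the positive and negative parts of a lift to ℤᵐ and one slack variable for
  -- each form. `S` is the image of the solutions in natural numbers of the equations "form equals
  -- slack", and such a solution monoid is finitely generated.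
  let e : (Fin m ⊕ Fin m ⊕ Ψ → ℕ) →+ M :=
    { toFun := fun x => f fun i => (x (Sum.inl i) : ℤ) - x (Sum.inr (Sum.inl i))
      map_zero' := by
        simp only [Pi.zero_apply, Nat.cast_zero, sub_zero]
        exact map_zero f
      map_add' := fun x y => by
        rw [← map_add]
        congr 1
        funext i
        simp only [Pi.add_apply, Nat.cast_add]
        ring }
  let φ : (Fin m ⊕ Fin m ⊕ Ψ → ℕ) →+ (Ψ → ℤ) :=
    { toFun := fun x ψ => ψ.1 (e x), map_zero' := by funext; simp, map_add' := fun x y => by funext; simp }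
  let φ' : (Fin m ⊕ Fin m ⊕ Ψ → ℕ) →+ (Ψ → ℤ) :=
    { toFun := fun x ψ => x (Sum.inr (Sum.inr ψ)), map_zero' := by funext; simp,
      map_add' := fun x y => by funext; simp }
  have hS : (φ.eqLocusM φ').map e = S := by
    ext s
    constructor
    · rintro ⟨x, hx, rfl⟩
      refine (h.mem_iff _).mpr fun ψ hψ => ?_
      have : ψ (e x) = x (Sum.inr (Sum.inr ⟨ψ, hψ⟩)) := congrFun hx ⟨ψ, hψ⟩
      rw [this]
      positivity
    · intro hs
      obtain ⟨z, rfl⟩ := hf s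
      have he : ∀ y : Ψ → ℕ, e (Sum.elim (fun i => (z i).toNat)
          (Sum.elim (fun i => (-z i).toNat) y)) = f z := by
        intro y
        change f _ = f z
        congr 1
        funext i
        simp only [Sum.elim_inl, Sum.elim_inr]
        omega
      refine ⟨_, ?_, he fun ψ => (ψ.1 (f z)).toNat⟩
      refine funext fun ψ => ?_
      change ψ.1 (e _) = _
      rw [he]
      exact (Int.toNat_of_nonneg ((h.mem_iff _).mp hs ψ.1 ψ.2)).symm
  rw [← hS]
  exact (AddSubmonoid.fg_eqLocusM φ φ').map e

/-- Every character is a product of basis characters and their inverses, hence algebraic over the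
subalgebra that the basis characters generate. -/
lemma trdeg_addMonoidAlgebra_le {k : Type u} [Field k] {ι : Type} [Fintype ι] (g : Module.Basis ι ℤ M) :
    Algebra.trdeg k (AddMonoidAlgebra k M) ≤ Fintype.card ι := by
  have : NoZeroDivisors (AddMonoidAlgebra k M) :=
    have : UniqueSums M := .of_injective_addHom g.equivFun.toAddEquiv.toAddHom g.equivFun.injective inferInstance
    inferInstance
  let χ : ι → AddMonoidAlgebra k M := fun i => AddMonoidAlgebra.single (g i) 1
  let B := Algebra.adjoin k (Set.range χ)
  have hχ : ∀ x : M, IsAlgebraic B (AddMonoidAlgebra.single x (1 : k)) := by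
    have hg : ∀ i, IsAlgebraic B (χ i) := fun i =>
      isAlgebraic_algebraMap (⟨χ i, Algebra.subset_adjoin ⟨i, rfl⟩⟩ : B)
    intro x
    have hx : x ∈ Submodule.span ℤ (Set.range g) := g.mem_span x
    rw [← AddSubgroup.toIntSubmodule_closure] at hx
    replace hx : x ∈ AddSubgroup.closure (Set.range g) := hx
    induction hx using AddSubgroup.closure_induction with
    | mem x hx =>
      obtain ⟨i, rfl⟩ := hx
      exact hg i
    | zero => exact isAlgebraic_one
    | add x y _ _ hx hy =>
      have := hx.mul hy
      rwa [AddMonoidAlgebra.single_mul_single, one_mul] at this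
    | neg x _ hx =>
      let _ : Invertible (AddMonoidAlgebra.single x (1 : k)) :=
        ⟨AddMonoidAlgebra.single (-x) 1,
          by rw [AddMonoidAlgebra.single_mul_single, neg_add_cancel, one_mul]; rfl,
          by rw [AddMonoidAlgebra.single_mul_single, add_neg_cancel, one_mul]; rfl⟩
      exact hx.invOf
  have : Algebra.IsAlgebraic (Algebra.adjoin k (Set.range χ)) (AddMonoidAlgebra k M) := by
    refine ⟨fun x => ?_⟩
    induction x using AddMonoidAlgebra.induction_linear with
    | zero => exact isAlgebraic_zero
    | add x y hx hy => exact hx.add hy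
    | single m a =>
      rw [show AddMonoidAlgebra.single m a = algebraMap k (AddMonoidAlgebra k M) a *
        AddMonoidAlgebra.single m 1 by simp [AddMonoidAlgebra.single_mul_single]]
      exact (isAlgebraic_algebraMap (algebraMap k B a)).mul (hχ m)
  refine (Algebra.IsAlgebraic.trdeg_le_cardinalMk k (Set.range χ)).trans ?_
  simpa using Cardinal.mk_range_le_lift (f := χ)

lemma IsCutOutBy.ringKrullDim_le {k : Type u} [Field k] {ι : Type} [Fintype ι]
    (g : Module.Basis ι ℤ M) {S : AddSubmonoid M} {Ψ : Set (M →+ ℤ)} {l : M} (h : IsCutOutBy S Ψ l) :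
    ringKrullDim (AddMonoidAlgebra k S) ≤ Fintype.card ι := by
  have := Module.Finite.of_basis g
  have : AddMonoid.FG S := (AddMonoid.fg_iff_addSubmonoid_fg S).mpr h.fg
  refine ringKrullDim_le_of_trdeg_le (k := k) (le_trans ?_ (trdeg_addMonoidAlgebra_le (k := k) g))
  exact trdeg_le_of_injective (AddMonoidAlgebra.mapDomainAlgHom k k S.subtype)
    (AddMonoidAlgebra.mapDomain_injective Subtype.val_injective)

end Gordan

/-! ### The cotangent space at the distinguished point -/

section Vertex
variable {M : Type} [AddCommGroup M]

lemma neg_mem_of_neg_add_mem {S : AddSubmonoid M} {a b : M} (hb : b ∈ S) (h : -(a + b) ∈ S) :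
    -a ∈ S := by
  have := S.add_mem h hb
  rwa [neg_add, neg_add_cancel_right] at this

lemma neg_add_mem_iff {S : AddSubmonoid M} {a b : M} (ha : a ∈ S) (hb : b ∈ S) :
    -(a + b) ∈ S ↔ -a ∈ S ∧ -b ∈ S :=
  ⟨fun h => ⟨neg_mem_of_neg_add_mem hb h, neg_mem_of_neg_add_mem ha (by rwa [add_comm] at h)⟩,
    fun h => by rw [neg_add]; exact S.add_mem h.1 h.2⟩

open Classical in
/-- The homomorphism `k[S] → k` that maps the invertible characters to `1` and the others to `0`. -/
def vertexHom (k : Type u) [Field k] (S : AddSubmonoid M) : AddMonoidAlgebra k S →ₐ[k] k :=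
  AddMonoidAlgebra.lift k k S
    { toFun := fun s => if -(s.toAdd : M) ∈ S then 1 else 0
      map_one' := by simp
      map_mul' := fun a b => by
        have := neg_add_mem_iff a.toAdd.2 b.toAdd.2
        rw [toAdd_mul, AddSubmonoid.coe_add, if_congr this rfl rfl]
        split_ifs <;> simp_all }

/-- The ideal of the distinguished point of the affine toric variety. -/
def vertexIdeal (k : Type u) [Field k] (S : AddSubmonoid M) : Ideal (AddMonoidAlgebra k S) :=
  RingHom.ker (vertexHom k S)

instance (k : Type u) [Field k] (S : AddSubmonoid M) : (vertexIdeal k S).IsPrime :=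
  RingHom.ker_isPrime _

open Classical in
lemma vertexHom_single {k : Type u} [Field k] {S : AddSubmonoid M} (s : S) (c : k) :
    vertexHom k S (AddMonoidAlgebra.single s c) = if -(s : M) ∈ S then c else 0 := by
  rw [vertexHom, AddMonoidAlgebra.lift_single]
  simp

/-- The subgroup of the invertible elements of a submonoid of a lattice. -/
def unitLattice (S : AddSubmonoid M) : Submodule ℤ M :=
  AddSubgroup.toIntSubmodule
    { carrier := {x | x ∈ S ∧ -x ∈ S}
      zero_mem' := by simp
      add_mem' := fun {a b} ha hb => ⟨S.add_mem ha.1 hb.1, by rw [neg_add]; exact S.add_mem ha.2 hb.2⟩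
      neg_mem' := fun {a} ha => ⟨ha.2, by rw [neg_neg]; exact ha.1⟩ }

lemma mem_unitLattice {S : AddSubmonoid M} {x : M} : x ∈ unitLattice S ↔ x ∈ S ∧ -x ∈ S := Iff.rfl

/-- The elements of a submonoid that are not invertible and not the sum of two noninvertible elements. -/
def IsIrred (S : AddSubmonoid M) (h : M) : Prop :=
  h ∈ S ∧ -h ∉ S ∧ ∀ a ∈ S, ∀ b ∈ S, a + b = h → -a ∈ S ∨ -b ∈ S

lemma IsIrred.add {S : AddSubmonoid M} {h l : M} (hh : IsIrred S h) (hl : l ∈ unitLattice S) :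
    IsIrred S (h + l) := by
  refine ⟨S.add_mem hh.1 hl.1, fun hn => hh.2.1 (neg_mem_of_neg_add_mem hl.1 hn), fun a ha b hb hab => ?_⟩
  rcases hh.2.2 a ha (b + -l) (S.add_mem hb hl.2) (by rw [← add_assoc, hab]; abel) with h1 | h1
  · exact Or.inl h1
  · exact Or.inr (neg_mem_of_neg_add_mem hl.2 h1)

lemma IsIrred.of_mk_eq {S : AddSubmonoid M} {h s : M} (hh : IsIrred S h)
    (hs : (unitLattice S).mkQ s = (unitLattice S).mkQ h) : IsIrred S s := by
  have : s - h ∈ unitLattice S := (Submodule.Quotient.eq _).mp hs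
  simpa using hh.add this

open Classical in
/-- The values on the characters of a derivation of `k[S]` at the distinguished point. -/
def vertexDeriv (k : Type u) [Field k] (S : AddSubmonoid M) (T : Finset (M ⧸ unitLattice S)) {κ : Type}
    (b : Module.Basis κ ℤ (unitLattice S)) (s : S) : T ⊕ κ → k :=
  Sum.elim (fun t => if (unitLattice S).mkQ s = t then 1 else 0)
    (fun i => if hs : -(s : M) ∈ S then (b.repr ⟨s, mem_unitLattice.mpr ⟨s.2, hs⟩⟩ i : k) else 0)

-- The Leibniz rule at the point where invertible characters have the value 1 and the others 0. The
-- critical case is that neither `x` nor `y` is invertible: then `x + y` is not in an irreducible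
-- class, so no component in `T` is affected.
open Classical in
lemma vertexDeriv_add (k : Type u) [Field k] {S : AddSubmonoid M} {T : Finset (M ⧸ unitLattice S)}
    (hT : ∀ q ∈ T, ∃ h, IsIrred S h ∧ (unitLattice S).mkQ h = q) {κ : Type}
    (b : Module.Basis κ ℤ (unitLattice S)) (x y : S) :
    vertexDeriv k S T b (x + y) = (if -(x : M) ∈ S then (1 : k) else 0) • vertexDeriv k S T b y +
      (if -(y : M) ∈ S then (1 : k) else 0) • vertexDeriv k S T b x := by
  have hzero : ∀ x : S, -(x : M) ∈ S → (unitLattice S).mkQ x = 0 := fun x hx =>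
    (Submodule.Quotient.mk_eq_zero _).mpr ⟨x.2, hx⟩
  have hT0 : ∀ t : T, (0 : M ⧸ unitLattice S) ≠ t := by
    rintro t ht
    obtain ⟨h, hh, hht⟩ := hT t t.2
    rw [← ht] at hht
    exact hh.2.1 ((Submodule.Quotient.mk_eq_zero _).mp hht).2
  have hadd := neg_add_mem_iff x.2 y.2
  funext i
  rcases i with t | i
  · simp only [vertexDeriv, Pi.add_apply, Pi.smul_apply, Sum.elim_inl, smul_eq_mul, AddSubmonoid.coe_add,
      map_add]
    by_cases hx : -(x : M) ∈ S <;> by_cases hy : -(y : M) ∈ S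
    · simp [hzero x hx, hzero y hy, hT0]
    · rw [hzero x hx, zero_add, if_pos hx, if_neg hy, one_mul, zero_mul, add_zero]
    · rw [hzero y hy, add_zero, if_pos hy, if_neg hx, one_mul, zero_mul, zero_add]
    · rw [if_neg, if_neg hx, if_neg hy, zero_mul, zero_mul, add_zero]
      intro ht
      obtain ⟨h, hh, hht⟩ := hT t t.2
      rw [← map_add, ← hht] at ht
      rcases (hh.of_mk_eq ht).2.2 x x.2 y y.2 rfl with h1 | h1
      · exact hx h1
      · exact hy h1
  · simp only [vertexDeriv, Pi.add_apply, Pi.smul_apply, Sum.elim_inr, smul_eq_mul, AddSubmonoid.coe_add]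
    by_cases hx : -(x : M) ∈ S <;> by_cases hy : -(y : M) ∈ S
    · have e : (⟨(x : M) + y, mem_unitLattice.mpr ⟨S.add_mem x.2 y.2, hadd.mpr ⟨hx, hy⟩⟩⟩ : unitLattice S) =
          ⟨y, mem_unitLattice.mpr ⟨y.2, hy⟩⟩ + ⟨x, mem_unitLattice.mpr ⟨x.2, hx⟩⟩ :=
        Subtype.ext (add_comm _ _)
      rw [dif_pos (hadd.mpr ⟨hx, hy⟩), if_pos hx, if_pos hy, dif_pos hx, dif_pos hy, one_mul, one_mul, e,
        map_add, Finsupp.add_apply, Int.cast_add]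
    · rw [dif_neg fun h => hy (hadd.mp h).2, if_neg hy, dif_neg hy, mul_zero, zero_mul, add_zero]
    · rw [dif_neg fun h => hx (hadd.mp h).1, if_neg hx, dif_neg hx, mul_zero, zero_mul, add_zero]
    · rw [dif_neg fun h => hx (hadd.mp h).1, if_neg hx, dif_neg hx, mul_zero, add_zero,
        zero_mul]

open Classical in
/-- The homomorphism from `k[S]` to a ring of dual numbers that computes the cotangent space at the
distinguished point. -/
def vertexDual (k : Type u) [Field k] (S : AddSubmonoid M) (T : Finset (M ⧸ unitLattice S))
    (hT : ∀ q ∈ T, ∃ h, IsIrred S h ∧ (unitLattice S).mkQ h = q) {κ : Type}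
    (b : Module.Basis κ ℤ (unitLattice S)) :
    AddMonoidAlgebra k S →ₐ[k] TrivSqZeroExt k (T ⊕ κ → k) :=
  AddMonoidAlgebra.lift k _ S
    { toFun := fun s => TrivSqZeroExt.inl (if -(s.toAdd : M) ∈ S then 1 else 0) +
        TrivSqZeroExt.inr (vertexDeriv k S T b s.toAdd)
      map_one' := by
        refine TrivSqZeroExt.ext (by simp) ?_
        have := vertexDeriv_add k hT b 0 0
        rw [add_zero, if_pos (by simp), one_smul, right_eq_add] at this
        simpa using this
      map_mul' := fun x y => by
        refine TrivSqZeroExt.ext ?_ ?_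
        · have := neg_add_mem_iff x.toAdd.2 y.toAdd.2
          simp only [TrivSqZeroExt.fst_mul, TrivSqZeroExt.fst_add, TrivSqZeroExt.fst_inl,
            TrivSqZeroExt.fst_inr, add_zero, toAdd_mul, AddSubmonoid.coe_add, this]
          split_ifs <;> simp_all
        · simp only [TrivSqZeroExt.snd_mul, TrivSqZeroExt.fst_add, TrivSqZeroExt.fst_inl,
            TrivSqZeroExt.fst_inr, add_zero, TrivSqZeroExt.snd_add, TrivSqZeroExt.snd_inl,
            TrivSqZeroExt.snd_inr, zero_add, toAdd_mul, op_smul_eq_smul]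
          exact vertexDeriv_add k hT b x.toAdd y.toAdd }

lemma fst_vertexDual {k : Type u} [Field k] {S : AddSubmonoid M} {T : Finset (M ⧸ unitLattice S)}
    (hT : ∀ q ∈ T, ∃ h, IsIrred S h ∧ (unitLattice S).mkQ h = q) {κ : Type}
    (b : Module.Basis κ ℤ (unitLattice S)) (x : AddMonoidAlgebra k S) :
    (vertexDual k S T hT b x).fst = vertexHom k S x := by
  have : (TrivSqZeroExt.fstHom k k (T ⊕ κ → k)).comp (vertexDual k S T hT b) = vertexHom k S := by
    classical
    refine (AddMonoidAlgebra.lift k k S).symm.injective (MonoidHom.ext fun s => ?_)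
    change (vertexDual k S T hT b (AddMonoidAlgebra.single s.toAdd 1)).fst =
      vertexHom k S (AddMonoidAlgebra.single s.toAdd 1)
    rw [vertexHom_single, vertexDual, AddMonoidAlgebra.lift_single, one_smul]
    simp
  exact DFunLike.congr_fun this x

lemma snd_vertexDual_single {k : Type u} [Field k] {S : AddSubmonoid M} {T : Finset (M ⧸ unitLattice S)}
    (hT : ∀ q ∈ T, ∃ h, IsIrred S h ∧ (unitLattice S).mkQ h = q) {κ : Type}
    (b : Module.Basis κ ℤ (unitLattice S)) (s : S) :
    (vertexDual k S T hT b (AddMonoidAlgebra.single s 1)).snd = vertexDeriv k S T b s := by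
  rw [vertexDual, AddMonoidAlgebra.lift_single, one_smul]
  simp

/-- The number of irreducible elements modulo units is bounded in terms of the cotangent space at the
distinguished point. -/
lemma card_add_card_le_spanFinrank {k : Type u} [Field k] {S : AddSubmonoid M}
    {T : Finset (M ⧸ unitLattice S)} (hT : ∀ q ∈ T, ∃ h, IsIrred S h ∧ (unitLattice S).mkQ h = q)
    {κ : Type} [Fintype κ] (b : Module.Basis κ ℤ (unitLattice S))
    [IsNoetherianRing (Localization.AtPrime (vertexIdeal k S))] :
    T.card + Fintype.card κ ≤
      (IsLocalRing.maximalIdeal (Localization.AtPrime (vertexIdeal k S))).spanFinrank := by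
  classical
  have := finrank_le_spanFinrank (k := k) (vertexDual k S T hT b).toRingHom (vertexIdeal k S)
    (fun a => by
      change _ ↔ (vertexDual k S T hT b a).fst = 0
      rw [fst_vertexDual]
      rfl) ?_
  · simpa using this
  rw [eq_top_iff, ← (Pi.basisFun k (T ⊕ κ)).span_eq, Submodule.span_le]
  rintro _ ⟨i, rfl⟩
  rw [Pi.basisFun_apply]
  refine Submodule.subset_span ?_
  -- The basis vector of `t` is the derivative of χ^h for an irreducible `h` in the class `t`, and
  -- that of `i` is the derivative of χ^{b i} - 1.
  rcases i with t | i
  · obtain ⟨h, hh, hht⟩ := hT t t.2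
    refine ⟨AddMonoidAlgebra.single ⟨h, hh.1⟩ 1, ?_, ?_⟩
    · change vertexHom k S _ = 0
      rw [vertexHom_single, if_neg hh.2.1]
    · refine (snd_vertexDual_single hT b _).trans ?_
      funext j
      rcases j with t' | j
      · simp only [vertexDeriv, Sum.elim_inl, hht, Pi.single_apply, Sum.inl.injEq]
        exact if_congr (by rw [← Subtype.ext_iff, eq_comm]) rfl rfl
      · simp [vertexDeriv, hh.2.1]
  · refine ⟨AddMonoidAlgebra.single ⟨b i, (b i).2.1⟩ 1 - 1, ?_, ?_⟩
    · change vertexHom k S _ = 0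
      rw [map_sub, vertexHom_single, if_pos (b i).2.2, map_one, sub_self]
    · change (vertexDual k S T hT b _).snd = _
      rw [map_sub, map_one, TrivSqZeroExt.snd_sub, snd_vertexDual_single, TrivSqZeroExt.snd_one, sub_zero]
      funext j
      rcases j with t' | j
      · have h0 : (unitLattice S).mkQ (b i) = 0 := (Submodule.Quotient.mk_eq_zero _).mpr (b i).2
        obtain ⟨h, hh, hht⟩ := hT t' t'.2
        simp only [vertexDeriv, Sum.elim_inl, h0, Pi.single_apply, reduceCtorEq, if_false]
        refine if_neg fun h1 => hh.2.1 ?_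
        rw [← hht] at h1
        exact ((Submodule.Quotient.mk_eq_zero _).mp h1.symm).2
      · have hb : (⟨(b i : M), (b i).2.1, (b i).2.2⟩ : unitLattice S) = b i := rfl
        simp [vertexDeriv, (b i).2.2, hb, Finsupp.single_apply, Pi.single_apply, eq_comm]

lemma IsCutOutBy.mem_unitLattice_iff {S : AddSubmonoid M} {Ψ : Set (M →+ ℤ)} {l : M}
    (h : IsCutOutBy S Ψ l) {x : M} : x ∈ unitLattice S ↔ ∀ ψ ∈ Ψ, ψ x = 0 := by
  rw [mem_unitLattice, h.mem_iff, h.mem_iff]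
  refine ⟨fun hx ψ hψ => le_antisymm ?_ (hx.1 ψ hψ), fun hx => ⟨fun ψ hψ => (hx ψ hψ).ge, fun ψ hψ => ?_⟩⟩
  · have := hx.2 ψ hψ
    rwa [map_neg, Left.nonneg_neg_iff] at this
  · rw [map_neg, hx ψ hψ, neg_zero]

/-- The irreducible elements and the units generate the monoid. -/
lemma IsCutOutBy.mem_closure_irred {S : AddSubmonoid M} {Ψ : Set (M →+ ℤ)} {l : M}
    (h : IsCutOutBy S Ψ l) {x : M} (hx : x ∈ S) : (unitLattice S).mkQ x ∈
      AddSubmonoid.closure {q | ∃ h, IsIrred S h ∧ (unitLattice S).mkQ h = q} := by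
  classical
  -- The sum of all forms is nonnegative on `S` and vanishes only at units, so it decreases strictly
  -- when an element is split into two noninvertible ones.
  let δ : M →+ ℤ := ∑ ψ ∈ h.finite.toFinset, ψ
  have hδ : ∀ y ∈ S, 0 ≤ δ y ∧ (δ y = 0 → -y ∈ S) := by
    intro y hy
    have h0 : ∀ ψ ∈ h.finite.toFinset, 0 ≤ ψ y := fun ψ hψ =>
      (h.mem_iff y).mp hy ψ (h.finite.mem_toFinset.mp hψ)
    have hd : δ y = ∑ ψ ∈ h.finite.toFinset, ψ y := by simp [δ]
    rw [hd]
    refine ⟨Finset.sum_nonneg h0, fun hy0 => ?_⟩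
    rw [Finset.sum_eq_zero_iff_of_nonneg h0] at hy0
    exact (h.mem_unitLattice_iff.mpr fun ψ hψ => hy0 ψ (h.finite.mem_toFinset.mpr hψ)).2
  induction hn : (δ x).toNat using Nat.strong_induction_on generalizing x with
  | _ n ih =>
    by_cases hu : -x ∈ S
    · rw [show (unitLattice S).mkQ x = 0 from (Submodule.Quotient.mk_eq_zero _).mpr ⟨hx, hu⟩]
      exact AddSubmonoid.zero_mem _
    by_cases hirr : IsIrred S x
    · exact AddSubmonoid.subset_closure ⟨x, hirr, rfl⟩
    obtain ⟨a, ha, b, hb, rfl, hna, hnb⟩ : ∃ a ∈ S, ∃ b ∈ S, a + b = x ∧ -a ∉ S ∧ -b ∉ S := by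
      by_contra! hcon
      exact hirr ⟨hx, hu, fun a ha b hb hab => or_iff_not_imp_left.mpr (hcon a ha b hb hab)⟩
    have h1 := hδ a ha
    have h2 := hδ b hb
    have h3 : δ a ≠ 0 := fun h => hna (h1.2 h)
    have h4 : δ b ≠ 0 := fun h => hnb (h2.2 h)
    rw [map_add] at hn
    rw [map_add]
    exact AddSubmonoid.add_mem _ (ih _ (by omega) ha rfl) (ih _ (by omega) hb rfl)

/-- If the distinguished point of an affine toric variety is regular, then the monoid is smooth. -/
theorem IsCutOutBy.isSmoothMonoid_of_isRegularLocalRing {k : Type u} [Field k] {ι : Type} [Fintype ι]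
    (g : Module.Basis ι ℤ M) {S : AddSubmonoid M} {Ψ : Set (M →+ ℤ)} {l : M} (h : IsCutOutBy S Ψ l)
    [hreg : IsRegularLocalRing (Localization.AtPrime (vertexIdeal k S))] : IsSmoothMonoid S := by
  classical
  have := Module.Finite.of_basis g
  have := Module.Free.of_basis g
  set L := unitLattice S
  let b := Module.finBasis ℤ L
  set H : Set (M ⧸ L) := {q | ∃ h, IsIrred S h ∧ L.mkQ h = q}
  -- The left side is at most the number of generators of the maximal ideal; by regularity this is
  -- the dimension of the local ring, which is at most the rank of `M`.
  have hcard : ∀ T : Finset (M ⧸ L), (T : Set (M ⧸ L)) ⊆ H →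
      T.card + Module.finrank ℤ L ≤ Module.finrank ℤ M := by
    intro T hT
    have h1 := card_add_card_le_spanFinrank (k := k) (T := T) (fun q hq => hT hq) b
    have h2 : ringKrullDim (Localization.AtPrime (vertexIdeal k S)) ≤ Fintype.card ι := by
      rw [IsLocalization.AtPrime.ringKrullDim_eq_height (vertexIdeal k S)]
      exact (Ideal.height_le_ringKrullDim_of_ne_top Ideal.IsPrime.ne_top').trans (h.ringKrullDim_le g)
    rw [← hreg.spanFinrank_maximalIdeal] at h2
    have h3 : (IsLocalRing.maximalIdeal (Localization.AtPrime (vertexIdeal k S))).spanFinrank ≤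
      Fintype.card ι := by exact_mod_cast h2
    rw [Module.finrank_eq_card_basis g]
    simpa using h1.trans h3
  have hQ := Submodule.finrank_quotient_add_finrank L
  have hHfin : H.Finite := by
    by_contra hinf
    obtain ⟨T, hT, hTc⟩ := Set.Infinite.exists_subset_card_eq hinf (Module.finrank ℤ M + 1)
    have := hcard T hT
    omega
  have : Fintype H := hHfin.fintype
  have hHcard : Fintype.card H ≤ Module.finrank ℤ (M ⧸ L) := by
    have := hcard H.toFinset (by simp)
    rw [Set.toFinset_card] at this
    omega
  -- Every element of `M` is a difference of elements of `S`, as `x + N • l` is in `S` for some `N`.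
  have hspan : ⊤ ≤ Submodule.span ℤ (Set.range ((↑) : H → M ⧸ L)) := by
    have hS : ∀ x ∈ S, L.mkQ x ∈ Submodule.span ℤ H := by
      intro x hx
      have : AddSubmonoid.closure H ≤ (Submodule.span ℤ H).toAddSubmonoid :=
        AddSubmonoid.closure_le.mpr Submodule.subset_span
      exact this (h.mem_closure_irred hx)
    rintro q -
    obtain ⟨x, rfl⟩ := Submodule.mkQ_surjective _ q
    obtain ⟨N, hN⟩ := h.exists_add_nsmul_mem x
    rw [Subtype.range_coe, show x = (x + N • l) - N • l by abel, map_sub]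
    exact Submodule.sub_mem _ (hS _ hN) (hS _ (S.nsmul_mem h.mem N))
  -- `L` is the common kernel of the forms in `Ψ`, hence saturated.
  have htf : Module.IsTorsionFree ℤ (M ⧸ L) := by
    refine Module.IsTorsionFree.of_smul_eq_zero fun n q hnq => ?_
    obtain ⟨x, rfl⟩ := Submodule.mkQ_surjective _ q
    rw [← map_smul] at hnq
    replace hnq := (Submodule.Quotient.mk_eq_zero _).mp hnq
    refine or_iff_not_imp_left.mpr fun hn => (Submodule.Quotient.mk_eq_zero _).mpr ?_
    rw [h.mem_unitLattice_iff] at hnq ⊢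
    intro ψ hψ
    have := hnq ψ hψ
    rw [map_zsmul, smul_eq_mul] at this
    exact (mul_eq_zero.mp this).resolve_left hn
  have : Module.Free ℤ (M ⧸ L) := inferInstance
  -- A generating set with at most as many elements as the rank is a basis; the coordinate forms of
  -- this basis are the required forms.
  let c : Module.Basis H ℤ (M ⧸ L) :=
    Module.Basis.mk (linearIndependent_of_top_le_span_of_card_le_finrank hspan hHcard) hspan
  have hc : ∀ q : H, c q = q := fun q => Module.Basis.mk_apply _ _ q
  let v : H → M →+ ℤ := fun q => (c.coord q ∘ₗ L.mkQ).toAddMonoidHom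
  have hv : ∀ q x, v q x = c.repr (L.mkQ x) q := fun _ _ => rfl
  refine isSmoothMonoid_of_dual v (fun x => ⟨fun hx i => ?_, fun hx => ?_⟩) fun q => ?_
  · rw [hv]
    have hcl := h.mem_closure_irred hx
    generalize L.mkQ x = y at hcl
    induction hcl using AddSubmonoid.closure_induction with
    | mem y hy =>
      rw [← show c ⟨y, hy⟩ = y from hc ⟨y, hy⟩, c.repr_self, Finsupp.single_apply]
      split_ifs <;> norm_num
    | zero => simp
    | add y z _ _ hy hz =>
      rw [map_add, Finsupp.add_apply]
      exact add_nonneg hy hz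
  · choose a ha using fun q : H => q.2
    -- An element with nonnegative coordinates differs by a unit of `S` from the sum of irreducible
    -- elements with the same coordinates.
    have hmem : x - ∑ q, (v q x).toNat • a q ∈ L := by
      rw [← Submodule.Quotient.mk_eq_zero]
      change L.mkQ _ = 0
      rw [map_sub, map_sum, sub_eq_zero]
      conv_lhs => rw [← c.sum_repr (L.mkQ x)]
      refine Finset.sum_congr rfl fun q _ => ?_
      rw [hc, map_nsmul, (ha q).2, ← natCast_zsmul, Int.toNat_of_nonneg (hx q), hv]
    rw [← sub_add_cancel x (∑ q, (v q x).toNat • a q)]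
    exact S.add_mem hmem.1 (S.sum_mem fun q _ => S.nsmul_mem (ha q).1.1 _)
  · obtain ⟨a, ha, haq⟩ := q.2
    refine ⟨a, ?_, fun q' hq' => ?_⟩
    · rw [hv, haq, ← hc, c.repr_self, Finsupp.single_eq_same]
    · rw [hv, haq, ← hc, c.repr_self, Finsupp.single_eq_of_ne hq']

end Vertex

/-! ### Regularity of the algebra of a smooth monoid -/

/-- Every local ring of `A` is a local ring of `R`, at the contracted prime. -/
lemma isRegularRing_of_isLocalization {R A : Type*} [CommRing R] [CommRing A] [Algebra R A]
    (N : Submonoid R) [IsLocalization N A] [IsRegularRing R] : IsRegularRing A := by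
  have := IsLocalization.isNoetherianRing N A inferInstance
  refine isRegularRing_iff.mpr fun p hp => ?_
  have := IsLocalization.isLocalization_isLocalization_atPrime_isLocalization N (Localization.AtPrime p) p
  have := isRegularRing_iff.mp ‹IsRegularRing R› (p.comap (algebraMap R A))
  exact IsRegularLocalRing.of_ringEquiv (IsLocalization.algEquiv (p.comap (algebraMap R A)).primeCompl
    (Localization.AtPrime (p.comap (algebraMap R A))) (Localization.AtPrime p)).toRingEquiv

section
variable {M : Type} [AddCommGroup M]

/-- The monoid algebra of a smooth monoid is regular. -/
theorem IsSmoothMonoid.isRegularRing {S : AddSubmonoid M} (hS : IsSmoothMonoid S) (k : Type u) [Field k] :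
    IsRegularRing (AddMonoidAlgebra k S) := by
  classical
  obtain ⟨ι, _, g, J, hJ⟩ := hS
  have hg : ∀ i j, g.repr (g i) j = if i = j then 1 else 0 := fun i j => by
    rw [g.repr_self, Finsupp.single_apply]
  have hgS : ∀ i, g i ∈ S := fun i => (hJ _).mpr fun j _ => by
    rw [hg]
    split_ifs <;> norm_num
  let e : (ι →₀ ℕ) →+ S :=
    { toFun := fun c => ∑ i, c i • ⟨g i, hgS i⟩
      map_zero' := by simp
      map_add' := fun a b => by
        rw [← Finset.sum_add_distrib]
        exact Finset.sum_congr rfl fun i _ => add_smul _ _ _ }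
  have he : ∀ c i, g.repr (e c : M) i = c i := by
    intro c i
    have : (e c : M) = ∑ i, (c i : ℤ) • g i := by simp [e]
    rw [this, map_sum, Finsupp.finsetSum_apply]
    simp [Finsupp.single_apply]
  have hinj : Function.Injective e := fun a b hab => Finsupp.ext fun i => by
    have := he a i
    rw [hab, he] at this
    exact_mod_cast this.symm
  let φ : MvPolynomial ι k →+* AddMonoidAlgebra k S := AddMonoidAlgebra.mapDomainRingHom k e
  have hφ : ∀ c a, φ (MvPolynomial.monomial c a) = AddMonoidAlgebra.single (e c) a := fun c a =>
    AddMonoidAlgebra.mapDomain_single ..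
  let _ := φ.toAlgebra
  -- The exponent `c₀` is the product of the variables outside `J`; inverting this monomial turns
  -- the polynomial ring into `k[S]`.
  let c₀ : ι →₀ ℕ := Finsupp.equivFunOnFinite.symm fun i => if i ∈ J then 0 else 1
  have hc₀ : ∀ i, c₀ i = if i ∈ J then 0 else 1 := fun _ => rfl
  have hneg : -(e c₀ : M) ∈ S := (hJ _).mpr fun j hj => by
    rw [map_neg, Finsupp.neg_apply, he, hc₀, if_pos hj]
    simp
  have hsurj : ∀ x : S, ∃ (N : ℕ) (c : ι →₀ ℕ), e c = x + N • e c₀ := by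
    intro x
    -- The sum of the absolute values of all coordinates is one exponent that works for every
    -- coordinate outside `J`.
    have hx : ∀ i, 0 ≤ g.repr (x + (∑ i, (g.repr x i).natAbs) • (e c₀ : M)) i := by
      intro i
      rw [map_add, map_nsmul, Finsupp.add_apply, Finsupp.smul_apply, he, hc₀]
      split_ifs with hi
      · simpa using (hJ x).mp x.2 i hi
      · have := Finset.single_le_sum (f := fun i => (g.repr x i).natAbs) (fun _ _ => Nat.zero_le _)
          (Finset.mem_univ i)
        simp only [Nat.cast_one, nsmul_eq_mul, mul_one]
        omega
    refine ⟨∑ i, (g.repr x i).natAbs, Finsupp.equivFunOnFinite.symm fun i =>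
      (g.repr (x + (∑ i, (g.repr x i).natAbs) • (e c₀ : M)) i).toNat, Subtype.ext (g.repr.injective ?_)⟩
    ext i
    rw [he]
    exact Int.toNat_of_nonneg (hx i)
  have hloc : IsLocalization.Away (MvPolynomial.monomial c₀ (1 : k)) (AddMonoidAlgebra k S) := by
    refine IsLocalization.Away.mk _ ?_ ?_ ?_
    · rw [RingHom.algebraMap_toAlgebra, hφ]
      refine IsUnit.of_mul_eq_one (AddMonoidAlgebra.single ⟨_, hneg⟩ 1) ?_
      rw [AddMonoidAlgebra.single_mul_single, AddMonoidAlgebra.one_def, one_mul]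
      congr 1
      exact Subtype.ext (add_neg_cancel _)
    · intro x
      rw [RingHom.algebraMap_toAlgebra]
      induction x using AddMonoidAlgebra.induction_linear with
      | zero => exact ⟨0, 0, by simp⟩
      | add x y hx hy =>
        obtain ⟨N, a, ha⟩ := hx
        obtain ⟨N', b, hb⟩ := hy
        refine ⟨N + N', a * MvPolynomial.monomial c₀ (1 : k) ^ N' + b * MvPolynomial.monomial c₀ (1 : k) ^ N, ?_⟩
        rw [map_add, map_mul, map_mul, ← ha, ← hb, map_pow, map_pow]
        ring
      | single m a =>
        obtain ⟨N, c, hc⟩ := hsurj m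
        refine ⟨N, MvPolynomial.monomial c a, ?_⟩
        rw [hφ, hφ, AddMonoidAlgebra.single_pow, AddMonoidAlgebra.single_mul_single, one_pow, mul_one, hc]
    · intro a b hab
      exact ⟨0, congrArg _ (AddMonoidAlgebra.mapDomain_injective hinj hab)⟩
  exact isRegularRing_of_isLocalization (Submonoid.powers (MvPolynomial.monomial c₀ (1 : k)))

end

/-! ### Comparison with the torus -/

section Torus
variable {M : Type} [AddCommGroup M] {S : AddSubmonoid M} {Ψ : Set (M →+ ℤ)} {l : M}

/-- The inclusion of `k[S]` in the algebra of the torus. -/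
def toTorus (k : Type u) [Field k] (S : AddSubmonoid M) : AddMonoidAlgebra k S →ₐ[k] AddMonoidAlgebra k M :=
  AddMonoidAlgebra.mapDomainAlgHom k k S.subtype

lemma toTorus_single {k : Type u} [Field k] (s : S) (c : k) :
    toTorus k S (AddMonoidAlgebra.single s c) = AddMonoidAlgebra.single (s : M) c :=
  AddMonoidAlgebra.mapDomain_single ..

lemma toTorus_injective {k : Type u} [Field k] : Function.Injective (toTorus k S) :=
  AddMonoidAlgebra.mapDomain_injective Subtype.val_injective

lemma coeff_toTorus {k : Type u} [Field k] (x : AddMonoidAlgebra k S) (s : S) :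
    (toTorus k S x).coeff s = x.coeff s := by
  change (AddMonoidAlgebra.mapDomain S.subtype x).coeff (s : M) = _
  rw [AddMonoidAlgebra.coeff_mapDomain]
  exact Finsupp.mapDomain_apply Subtype.val_injective _ s

lemma mem_of_coeff_toTorus_ne_zero {k : Type u} [Field k] {x : AddMonoidAlgebra k S} {m : M}
    (h : (toTorus k S x).coeff m ≠ 0) : m ∈ S := by
  by_contra hm
  refine h ?_
  change (AddMonoidAlgebra.mapDomain _ x).coeff m = _
  rw [AddMonoidAlgebra.coeff_mapDomain]
  exact Finsupp.mapDomain_of_notMem_range _ _ (by simpa using hm)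

/-- A function on the torus that becomes regular on an affine toric variety after multiplication
with a function that does not vanish at the distinguished point. -/
lemma mem_of_mul_single_mem {k : Type u} [Field k] {a b : AddMonoidAlgebra k S} (hb : b ∉ vertexIdeal k S)
    {q : M} (h : toTorus k S b * AddMonoidAlgebra.single q 1 = toTorus k S a) : q ∈ S := by
  classical
  -- The value of `b` at the distinguished point is the sum of its coefficients at invertible
  -- characters, so one of these is nonzero.
  obtain ⟨s, hs, hsb⟩ : ∃ s : S, -(s : M) ∈ S ∧ b.coeff s ≠ 0 := by
    by_contra! hcon
    refine hb ?_
    change vertexHom k S b = 0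
    rw [vertexHom, AddMonoidAlgebra.lift_apply]
    refine Finset.sum_eq_zero fun s _ => ?_
    by_cases hs : -(s : M) ∈ S
    · simp only [hcon s hs, zero_smul]
    · simp [hs]
  -- Comparing coefficients at `s + q` shows that `s + q` is in `S`, and `-s` is in `S` as well.
  have h1 := congrArg (fun x => x.coeff ((s : M) + q)) h
  simp only [AddMonoidAlgebra.coeff_mul_single_apply, mul_one, add_neg_cancel_right, coeff_toTorus] at h1
  rw [h1] at hsb
  have := S.add_mem (mem_of_coeff_toTorus_ne_zero hsb) hs
  rwa [add_neg_cancel_comm] at this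

/-- Since `l` is positive under every form, inverting χ^l makes all characters available. Hence the
torus and the chart have the same function field. -/
lemma IsCutOutBy.isLocalization_toTorus (h : IsCutOutBy S Ψ l) (k : Type u) [Field k] :
    letI := (toTorus k S).toRingHom.toAlgebra
    IsLocalization.Away (AddMonoidAlgebra.single ⟨l, h.mem⟩ 1 : AddMonoidAlgebra k S)
      (AddMonoidAlgebra k M) := by
  let _ := (toTorus k S).toRingHom.toAlgebra
  have halg : ∀ x, algebraMap (AddMonoidAlgebra k S) (AddMonoidAlgebra k M) x = toTorus k S x := fun _ => rfl
  refine IsLocalization.Away.mk _ ?_ ?_ ?_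
  · rw [halg, toTorus_single]
    refine IsUnit.of_mul_eq_one (AddMonoidAlgebra.single (-l) 1) ?_
    rw [AddMonoidAlgebra.single_mul_single, AddMonoidAlgebra.one_def, one_mul, add_neg_cancel]
  · intro x
    simp only [halg]
    induction x using AddMonoidAlgebra.induction_linear with
    | zero => exact ⟨0, 0, by simp⟩
    | add x y hx hy =>
      obtain ⟨N, a, ha⟩ := hx
      obtain ⟨N', b, hb⟩ := hy
      refine ⟨N + N', a * AddMonoidAlgebra.single ⟨l, h.mem⟩ 1 ^ N' +
        b * AddMonoidAlgebra.single ⟨l, h.mem⟩ 1 ^ N, ?_⟩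
      rw [map_add, map_mul, map_mul, ← ha, ← hb, map_pow, map_pow]
      ring
    | single m a =>
      obtain ⟨N, hN⟩ := h.exists_add_nsmul_mem m
      refine ⟨N, AddMonoidAlgebra.single ⟨_, hN⟩ a, ?_⟩
      rw [toTorus_single, toTorus_single, AddMonoidAlgebra.single_pow,
        AddMonoidAlgebra.single_mul_single, one_pow, mul_one]
  · intro a b hab
    exact ⟨0, congrArg _ (toTorus_injective hab)⟩

end Torus

/-! ### The criterion for an affine chart -/

section AffineCriterion
open TensorProduct
variable {k A K : Type u} [Field k] [CommRing A] [Field K] [Algebra k A] [Algebra k K] [Algebra A K]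
  [IsScalarTower k A K]

/-- The generators of the module of Plücker coordinates given by monomials. -/
lemma pluckerModule_eq_span {n : ℕ} {T : Set K}
    (hT : ∀ t ∈ T, ∃ a : A, algebraMap A K a = t)
    (hspan : ∀ a : A, algebraMap A K a ∈ Submodule.span k T) :
    pluckerModule k A K n = Submodule.span A {x | ∃ t : Fin (Module.finrank K (PrincipalParts k K n)) → K,
      (∀ i, t i ∈ T) ∧ pluckerForm k K n (fun i => Ideal.Quotient.mk _ (1 ⊗ₜ t i)) = x} := by
  apply le_antisymm
  · refine Submodule.span_le.mpr ?_
    rintro _ ⟨p, rfl⟩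
    -- The elements 1 ⊗ b generate Pⁿ_A over `A`, and constants pass from the right factor to the
    -- left, so a spanning set over `k` suffices for b.
    have hone : ∀ x ∈ Submodule.span k T, (Ideal.Quotient.mk _ (1 ⊗ₜ x) : PrincipalParts k K n) ∈
        Submodule.span A ((fun t => (Ideal.Quotient.mk _ (1 ⊗ₜ t) : PrincipalParts k K n)) '' T) := by
      intro x hx
      induction hx using Submodule.span_induction with
      | mem x hx => exact Submodule.subset_span ⟨x, hx, rfl⟩
      | zero => rw [tmul_zero, map_zero]; exact Submodule.zero_mem _
      | add x y _ _ hx hy =>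
        rw [tmul_add, map_add]
        exact Submodule.add_mem _ hx hy
      | smul c x _ hx =>
        have : (Ideal.Quotient.mk _ (1 ⊗ₜ (c • x)) : PrincipalParts k K n) =
            algebraMap k A c • (Ideal.Quotient.mk _ (1 ⊗ₜ x) : PrincipalParts k K n) := by
          rw [tmul_smul, algebraMap_smul]
          rfl
        rw [this]
        exact Submodule.smul_mem _ _ hx
    have hp : ∀ q : PrincipalParts k A n, principalPartsMap (IsScalarTower.toAlgHom k A K) n q ∈
        Submodule.span A ((fun t => (Ideal.Quotient.mk _ (1 ⊗ₜ t) : PrincipalParts k K n)) '' T) := by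
      intro q
      obtain ⟨x, rfl⟩ := Ideal.Quotient.mk_surjective q
      induction x using TensorProduct.induction_on with
      | zero => simp only [map_zero]; exact Submodule.zero_mem _
      | add x y hx hy =>
        rw [map_add, map_add]
        exact Submodule.add_mem _ hx hy
      | tmul a b =>
        rw [principalPartsMap_mk]
        have : (Ideal.Quotient.mk (KaehlerDifferential.ideal k K ^ (n + 1))
            (algebraMap A K a ⊗ₜ[k] algebraMap A K b) : PrincipalParts k K n) =
            a • (Ideal.Quotient.mk _ (1 ⊗ₜ algebraMap A K b) : PrincipalParts k K n) := by
          rw [← mul_one (algebraMap A K a), ← smul_eq_mul, ← TensorProduct.smul_tmul', algebraMap_smul]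
          rfl
        refine Eq.mpr (congrArg (· ∈ _) this) ?_
        exact Submodule.smul_mem _ _ (hone _ (hspan b))
    refine Submodule.span_mono ?_ (multilinear_mem_span (R := A) (pluckerForm k K n) _ _ fun i => hp (p i))
    rintro _ ⟨w, hw, rfl⟩
    choose t ht htw using hw
    exact ⟨t, ht, congrArg _ (funext htw)⟩
  · refine Submodule.span_mono ?_
    rintro _ ⟨t, ht, rfl⟩
    choose a ha using fun i => hT (t i) (ht i)
    refine ⟨fun i => Ideal.Quotient.mk _ (1 ⊗ₜ a i), congrArg _ (funext fun i => ?_)⟩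
    rw [principalPartsMap_mk, map_one, ← ha]
    rfl

variable {M : Type} [AddCommGroup M] {S : AddSubmonoid M}
  {Ψ : Set (M →+ ℤ)} {l : M} [IsFractionRing A K]

/-- For an affine toric variety, the morphism `Proj (⨁ Eⁱ tⁱ) ⟶ Spec A`, for `E` the module of Plücker
coordinates, is an isomorphism if and only if the monoid is smooth. -/
theorem IsCutOutBy.isIso_closureToBase_iff {ι : Type} [Fintype ι] (g : Module.Basis ι ℤ M) (h : IsCutOutBy S Ψ l) (φ : AddMonoidAlgebra k S ≃ₐ[k] A)
    {n : ℕ} (hn : 1 ≤ n) : IsIso (closureToBase (pluckerModule k A K n)) ↔ IsSmoothMonoid S := by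
  have := Module.Finite.of_basis g
  have := Module.Free.of_basis g
  let algA : Algebra (AddMonoidAlgebra k S) A := φ.toRingEquiv.toRingHom.toAlgebra
  let algK : Algebra (AddMonoidAlgebra k S) K := ((algebraMap A K).comp φ.toRingEquiv.toRingHom).toAlgebra
  have hSK : ∀ x, algebraMap (AddMonoidAlgebra k S) K x = algebraMap A K (φ x) := fun _ => rfl
  let algM := (toTorus k S).toRingHom.toAlgebra
  have hSM : ∀ x, algebraMap (AddMonoidAlgebra k S) (AddMonoidAlgebra k M) x = toTorus k S x := fun _ => rfl
  have : IsScalarTower k (AddMonoidAlgebra k S) K := .of_algebraMap_eq fun c => by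
    rw [hSK, AlgEquiv.commutes, ← IsScalarTower.algebraMap_apply]
  have : IsScalarTower k (AddMonoidAlgebra k S) (AddMonoidAlgebra k M) :=
    .of_algebraMap_eq fun c => ((toTorus k S).commutes c).symm
  have hfrac : IsFractionRing (AddMonoidAlgebra k S) K :=
    IsLocalization.of_ringEquiv_left φ.toRingEquiv
      (MulEquivClass.map_nonZeroDivisors φ.toRingEquiv) hSK
  have hinj : Function.Injective (algebraMap (AddMonoidAlgebra k S) K) := IsFractionRing.injective _ _
  have : IsDomain (AddMonoidAlgebra k S) := hinj.isDomain
  have hl0 : (AddMonoidAlgebra.single ⟨l, h.mem⟩ 1 : AddMonoidAlgebra k S) ≠ 0 :=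
    AddMonoidAlgebra.single_ne_zero.mpr one_ne_zero
  have hl := h.isLocalization_toTorus k
  let f : AddMonoidAlgebra k M →+* K := IsLocalization.Away.lift (g := algebraMap (AddMonoidAlgebra k S) K)
    (AddMonoidAlgebra.single ⟨l, h.mem⟩ 1 : AddMonoidAlgebra k S) (by
      rw [isUnit_iff_ne_zero, Ne, map_eq_zero_iff _ hinj]
      exact hl0)
  let algMK : Algebra (AddMonoidAlgebra k M) K := f.toAlgebra
  have : IsScalarTower (AddMonoidAlgebra k S) (AddMonoidAlgebra k M) K := .of_algebraMap_eq fun x =>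
    (IsLocalization.Away.lift_eq _ _ x).symm
  have hk : IsScalarTower k (AddMonoidAlgebra k M) K := .of_algebraMap_eq fun c => by
    rw [IsScalarTower.algebraMap_apply k (AddMonoidAlgebra k S) K,
      IsScalarTower.algebraMap_apply k (AddMonoidAlgebra k S) (AddMonoidAlgebra k M),
      IsScalarTower.algebraMap_apply (AddMonoidAlgebra k S) (AddMonoidAlgebra k M) K]
  have hMK : IsFractionRing (AddMonoidAlgebra k M) K :=
    IsFractionRing.isFractionRing_of_isLocalization
      (Submonoid.powers (AddMonoidAlgebra.single ⟨l, h.mem⟩ 1 : AddMonoidAlgebra k S)) _ _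
      (powers_le_nonZeroDivisors_of_noZeroDivisors hl0)
  have hchar : ∀ s : S, algebraMap A K (φ (AddMonoidAlgebra.single s 1)) = torusChar k K (s : M) := by
    intro s
    rw [← hSK, IsScalarTower.algebraMap_apply (AddMonoidAlgebra k S) (AddMonoidAlgebra k M) K, hSM,
      toTorus_single, torusChar]
  have hchar' : ∀ s ∈ S, ∃ a : A, algebraMap A K a = torusChar k K s := fun s hs => ⟨_, hchar ⟨s, hs⟩⟩
  have hspan : ∀ a : A, algebraMap A K a ∈ Submodule.span k (torusChar k K '' (S : Set M)) := by
    intro a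
    obtain ⟨x, rfl⟩ := φ.surjective a
    induction x using AddMonoidAlgebra.induction_linear with
    | zero => simp
    | add x y hx hy =>
      rw [map_add, map_add]
      exact Submodule.add_mem _ hx hy
    | single s c =>
      rw [show AddMonoidAlgebra.single s c = c • AddMonoidAlgebra.single s (1 : k) by simp, map_smul,
        ← IsScalarTower.coe_toAlgHom' k A K, map_smul]
      exact Submodule.smul_mem _ _ (Submodule.subset_span ⟨s, s.2, (hchar s).symm⟩)
  constructor
  · intro hiso
    -- The distinguished point: there, by `mem_of_mul_single_mem`, only the characters of `S` are
    -- regular, as `exists_pluckerDatum` requires.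
    let p : PrimeSpectrum A := ⟨(vertexIdeal k S).comap φ.symm.toRingEquiv.toRingHom, inferInstance⟩
    have hG := pluckerModule_eq_span (n := n) (by rintro _ ⟨s, hs, rfl⟩; exact hchar' s hs) hspan
    obtain ⟨x, ⟨t, ht, rfl⟩, hx0, hx⟩ := exists_generator_of_isIso hG p
    choose m hm hmt using ht
    obtain rfl : (fun i => torusChar k K (m i)) = t := funext hmt
    obtain ⟨F, D⟩ := exists_pluckerDatum g (S := S) (p := p.asIdeal) (A := A)
      (by
        rintro q ⟨a, b, hb, hab⟩
        refine mem_of_mul_single_mem (a := φ.symm a) (b := φ.symm b) hb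
          (IsFractionRing.injective (AddMonoidAlgebra k M) K ?_)
        rw [map_mul, ← hSM, ← hSM, ← IsScalarTower.algebraMap_apply, ← IsScalarTower.algebraMap_apply,
          hSK, hSK, φ.apply_symm_apply, φ.apply_symm_apply]
        exact hab)
      (fun c => ⟨algebraMap k A c, (IsScalarTower.algebraMap_apply k A K c).symm⟩) hm hx0
      (fun m' hm' => hx _ (by
        rw [hG]
        exact Submodule.subset_span ⟨_, fun i => ⟨m' i, hm' i, rfl⟩, rfl⟩))
    obtain ⟨κ, _, v, hv, hvS⟩ := h.exists_facetSystem
    exact isSmoothMonoid_of_dual v hvS fun i => D.exists_dual hv hvS hn i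
  · rintro ⟨κ, _, g', J, hJ⟩
    obtain ⟨x, hx, hE⟩ := exists_pluckerModule_eq_span (n := n) (k := k) (A := A) (K := K) g' hchar' hspan hJ
    exact isIso_closureToBase (IsFractionRing.injective A K) hx hE

end AffineCriterion

/-! ### Locality of the projection on the base -/

section LocalOnBase
open Limits
variable {k : Type u} [Field k] {X : Scheme.{u}} [IsIntegral X] (s : X ⟶ Spec (CommRingCat.of k)) (n : ℕ)

lemma isPullback_nashProjection (U : NashIndex X) :
    IsPullback (nashToOpen s n U) (colimit.ι (nashGluingData s n).functor U) U.1.toOpens.ι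
      (nashProjection s n) :=
  (nashGluingData s n).isPullback_natTrans_ι_toBase U

/-- Whether the projection of the Nash modification is an isomorphism can be tested on a cover by
affine open sets. -/
theorem isIso_nashProjection_iff {I : Type*} (U : I → NashIndex X) (hU : ⨆ i, (U i).1.toOpens = ⊤) :
    IsIso (nashProjection s n) ↔ ∀ i, IsIso (closureToBase (nashModule s n (U i).1.toOpens)) := by
  have key : ∀ i, IsIso (closureToBase (nashModule s n (U i).1.toOpens)) ↔ IsIso (nashToOpen s n (U i)) := by
    intro i
    rw [nashToOpen]
    exact ⟨fun _ => inferInstance, fun _ => IsIso.of_isIso_comp_right _ (U i).1.2.isoSpec.inv⟩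
  simp_rw [key]
  constructor
  · intro h i
    exact MorphismProperty.of_isPullback (P := MorphismProperty.isomorphisms Scheme.{u})
      (isPullback_nashProjection s n (U i)).flip h
  · intro h
    refine IsZariskiLocalAtTarget.of_iSup_eq_top (P := MorphismProperty.isomorphisms Scheme.{u})
      (fun i => (U i).1.toOpens) hU fun i => ?_
    -- The restriction of the projection over `U i` and `nashToOpen` are base changes of the same
    -- morphism, hence agree up to an isomorphism of the sources.
    have h1 := isPullback_nashProjection s n (U i)
    have h2 := isPullback_morphismRestrict (nashProjection s n) (U i).1.toOpens
    change IsIso _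
    rw [← IsPullback.isoIsPullback_hom_fst _ _ h2 h1]
    infer_instance

end LocalOnBase

/-! ### Transfer to charts of a scheme -/

section Charts
variable {k R : Type u} [Field k] [CommRing R] [Algebra k R] {X : Scheme.{u}}
  (s : X ⟶ Spec (CommRingCat.of k)) (j : Spec (CommRingCat.of R) ⟶ X) [IsOpenImmersion j]

/-- The identification of the coordinate ring of an affine chart with the ring of sections over its
image. -/
def chartIso : R ≃+* Γ(X, j ''ᵁ ⊤) :=
  ((Scheme.ΓSpecIso (CommRingCat.of R)).symm ≪≫ (j.appIso ⊤).symm).commRingCatIsoToRingEquiv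

lemma chartIso_algebraMap (hj : j ≫ s = Spec.map (CommRingCat.ofHom (algebraMap k R))) (c : k) :
    chartIso j (algebraMap k R c) = structureHom s (j ''ᵁ ⊤) c := by
  have h : CommRingCat.ofHom (algebraMap k R) ≫ (Scheme.ΓSpecIso (CommRingCat.of R)).inv ≫
      (j.appIso ⊤).inv = (Scheme.ΓSpecIso (CommRingCat.of k)).inv ≫ s.appTop ≫
        X.presheaf.map (homOfLE (le_top : j ''ᵁ ⊤ ≤ ⊤)).op := by
    rw [Scheme.ΓSpecIso_inv_naturality_assoc, ← hj]
    rw [Scheme.Hom.comp_appTop, Category.assoc]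
    congr 2
    exact Scheme.Hom.app_appIso_inv j ⊤
  exact congrArg (fun f => f.hom c) h

lemma isRegularLocalRing_stalk_iff (y : PrimeSpectrum R) :
    IsRegularLocalRing (X.presheaf.stalk (j y)) ↔ IsRegularLocalRing (Localization.AtPrime y.asIdeal) := by
  have hiso : ∀ z : Spec (CommRingCat.of R), IsIso (j.stalkMap z) := fun z => inferInstance
  have := hiso y
  have e1 : X.presheaf.stalk (j y) ≃+* (Spec (CommRingCat.of R)).presheaf.stalk y :=
    (asIso (j.stalkMap y)).commRingCatIsoToRingEquiv
  let _ : Algebra R ((Spec (CommRingCat.of R)).presheaf.stalk y) := StructureSheaf.stalkAlgebra R y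
  have : IsLocalization.AtPrime ((Spec (CommRingCat.of R)).presheaf.stalk y) y.asIdeal :=
    StructureSheaf.IsLocalization.to_stalk R y
  have e2 : (Spec (CommRingCat.of R)).presheaf.stalk y ≃+* Localization.AtPrime y.asIdeal :=
    (IsLocalization.algEquiv y.asIdeal.primeCompl _ _).toRingEquiv
  exact ⟨fun h => h.of_ringEquiv (e1.trans e2), fun h => h.of_ringEquiv (e1.trans e2).symm⟩

lemma nonempty_image_top [Nontrivial R] : Nonempty (j ''ᵁ ⊤ : X.Opens) := by
  obtain ⟨y⟩ : Nonempty (PrimeSpectrum R) := inferInstance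
  exact ⟨⟨j y, ⟨y, trivial, rfl⟩⟩⟩

variable (R) in
/-- The image of an affine chart, as an affine open set. -/
def chartIndex [Nontrivial R] : NashIndex X :=
  ⟨⟨j ''ᵁ ⊤, (isAffineOpen_top _).image_of_isOpenImmersion j⟩, nonempty_image_top j⟩

lemma isIso_closureToBase_nashModule_iff_of_ringEquiv [IsIntegral X] {M : Type} [AddCommGroup M]
    {S : AddSubmonoid M} {ι : Type} [Fintype ι] (g : Module.Basis ι ℤ M) {Ψ : Set (M →+ ℤ)} {l : M}
    (h : IsCutOutBy S Ψ l) (U : NashIndex X) (φ : AddMonoidAlgebra k S ≃+* Γ(X, U.1.toOpens))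
    (hφ : ∀ c, φ (algebraMap k _ c) = structureHom s U.1.toOpens c) {n : ℕ} (hn : 1 ≤ n) :
    IsIso (closureToBase (nashModule s n U.1.toOpens)) ↔ IsSmoothMonoid S := by
  let := (structureHom s U.1.toOpens).toAlgebra
  let := ((X.germToFunctionField U.1.toOpens).hom.comp (structureHom s U.1.toOpens)).toAlgebra
  have : IsScalarTower k Γ(X, U.1.toOpens) X.functionField := .of_algebraMap_eq' rfl
  have := functionField_isFractionRing_of_isAffineOpen X U.1.toOpens U.1.2
  exact h.isIso_closureToBase_iff g (AlgEquiv.ofRingEquiv (f := φ) hφ) hn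

/-- The projection of the Nash modification is an isomorphism over an affine toric chart if and only if
the monoid of the chart is smooth. -/
lemma isIso_closureToBase_nashModule_iff [IsIntegral X] {M : Type} [AddCommGroup M] {S : AddSubmonoid M}
    {ι : Type} [Fintype ι] (g : Module.Basis ι ℤ M) {Ψ : Set (M →+ ℤ)} {l : M} (h : IsCutOutBy S Ψ l)
    (j : Spec (CommRingCat.of (AddMonoidAlgebra k S)) ⟶ X) [IsOpenImmersion j]
    (hj : j ≫ s = Spec.map (CommRingCat.ofHom (algebraMap k (AddMonoidAlgebra k S)))) {n : ℕ} (hn : 1 ≤ n) :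
    IsIso (closureToBase (nashModule s n (chartIndex _ j).1.toOpens)) ↔ IsSmoothMonoid S := by
  refine isIso_closureToBase_nashModule_iff_of_ringEquiv s g h _ (chartIso j) ?_ hn
  exact chartIso_algebraMap s j hj

end Charts

/-! ### The charts of a toric variety -/

section ToricCharts
open Limits
variable {k : Type u} [Field k] {X : Scheme.{u}} {d : ℕ} (F : Fan d) (e : X ≅ F.toricScheme k)

/-- The charts of the toric variety of a fan. -/
def fanChart (k : Type u) [Field k] (σ : F.Index) :
    Spec (CommRingCat.of (ConeAlgebra k σ.1)) ⟶ F.toricScheme k :=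
  colimit.ι (F.diagram k) σ

instance (σ : F.Index) : IsOpenImmersion (fanChart F k σ) :=
  inferInstanceAs (IsOpenImmersion (colimit.ι (F.diagram k) σ))

lemma fanChart_comp (σ : F.Index) : fanChart F k σ ≫ F.toricStructure k =
    Spec.map (CommRingCat.ofHom (algebraMap k (ConeAlgebra k σ.1))) :=
  colimit.ι_desc _ _

/-- The charts of a toric variety. -/
def toricChart (σ : F.Index) : Spec (CommRingCat.of (ConeAlgebra k σ.1)) ⟶ X := fanChart F k σ ≫ e.inv

instance (σ : F.Index) : IsOpenImmersion (toricChart F e σ) :=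
  inferInstanceAs (IsOpenImmersion (fanChart F k σ ≫ e.inv))

lemma exists_toricChart_eq (x : X) : ∃ (σ : F.Index) (y : PrimeSpectrum (ConeAlgebra k σ.1)),
    toricChart F e σ y = x := by
  obtain ⟨σ, y, hy⟩ := Scheme.IsLocallyDirected.ι_jointly_surjective (F.diagram k) (e.hom x)
  refine ⟨σ, y, ?_⟩
  refine (congrArg e.inv hy).trans ?_
  rw [← Scheme.Hom.comp_apply, e.hom_inv_id]
  rfl

lemma toricChart_comp {s : X ⟶ Spec (CommRingCat.of k)} (hs : e.hom ≫ F.toricStructure k = s) (σ : F.Index) :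
    toricChart F e σ ≫ s = Spec.map (CommRingCat.ofHom (algebraMap k (ConeAlgebra k σ.1))) := by
  rw [← hs, toricChart, Category.assoc, e.inv_hom_id_assoc, fanChart_comp]

end ToricCharts

end HigherNash

end

/-! ### The main theorem -/

/-- Let `X` be a (normal) toric variety over an algebraically closed field `k` and `n ≥ 1`. Then
the `n`-th Nash modification `π_n : N_n(X) ⟶ X` is an isomorphism if and only if `X` is nonsingular. -/
theorem theorem6p1 {k : Type u} [Field k] [IsAlgClosed k] {X : Scheme.{u}} [IsIntegral X]
    (s : X ⟶ Spec (CommRingCat.of k)) (hX : HigherNash.IsToricVariety s) (n : ℕ) (hn : 1 ≤ n) :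
    IsIso (HigherNash.nashProjection s n) ↔ HigherNash.IsNonsingular X := by
  obtain ⟨d, F, e, hs⟩ := hX
  have hcut := fun σ : F.Index => (F.isSCRPC σ.1 σ.2).exists_isCutOutBy
  rw [HigherNash.isIso_nashProjection_iff s n (fun σ : F.Index => HigherNash.chartIndex _ (HigherNash.toricChart F e σ))]
  · have key : ∀ σ : F.Index, IsIso (HigherNash.closureToBase (HigherNash.nashModule s n
        (HigherNash.chartIndex _ (HigherNash.toricChart F e σ)).1.toOpens)) ↔
          HigherNash.IsSmoothMonoid (HigherNash.dualMonoid σ.1) := by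
      intro σ
      obtain ⟨Ψ, l, h⟩ := hcut σ
      exact HigherNash.isIso_closureToBase_nashModule_iff s (Pi.basisFun ℤ (Fin d)) h _
        (HigherNash.toricChart_comp F e hs σ) hn
    simp_rw [key]
    constructor
    · intro h x
      obtain ⟨σ, y, rfl⟩ := HigherNash.exists_toricChart_eq F e x
      have := (h σ).isRegularRing k
      exact (HigherNash.isRegularLocalRing_stalk_iff (HigherNash.toricChart F e σ) y).mpr
        (isRegularRing_iff.mp this y.asIdeal)
    -- Regularity is needed only at the distinguished point of each chart.
    · intro h σ
      obtain ⟨Ψ, l, hcutσ⟩ := hcut σ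
      have := (HigherNash.isRegularLocalRing_stalk_iff (HigherNash.toricChart F e σ)
        ⟨HigherNash.vertexIdeal k (HigherNash.dualMonoid σ.1), inferInstance⟩).mp (h _)
      exact hcutσ.isSmoothMonoid_of_isRegularLocalRing (k := k) (Pi.basisFun ℤ (Fin d))
  · refine top_le_iff.mp fun x _ => ?_
    obtain ⟨σ, y, rfl⟩ := HigherNash.exists_toricChart_eq F e x
    exact TopologicalSpace.Opens.mem_iSup.mpr ⟨σ, ⟨y, trivial, rfl⟩⟩
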